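/- Let $F$ be a finite extension of $\mathbb Q_p$, $R\subset F$ its maximal compact subring, $\mathfrak q\subset R$ the maximal ideal, $\mathbb F_q=R/\mathfrak q$ the residue field with $q$ elements, and $\|a\|=|N_{F/\mathbb Q_p}(a)|_p$ the normalized absolute value on $F$. Let $\mathcal X$ be an $S$-scheme of finite type, $S=\operatorname{Spec}R$, that is regular over $S$, i.e. smooth over $S$, of relative dimension $n$. For an $R$-algebra $A$ let $\mathcal X(A)$ be the set of $S$-morphisms $\operatorname{Spec}A\to\mathcal X$; give $\mathcal X(R)$ and $\mathcal X(F)$ their $p$-adic topologies. A gauge form on an open subscheme $\mathcal U\subset\mathcal X$ is a section $\omega$ of $\Omega^n_{\mathcal X/S}$ over $\mathcal U$ such that $1\mapsto\omega$ is an isomorphism $\mathcal O_{\mathcal U}\cong\Omega^n_{\mathcal U/S}$. The Weil measure of $\omega$ is the Borel measure $\mu_\omega$ on $\mathcal U(F)$ with the following property: if $\theta\colon W\to F^n$ is an injective system of local $p$-adic analytic parameters on an open set $W\subset\mathcal U(F)$ and $\omega=\theta^*(g\,dt_1\wedge\dots\wedge dt_n)$ on $W$, then on $W$ the measure $\mu_\omega$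 is the pullback under $\theta$ of $\|g(t)\|\,dt$, where $dt$ is the Haar measure on $F^n$ with $\int_{R^n}dt=1$. A canonical $p$-adic measure on $\mathcal X(R)$ is a Borel measure $\mu$ such that, for every Zariski open $\mathcal U\subset\mathcal X$ and every gauge form $\omega$ on $\mathcal U$, the measures $\mu$ and $\mu_\omega$ agree on $\mathcal U(R)$, that is, $\mu(E)=\mu_\omega(E)$ for every Borel set $E\subset\mathcal U(R)$ on which $\mathcal U(R)\to\mathcal U(F)$ is injective (every Borel set $E\subset\mathcal U(R)$ if $\mathcal X$ is separated), where $E$ is identified with its images in $\mathcal X(R)$ and $\mathcal U(F)$. Theorem. For every gauge form $\omega$ on an open subscheme $\mathcal U\subset\mathcal X$ there is exactly one Weil measure $\mu_\omega$ of $\omega$ on $\mathcal U(F)$. There is exactly one canonical $p$-adic measure $\mu$ on $\mathcal X(R)$ (no gauge form on the whole of $\mathcal X$ is required). The set $\mathcal X(\mathbb F_q)$ of $\mathbb F_q$-rational points is finite, and $$\int_{\mathcal X(R)}d\mu=\frac{|\mathcal X(\mathbb F_q)|}{q^n}.$$ -/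

import Mathlib

open CategoryTheory AlgebraicGeometry MeasureTheory Topology
open scoped ENNReal

universe u

noncomputable section

namespace PadicMeasure

/-! ### The local field `F` and its ring of integers

A finite extension `F` of `ℚ_[p]` is given with its (unique) multiplicative norm extending the one
of `ℚ_[p]`, which carries the topology; the normalised absolute value is `absNorm` below. -/

section LocalField

variable (p : ℕ) [Fact p.Prime] (F : Type u) [NontriviallyNormedField F] [NormedAlgebra ℚ_[p] F]

/-- The maximal compact subring `{a | ‖a‖ ≤ 1}` of `F`. -/
def integers : ValuationSubring F :=
  haveI : IsUltrametricDist F := IsUltrametricDist.of_normedAlgebra ℚ_[p]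
  (NormedField.valuation (K := F)).valuationSubring

theorem mem_integers (a : F) : a ∈ integers p F ↔ ‖a‖ ≤ 1 := Iff.rfl

/-- The residue field of the ring of integers. -/
abbrev Residue : Type u := IsLocalRing.ResidueField (integers p F)

variable {F} in
/-- The normalised absolute value `a ↦ p ^ (-ord (N_{F/ℚ_p} a))`. -/
def absNorm (a : F) : ℝ := ‖Algebra.norm ℚ_[p] a‖

/-- The Haar measure on `F ^ n` for which the closed unit polydisc `R ^ n` has measure one. -/
def haar [FiniteDimensional ℚ_[p] F] [MeasurableSpace F] [BorelSpace F] (n : ℕ) :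
    Measure (Fin n → F) :=
  haveI : ProperSpace F := FiniteDimensional.proper ℚ_[p] F
  haveI : SecondCountableTopology F := inferInstance
  Measure.addHaarMeasure
    { carrier := Metric.closedBall (0 : Fin n → F) 1
      isCompact' := isCompact_closedBall _ _
      interior_nonempty' :=
        ⟨0, mem_interior_iff_mem_nhds.2 (Metric.closedBall_mem_nhds _ one_pos)⟩ }

end LocalField

/-! ### Differential forms of top degree -/

section Forms

/-- The map `⋀ⁿ Ω[A/R] → ⋀ⁿ Ω[B/R]` induced by a homomorphism `A → B` of `R`-algebras:
`a da₁ ∧ … ∧ daₙ ↦ φ(a) dφ(a₁) ∧ … ∧ dφ(aₙ)`. -/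
def formMap {R A B : Type u} [CommRing R] [CommRing A] [CommRing B] [Algebra R A] [Algebra R B]
    (φ : A →ₐ[R] B) (n : ℕ) (η : ⋀[A]^n (Ω[A⁄R])) : ⋀[B]^n (Ω[B⁄R]) :=
  letI : Algebra A B := φ.toRingHom.toAlgebra
  haveI : IsScalarTower R A B := IsScalarTower.of_algebraMap_eq' φ.comp_algebraMap.symm
  let ι : (Ω[B⁄R]) [⋀^Fin n]→ₗ[A] ⋀[B]^n (Ω[B⁄R]) :=
    { (exteriorPower.ιMulti B n (M := Ω[B⁄R])).toMultilinearMap.restrictScalars A with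
      map_eq_zero_of_eq' := (exteriorPower.ιMulti B n (M := Ω[B⁄R])).map_eq_zero_of_eq' }
  exteriorPower.alternatingMapLinearEquiv (ι.compLinearMap (KaehlerDifferential.map R R A B)) η

variable {R : Type u} [CommRing R] {X : Scheme.{u}} (f : X ⟶ Spec (.of R))

/-- `Γ(X, V)`, regarded as an `R`-algebra through the structure morphism. -/
def Sections {R : Type u} [CommRing R] {X : Scheme.{u}} (_ : X ⟶ Spec (.of R)) (V : X.Opens) :
    Type u := Γ(X, V)

instance (V : X.Opens) : CommRing (Sections f V) := inferInstanceAs (CommRing Γ(X, V))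

instance (V : X.Opens) : Algebra R (Sections f V) :=
  ((f.appLE ⊤ V le_top).hom.comp (Scheme.ΓSpecIso (.of R)).inv.hom).toAlgebra

/-- Restriction of functions. -/
def Sections.res {V W : X.Opens} (h : W ≤ V) : Sections f V →ₐ[R] Sections f W where
  toRingHom := (X.presheaf.map (homOfLE h).op).hom
  commutes' r := by
    have := f.appLE_map (U := ⊤) (V := V) (V' := W) le_top (homOfLE h).op
    exact congr($(this).hom ((Scheme.ΓSpecIso (.of R)).inv.hom r))

/-- A global section of `Ωⁿ_{X/R} = ⋀ⁿ Ω_{X/R}`: a compatible family of sections over all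
affine open subschemes. -/
structure Form (n : ℕ) where
  val : ∀ V : X.affineOpens, ⋀[Sections f V]^n (Ω[Sections f V⁄R])
  compat : ∀ (V W : X.affineOpens) (h : (W : X.Opens) ≤ V),
    formMap (Sections.res f h) n (val V) = val W

variable {f}

/-- `ω` is a gauge form: `1 ↦ ω` is an isomorphism from the structure sheaf to `Ωⁿ_{X/R}`. -/
def Form.IsGauge {n : ℕ} (ω : Form f n) : Prop :=
  ∀ V : X.affineOpens, Function.Bijective fun a : Sections f V => a • ω.val V

/-- Étale coordinates on `V`: functions whose differentials form a basis of `Ω_{V/R}`. -/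
def IsEtaleCoordinates {n : ℕ} {V : X.Opens} (t : Fin n → Sections f V) : Prop :=
  ∃ b : Module.Basis (Fin n) (Sections f V) (Ω[Sections f V⁄R]),
    ∀ i, b i = KaehlerDifferential.D R (Sections f V) (t i)

/-- The form `dt₁ ∧ … ∧ dtₙ`. -/
def dWedge {n : ℕ} {V : X.Opens} (t : Fin n → Sections f V) :
    ⋀[Sections f V]^n (Ω[Sections f V⁄R]) :=
  exteriorPower.ιMulti (Sections f V) n fun i => KaehlerDifferential.D R (Sections f V) (t i)

end Forms

/-! ### Points with values in a topological algebra -/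

section Points

variable {R : Type u} [CommRing R] {X : Scheme.{u}} (f : X ⟶ Spec (.of R))

/-- The set `X(A)` of `A`-valued points of the `R`-scheme `X`. -/
def Points (A : Type u) [CommRing A] [Algebra R A] : Type u :=
  {x : Spec (.of A) ⟶ X // x ≫ f = Spec.map (CommRingCat.ofHom (algebraMap R A))}

variable {f}

/-- The value `s(x)` of a function `s` on an open subscheme `V` at a point `x ∈ V(A)`. -/
def Points.eval {A : Type u} [CommRing A] [Algebra R A] (x : Points f A) {V : X.Opens}
    (hx : x.1 ⁻¹ᵁ V = ⊤) (s : Sections f V) : A :=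
  (Scheme.ΓSpecIso (.of A)).hom.hom ((x.1.appLE V ⊤ hx.ge).hom s)

/-- The map `X(A) → X(B)` for an `R`-algebra `A` and an `A`-algebra `B`. -/
def Points.map {A : Type u} (B : Type u) [CommRing A] [Algebra R A] [CommRing B] [Algebra R B]
    [Algebra A B] [IsScalarTower R A B] (x : Points f A) : Points f B :=
  ⟨Spec.map (CommRingCat.ofHom (algebraMap A B)) ≫ x.1, by
    rw [Category.assoc, x.2, ← Spec.map_comp, ← CommRingCat.ofHom_comp,
      ← IsScalarTower.algebraMap_eq]⟩

/-- The map `U(A) → X(A)` for an open subscheme `U` of `X`. -/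
def Points.ofOpen {A : Type u} [CommRing A] [Algebra R A] {U : X.Opens}
    (x : Points (U.ι ≫ f) A) : Points f A :=
  ⟨x.1 ≫ U.ι, by rw [Category.assoc, x.2]⟩

/-- The natural topology on `X(A)` for `A = F` or `A = R`: it is generated by the sets of the
points of `V(A)` at which `s` takes a value in `O`, for `V` affine open, `s ∈ Γ(V, 𝒪)` and
`O ⊆ A` open. -/
instance (A : Type u) [CommRing A] [Algebra R A] [TopologicalSpace A] :
    TopologicalSpace (Points f A) :=
  TopologicalSpace.generateFrom
    {Q | ∃ (V : X.affineOpens) (s : Sections f V.1) (O : Set A), IsOpen O ∧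
      Q = {x | ∃ hx : x.1 ⁻¹ᵁ V.1 = ⊤, x.eval hx s ∈ O}}

instance (A : Type u) [CommRing A] [Algebra R A] [TopologicalSpace A] :
    MeasurableSpace (Points f A) := borel _

end Points

/-! ### Weil's measure and the canonical measure -/

section Measure

variable {R : Type u} [CommRing R] {F : Type u} [NontriviallyNormedField F] [Algebra R F]
  {X : Scheme.{u}} {f : X ⟶ Spec (.of R)} {n : ℕ}

/-- The functions `θ₁, …, θₙ` are local analytic parameters at the point `x ∈ X(F)`, and
`ω = c dθ₁ ∧ … ∧ dθₙ` at `x`. The analytic structure of `X(F)` near `x` is given by étale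
coordinates `t₁, …, tₙ` on an affine neighbourhood: `θ = Φ ∘ t` near `x` with `Φ` analytic and of
invertible differential `Φ'`, so that `dθ₁ ∧ … ∧ dθₙ = det Φ' • dt₁ ∧ … ∧ dtₙ` at `x`. -/
def Form.HasCoefficientAt (ω : Form f n) (x : Points f F) (θ : Points f F → Fin n → F) (c : F) :
    Prop :=
  ∃ (V : X.affineOpens) (hx : x.1 ⁻¹ᵁ V.1 = ⊤) (t : Fin n → Sections f V.1) (h : Sections f V.1)
    (Φ : (Fin n → F) → Fin n → F) (Φ' : (Fin n → F) →L[F] Fin n → F),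
    IsEtaleCoordinates t ∧ ω.val V = h • dWedge t ∧
    (∀ᶠ y : Points f F in 𝓝 x, ∃ hy : y.1 ⁻¹ᵁ V.1 = ⊤, θ y = Φ fun i => y.eval hy (t i)) ∧
    AnalyticAt F Φ (fun i => x.eval hx (t i)) ∧
    HasFDerivAt Φ Φ' (fun i => x.eval hx (t i)) ∧
    Φ'.det ≠ 0 ∧ x.eval hx h = c * Φ'.det

/-- `θ` is a system of local analytic parameters on the open set `W ⊆ X(F)`, injective on `W`
(hence a homeomorphism onto an open subset of `F ^ n`), and
`ω = θ^* (g dt₁ ∧ … ∧ dtₙ)` on `W`. -/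
structure Form.IsChart (ω : Form f n) (W : Set (Points f F)) (θ : Points f F → Fin n → F)
    (g : (Fin n → F) → F) : Prop where
  isOpen : IsOpen W
  injOn : Set.InjOn θ W
  coeff : ∀ x ∈ W, ω.HasCoefficientAt x θ (g (θ x))

variable (p : ℕ) [Fact p.Prime] [NormedAlgebra ℚ_[p] F] [FiniteDimensional ℚ_[p] F]
  [MeasurableSpace F] [BorelSpace F]

/-- `ν` is the Weil measure on `X(F)` associated with `ω`: if `ω = θ^* (g dt₁ ∧ … ∧ dtₙ)` on a
chart `W`, then on `W` it is the pullback of the measure `|g(t)| dt` by `θ`. -/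
def Form.IsWeilMeasure (ω : Form f n) (ν : Measure (Points f F)) : Prop :=
  ∀ (W : Set (Points f F)) (θ : Points f F → Fin n → F) (g : (Fin n → F) → F), ω.IsChart W θ g →
    ∀ E ⊆ W, MeasurableSet E →
      ν E = ∫⁻ z in θ '' E, ENNReal.ofReal (absNorm p (g z)) ∂(haar p F n)

/-- `μ` is a canonical `p`-adic measure on `X(R)`: for every Zariski open `U ⊆ X` and every gauge
form `ω` on `U`, it coincides on `U(R)` with the Weil measure of `ω` on `U(F)`. The condition that
`U(R) → U(F)` is injective on `E` always holds if `X` is separated or `U` is affine, and then one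
may regard `U(R)` as a subset of `U(F)`. -/
def IsCanonicalMeasure {X : Scheme.{u}} (f : X ⟶ Spec (.of (integers p F))) (n : ℕ)
    (μ : Measure (Points f (integers p F))) : Prop :=
  ∀ (U : X.Opens) (ω : Form (U.ι ≫ f) n), ω.IsGauge →
    ∀ ν : Measure (Points (U.ι ≫ f) F), ω.IsWeilMeasure p ν →
      ∀ E : Set (Points (U.ι ≫ f) (integers p F)), MeasurableSet E →
        Set.InjOn (Points.map F) E → μ (Points.ofOpen '' E) = ν (Points.map F '' E)

end Measure

end PadicMeasure

end

/-!
Locally a smooth scheme `X` over the ring of integers `R` has étale coordinates `t₁, …, tₙ`: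
functions on an affine open `V` whose differentials are a basis of `Ω[V⁄R]`
(`exists_isEtaleCoordinates`). They make the ring of functions on `V` étale over `R[T₁, …, Tₙ]`, and
both halves of the theorem come from this, one over `F` and the other over `R`.

Over `F`, an étale algebra over the polynomial ring is presented by as many equations as variables,
with invertible Jacobian, so the inverse function theorem shows that `t` is a local homeomorphism
`V(F) → F ^ n` (`exists_localInverse`, `exists_localSection`). A change of coordinates, or more
generally of the local parameters which the definition of the Weil measure admits, is strictly
differentiable, and its Jacobian determinant is the quotient of the coefficients of a form in the
two systems (`Form.HasCoefficientAt.transition`). The Haar measure obeys the change of variables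
formula with the normalised absolute value of this determinant (`lintegral_image_eq`): near a point
the map is its derivative composed with a map `φ` such that `φ - id` is a contraction. Over an
ultrametric field `φ` maps small balls onto balls of the same radius and so preserves the measure,
and a linear map scales it by `|N(det)|_p`. Hence the measures `‖g(t)‖ dt` of two charts agree where
both are defined (`Form.IsChart.lintegral_image_eq`), and as the topology of `X(F)` has a countable
basis they glue to exactly one measure (`Form.existsUnique_isWeilMeasure`).

Over `R`, which is complete, `X(R)` is the disjoint union of the finitely many residue classes, the
fibres of `X(R) → X(𝔽_q)`. A residue class lies in an affine open with étale coordinates `t`, and by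
Hensel's lemma (`exists_lift_of_residue`, `lift_of_residue_unique`) `t` maps it bijectively to a
translate of `𝔪 ^ n`, whose Haar measure is `q ^ (-n)` (`haar_ball`). A gauge form is a unit times
`dt₁ ∧ … ∧ dtₙ`, and a unit takes values of absolute value one on integral points, so on the residue
class the Weil measure of every gauge form is just the Haar measure in the coordinates `t`
(`Form.IsWeilMeasure.apply_image_map`). These Haar measures therefore add up to a canonical measure
of total mass `|X(𝔽_q)| / q ^ n` (`exists_isCanonicalMeasure`). It is the only one, because
`dt₁ ∧ … ∧ dtₙ` is itself a gauge form on the domain of `t` (`IsCanonicalMeasure.eq`).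
-/

namespace PadicMeasure

/-! ### Determinants and Haar measure over `ℚ_p` -/

section PadicHaar
open Measure Metric Matrix
open scoped Pointwise NNReal

variable {p : ℕ} [Fact p.Prime]

/-- Multiplication by `u` scales the Haar measure of `ℚ_p` by `|u|_p`: units preserve `ℤ_p`, and
`ℤ_p` is the disjoint union of `p` translates of `p ℤ_p`. -/
theorem distribHaarChar_padic (u : ℚ_[p]ˣ) : distribHaarChar ℚ_[p] u = ‖(u : ℚ_[p])‖₊ := by
  borelize ℚ_[p]
  have hp0' : (p : ℝ≥0) ≠ 0 := by exact_mod_cast (Fact.out : p.Prime).ne_zero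
  set B : Set ℚ_[p] := closedBall 0 1 with hB
  have hB0 : (addHaar : Measure ℚ_[p]) B ≠ 0 :=
    (measure_closedBall_pos _ _ one_pos).ne'
  have hB1 : (addHaar : Measure ℚ_[p]) B ≠ ∞ := (isCompact_closedBall _ _).measure_lt_top.ne
  have hunit : ∀ v : ℚ_[p]ˣ, ‖(v : ℚ_[p])‖ = 1 → distribHaarChar ℚ_[p] v = 1 := by
    intro v hv
    refine distribHaarChar_eq_of_measure_smul_eq_mul (μ := addHaar) hB0 hB1 ?_
    have : v • B = B := by
      ext x
      rw [Set.mem_smul_set_iff_inv_smul_mem]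
      simp [hB, Units.smul_def, hv]
    rw [this]; simp
  have hp0 : (p : ℚ_[p]) ≠ 0 := by exact_mod_cast (Fact.out : p.Prime).ne_zero
  have hpn : ‖(p : ℚ_[p])‖₊ = (p : ℝ≥0)⁻¹ := by ext; simp
  have hpp : distribHaarChar ℚ_[p] (Units.mk0 (p : ℚ_[p]) hp0) = ‖(p : ℚ_[p])‖₊ := by
    refine distribHaarChar_eq_of_measure_smul_eq_mul (μ := addHaar) hB0 hB1 ?_
    set v : ℚ_[p]ˣ := Units.mk0 (p : ℚ_[p]) hp0 with hv
    have hppos : (0 : ℝ) < p := by exact_mod_cast (Fact.out : p.Prime).pos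
    have hmem : ∀ x : ℚ_[p], x ∈ v • B ↔ ‖x‖ < 1 := by
      intro x
      have h := Padic.norm_lt_pow_iff_norm_le_pow_sub_one x 0
      rw [zpow_zero, zero_sub, _root_.zpow_neg_one] at h
      rw [Set.mem_smul_set_iff_inv_smul_mem, h, hB, mem_closedBall_zero_iff, Units.smul_def,
        hv, Units.val_inv_eq_inv_val, Units.val_mk0, smul_eq_mul, norm_mul, norm_inv,
        Padic.norm_p, inv_inv, mul_comm, ← le_div_iff₀ hppos, one_div]
    have hU : B = ⋃ i : Fin p, (fun x => (i : ℚ_[p]) + x) '' (v • B) := by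
      ext x
      simp only [Set.mem_iUnion, Set.mem_image, hmem]
      constructor
      · intro hx
        have hx : ‖x‖ ≤ 1 := by simpa [hB] using hx
        obtain ⟨m, hm, hmx⟩ := PadicInt.exists_mem_range (⟨x, hx⟩ : ℤ_[p])
        refine ⟨⟨m, hm⟩, x - m, ?_, by simp⟩
        rw [IsLocalRing.mem_maximalIdeal, PadicInt.mem_nonunits] at hmx
        exact hmx
      · rintro ⟨i, y, hy, rfl⟩
        rw [hB, mem_closedBall_zero_iff]
        refine (IsUltrametricDist.norm_add_le_max _ _).trans (max_le ?_ hy.le)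
        exact_mod_cast Padic.norm_int_le_one (i : ℤ)
    have hd : Pairwise (Function.onFun Disjoint
        fun i : Fin p => (fun x => (i : ℚ_[p]) + x) '' (v • B)) := by
      intro i j hij
      rw [Function.onFun, Set.disjoint_left]
      rintro _ ⟨y, hy, rfl⟩ ⟨z, hz, hzy⟩
      rw [hmem] at hy hz
      have h1 : (((i : ℤ) - (j : ℤ) : ℤ) : ℚ_[p]) = z - y := by
        push_cast
        linear_combination -hzy
      have h2 : ‖(((i : ℤ) - (j : ℤ) : ℤ) : ℚ_[p])‖ < 1 := by
        rw [h1, sub_eq_add_neg]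
        refine (IsUltrametricDist.norm_add_le_max _ _).trans_lt (max_lt hz (by rwa [norm_neg]))
      rw [Padic.norm_intCast_lt_one_iff] at h2
      have h3 := Int.eq_zero_of_abs_lt_dvd h2 (by rw [abs_lt]; omega)
      exact hij (Fin.ext (by omega))
    have hvm : MeasurableSet (v • B) := (isClosed_closedBall.measurableSet).const_smul v
    have h1 : (addHaar : Measure ℚ_[p]) B = p * addHaar (v • B) := by
      conv_lhs => rw [hU]
      rw [measure_iUnion hd (fun i => (measurableEmbedding_addLeft _).measurableSet_image' hvm)]
      simp
    rw [h1, ← mul_assoc, hpn, ENNReal.coe_inv hp0', ENNReal.coe_natCast,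
      ENNReal.inv_mul_cancel, one_mul]
    · exact_mod_cast (Fact.out : p.Prime).ne_zero
    · simp
  obtain ⟨k, hk⟩ : ∃ k : ℤ, ‖(u : ℚ_[p])‖ = (p : ℝ) ^ (-k) :=
    ⟨_, Padic.norm_eq_zpow_neg_valuation u.ne_zero⟩
  set v := Units.mk0 (p : ℚ_[p]) hp0
  have hv : distribHaarChar ℚ_[p] (u * (v ^ k)⁻¹) = 1 := by
    apply hunit
    have hppos : (p : ℝ) ≠ 0 := by exact_mod_cast (Fact.out : p.Prime).ne_zero
    rw [Units.val_mul, norm_mul, hk, Units.val_inv_eq_inv_val, Units.val_zpow_eq_zpow_val,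
      Units.val_mk0, norm_inv, Padic.norm_p_zpow, mul_inv_cancel₀]
    exact zpow_ne_zero _ hppos
  rw [map_mul, map_inv, map_zpow, hpp, mul_inv_eq_one₀ (by
    rw [hpn]; exact zpow_ne_zero _ (inv_ne_zero hp0'))] at hv
  rw [hv]
  ext
  rw [NNReal.coe_zpow, hpn, coe_nnnorm, hk]
  simp

variable [MeasurableSpace ℚ_[p]] [BorelSpace ℚ_[p]]

theorem padic_addHaar_preimage_mul (μ : Measure ℚ_[p]) [μ.IsAddHaarMeasure] {a : ℚ_[p]}
    (ha : a ≠ 0) (s : Set ℚ_[p]) :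
    ENNReal.ofReal ‖a‖ * μ ((a * ·) ⁻¹' s) = μ s := by
  have h := distribHaarChar_mul μ (Units.mk0 a ha) ((a * ·) ⁻¹' s)
  rw [distribHaarChar_padic, Units.val_mk0] at h
  rw [ofReal_norm, enorm_eq_nnnorm, h]
  congr 1
  ext x
  rw [Set.mem_smul_set_iff_inv_smul_mem, Units.smul_def]
  simp [ha]

variable {ι : Type*} [Fintype ι] [DecidableEq ι]

/-- A diagonal matrix scales the product Haar measure by the absolute value of its determinant. -/
theorem padic_smul_map_diagonal_pi (μ : Measure ℚ_[p]) [μ.IsAddHaarMeasure] {D : ι → ℚ_[p]}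
    (h : det (diagonal D) ≠ 0) :
    ENNReal.ofReal ‖det (diagonal D)‖ •
      Measure.map (toLin' (diagonal D)) (Measure.pi fun _ : ι => μ) =
        Measure.pi fun _ : ι => μ := by
  refine (Measure.pi_eq fun s hs => ?_).symm
  simp only [det_diagonal, Measure.coe_smul, smul_eq_mul, Pi.smul_apply]
  rw [Measure.map_apply _ (MeasurableSet.univ_pi hs)]
  swap; · exact Continuous.measurable (LinearMap.continuous_on_pi _)
  have :
    (Matrix.toLin' (diagonal D) ⁻¹' Set.pi Set.univ fun i : ι => s i) =
      Set.pi Set.univ fun i : ι => (D i * ·) ⁻¹' s i := by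
    ext f
    simp [diagonal_toLin']
  have B : ∀ i, ENNReal.ofReal ‖D i‖ * μ ((D i * ·) ⁻¹' s i) = μ (s i) := by
    intro i
    refine padic_addHaar_preimage_mul μ ?_ _
    rw [det_diagonal] at h
    exact Finset.prod_ne_zero_iff.1 h i (Finset.mem_univ i)
  rw [this, Measure.pi_pi, norm_prod, ENNReal.ofReal_prod_of_nonneg fun i _ => norm_nonneg (D i),
    ← Finset.prod_mul_distrib]
  simp only [B]

/-- A transvection preserves the product Haar measure: it translates one coordinate by a function of
the others, so Fubini's theorem reduces the claim to translation invariance. -/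
theorem padic_measurePreserving_transvection (μ : Measure ℚ_[p]) [μ.IsAddHaarMeasure]
    (t : TransvectionStruct ι ℚ_[p]) :
    MeasurePreserving (toLin' t.toMatrix) (Measure.pi fun _ : ι => μ)
      (Measure.pi fun _ : ι => μ) := by
  have ht : Measurable (toLin' t.toMatrix) :=
    (toLin' t.toMatrix).continuous_of_finiteDimensional.measurable
  refine ⟨ht, ?_⟩
  refine (pi_eq fun s hs ↦ ?_).symm
  have h2s : MeasurableSet (Set.univ.pi s) := .pi Set.countable_univ fun i _ ↦ hs i
  simp_rw [← pi_pi, ← lintegral_indicator_one h2s]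
  rw [lintegral_map (measurable_one.indicator h2s) ht]
  refine lintegral_eq_of_lmarginal_eq {t.i} ((measurable_one.indicator h2s).comp ht)
    (measurable_one.indicator h2s) ?_
  simp_rw [lmarginal_singleton]
  ext x
  cases t with | mk t_i t_j t_hij t_c =>
  simp [transvection, single_mulVec, t_hij.symm, ← Function.update_add,
    lintegral_add_right_eq_self fun xᵢ ↦ Set.indicator (Set.univ.pi s) 1 (Function.update x t_i xᵢ)]

/-- An invertible matrix is a product of diagonal matrices and transvections, so it scales the
product Haar measure by the absolute value of its determinant. -/
theorem padic_map_matrix_pi (μ : Measure ℚ_[p]) [μ.IsAddHaarMeasure] {M : Matrix ι ι ℚ_[p]}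
    (hM : det M ≠ 0) :
    ENNReal.ofReal ‖det M‖ • Measure.map (Matrix.toLin' M) (Measure.pi fun _ : ι => μ)
      = Measure.pi fun _ : ι => μ := by
  apply diagonal_transvection_induction_of_det_ne_zero _ M hM
  · intro D hD
    exact padic_smul_map_diagonal_pi μ hD
  · intro t
    simp [(padic_measurePreserving_transvection μ t).map_eq]
  · intro A B _ _ IHA IHB
    rw [toLin'_mul, det_mul, LinearMap.coe_comp, ← Measure.map_map, norm_mul,
      ENNReal.ofReal_mul (norm_nonneg _), mul_smul, ← Measure.map_smul, IHB, IHA]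
    · exact Continuous.measurable (LinearMap.continuous_on_pi _)
    · exact Continuous.measurable (LinearMap.continuous_on_pi _)

end PadicHaar

section PadicHaarLinear
open Measure

/-- A linear automorphism of a finite dimensional `ℚ_p`-vector space multiplies the Haar measure by
the `p`-adic absolute value of its determinant. -/
theorem padic_addHaar_image_linearEquiv {p : ℕ} [Fact p.Prime] {E : Type*}
    [NormedAddCommGroup E] [NormedSpace ℚ_[p] E]
    [MeasurableSpace E] [BorelSpace E] [FiniteDimensional ℚ_[p] E] (μ : Measure E)
    [IsAddHaarMeasure μ] (f : E ≃ₗ[ℚ_[p]] E) (s : Set E) :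
    μ (f '' s) = ENNReal.ofReal ‖LinearMap.det (f : E →ₗ[ℚ_[p]] E)‖ * μ s := by
  borelize ℚ_[p]
  let ι := Fin (Module.finrank ℚ_[p] E)
  have e : E ≃ₗ[ℚ_[p]] ι → ℚ_[p] := LinearEquiv.ofFinrankEq E (ι → ℚ_[p]) (by simp [ι])
  have Ce : Continuous e := (e : E →ₗ[ℚ_[p]] ι → ℚ_[p]).continuous_of_finiteDimensional
  have Ces : Continuous e.symm := (e.symm : (ι → ℚ_[p]) →ₗ[ℚ_[p]] E).continuous_of_finiteDimensional
  have : IsAddHaarMeasure (map e μ) := (e : E ≃+ (ι → ℚ_[p])).isAddHaarMeasure_map μ Ce Ces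
  let eh : E ≃ᵐ (ι → ℚ_[p]) := e.toContinuousLinearEquiv.toHomeomorph.toMeasurableEquiv
  let fm : E ≃ᵐ E := f.toContinuousLinearEquiv.toHomeomorph.toMeasurableEquiv
  let M := LinearMap.toMatrix' ((e : E →ₗ[ℚ_[p]] ι → ℚ_[p]) ∘ₗ (f : E →ₗ[ℚ_[p]] E) ∘ₗ
    (e.symm : (ι → ℚ_[p]) →ₗ[ℚ_[p]] E))
  have hdet : M.det = LinearMap.det (f : E →ₗ[ℚ_[p]] E) := by
    rw [LinearMap.det_toMatrix', LinearMap.det_conj]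
  have hM0 : M.det ≠ 0 := by
    rw [hdet]; exact (LinearEquiv.isUnit_det' f).ne_zero
  have key := padic_map_matrix_pi (p := p) addHaar hM0
  -- Haar measures are proportional, so the product measure may be replaced by the image of `μ`
  have hs := isAddLeftInvariant_eq_smul (map e μ)
    (Measure.pi fun _ : ι => (addHaar : Measure ℚ_[p]))
  have key2 : ENNReal.ofReal ‖M.det‖ • map (Matrix.toLin' M) (map e μ) = map e μ := by
    rw [hs, Measure.map_smul, smul_comm, key]
  have h1 := congr($key2 (e '' (f '' s)))
  have hMe : (Matrix.toLin' M : (ι → ℚ_[p]) → ι → ℚ_[p]) ∘ e = e ∘ f := by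
    ext x
    simp [M]
  rw [Measure.map_map (LinearMap.continuous_on_pi _).measurable Ce.measurable, hMe,
    Measure.smul_apply] at h1
  have h2 : map (e ∘ f) μ (e '' (f '' s)) = μ s := by
    have : (e ∘ f) = (fm.trans eh : E → _) := rfl
    rw [this, MeasurableEquiv.map_apply]
    congr 1
    ext x
    simp [fm, eh]
  have h3 : map e μ (e '' (f '' s)) = μ (f '' s) := by
    have : (e : E → _) = eh := rfl
    rw [this, MeasurableEquiv.map_apply, Set.preimage_image_eq _ eh.injective]
  rw [h2, h3, hdet] at h1
  rw [← h1]; rfl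

end PadicHaarLinear

/-! ### Maps close to the identity in ultrametric groups -/

section UltrametricIsometry
open Measure Metric Set
open scoped NNReal

variable {E : Type*} [NormedAddCommGroup E] [IsUltrametricDist E]

/-- A self-map of an ultrametric normed group that differs from the identity by a contraction is an
isometry. -/
theorem norm_sub_eq_of_norm_sub_sub_le {φ : E → E} {c : ℝ} (hc : c < 1) {y z : E}
    (h : ‖φ y - φ z - (y - z)‖ ≤ c * ‖y - z‖) : ‖φ y - φ z‖ = ‖y - z‖ := by
  rcases eq_or_ne y z with rfl | hne
  · simp
  have hpos : 0 < ‖y - z‖ := norm_pos_iff.2 (sub_ne_zero.2 hne)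
  have h1 : ‖φ y - φ z - (y - z)‖ < ‖y - z‖ := by nlinarith
  have h2 := IsUltrametricDist.norm_add_eq_max_of_norm_ne_norm
    (x := φ y - φ z - (y - z)) (y := y - z) h1.ne
  rwa [sub_add_cancel, max_eq_right h1.le] at h2

/-- Such a map sends the closed ball around `a` onto the closed ball of the same radius around the
image of `a`: the preimage of `w` is a fixed point of the contraction `z ↦ z - φ z + w`. -/
theorem image_closedBall_of_norm_sub_sub_le [CompleteSpace E] {φ : E → E} {a : E} {r : ℝ}
    (hr : 0 ≤ r)
    (h : ∀ y ∈ closedBall a r, ∀ z ∈ closedBall a r,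
      ‖φ y - φ z - (y - z)‖ ≤ (1 / 2) * ‖y - z‖) :
    φ '' closedBall a r = closedBall (φ a) r := by
  apply Subset.antisymm
  · rintro _ ⟨y, hy, rfl⟩
    rw [mem_closedBall, dist_eq_norm,
      norm_sub_eq_of_norm_sub_sub_le (by norm_num) (h y hy a (mem_closedBall_self hr))]
    simpa [dist_eq_norm] using hy
  · intro w hw
    let T : E → E := fun z => z - φ z + w
    have hT : MapsTo T (closedBall a r) (closedBall a r) := by
      intro z hz
      have h1 := h a (mem_closedBall_self hr) z hz
      have e : T z - a = (φ a - φ z - (a - z)) + (w - φ a) := by simp only [T]; abel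
      rw [mem_closedBall, dist_eq_norm, e]
      refine (IsUltrametricDist.norm_add_le_max _ _).trans (max_le (h1.trans ?_) ?_)
      · rw [mem_closedBall, dist_comm, dist_eq_norm] at hz
        have := norm_nonneg (a - z)
        linarith
      · simpa [dist_eq_norm] using hw
    have hcon : ContractingWith (1 / 2 : ℝ≥0) (hT.restrict T _ _) := by
      refine ⟨by norm_num, LipschitzWith.of_dist_le_mul fun y z => ?_⟩
      have h1 := h z z.2 y y.2
      rw [Subtype.dist_eq, Subtype.dist_eq, dist_eq_norm, dist_eq_norm]
      have e : T y - T z = φ z - φ y - (z - y) := by simp only [T]; abel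
      simp only [MapsTo.val_restrict_apply, e]
      rw [norm_sub_rev (y : E) z]
      simpa using h1
    obtain ⟨y, hy, hfix, -⟩ := hcon.exists_fixedPoint' isClosed_closedBall.isComplete hT
      (mem_closedBall_self hr) (edist_ne_top _ _)
    refine ⟨y, hy, ?_⟩
    have h1 : y - φ y + w = y := hfix
    have h2 : w - φ y = (y - φ y + w) - y := by abel
    rw [h1, sub_self, sub_eq_zero] at h2
    exact h2.symm

theorem isTopologicalBasis_closedBall :
    TopologicalSpace.IsTopologicalBasis {s : Set E | ∃ a : E, ∃ r > 0, s = closedBall a r} := by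
  refine TopologicalSpace.isTopologicalBasis_of_isOpen_of_nhds ?_ ?_
  · rintro _ ⟨a, r, hr, rfl⟩
    exact IsUltrametricDist.isOpen_closedBall a hr.ne'
  · intro a u ha hu
    obtain ⟨r, hr, h⟩ := Metric.nhds_basis_closedBall.mem_iff.1 (hu.mem_nhds ha)
    exact ⟨_, ⟨a, r, hr, rfl⟩, mem_closedBall_self hr.le, h⟩

variable [MeasurableSpace E] [BorelSpace E] [ProperSpace E]

/-- A self-map of a ball that differs from the identity by a contraction preserves Haar measure: it
maps balls onto balls of the same radius, which all have the same measure and generate the Borel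
sets. -/
theorem measure_image_of_norm_sub_sub_le (μ : Measure E) [μ.IsAddHaarMeasure]
    {φ : E → E} {a : E} {r : ℝ} (hr : 0 < r)
    (h : ∀ y ∈ closedBall a r, ∀ z ∈ closedBall a r,
      ‖φ y - φ z - (y - z)‖ ≤ (1 / 2) * ‖y - z‖) {s : Set E} (hs : s ⊆ closedBall a r)
    (hsm : MeasurableSet s) : μ (φ '' s) = μ s := by
  set B := closedBall a r with hB
  have : SecondCountableTopology E := inferInstance
  let f : B → E := fun y => φ y
  have hf : Isometry f := Isometry.of_dist_eq fun y z => by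
    rw [Subtype.dist_eq, dist_eq_norm, dist_eq_norm]
    exact norm_sub_eq_of_norm_sub_sub_le (by norm_num) (h y y.2 z z.2)
  have hBc : IsClosed B := isClosed_closedBall
  have : CompleteSpace B := hBc.completeSpace_coe
  have hfm : MeasurableEmbedding f := hf.isClosedEmbedding.measurableEmbedding
  have hcoe : MeasurableEmbedding ((↑) : B → E) := MeasurableEmbedding.subtype_coe hBc.measurableSet
  let ν : Measure E := (μ.comap f).map (↑)
  have hν : ∀ t : Set E, ν t = μ (φ '' (t ∩ B)) := by
    intro t
    rw [hcoe.map_apply, hfm.comap_apply]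
    congr 1
    ext x
    simp only [mem_image, mem_preimage, f, Subtype.exists, mem_inter_iff]
    constructor
    · rintro ⟨y, hy, hyt, rfl⟩; exact ⟨y, ⟨hyt, hy⟩, rfl⟩
    · rintro ⟨y, ⟨hyt, hy⟩, rfl⟩; exact ⟨y, hy, hyt, rfl⟩
  have hball : ∀ b ∈ B, ∀ t ≤ r, 0 < t → μ (φ '' closedBall b t) = μ (closedBall b t) := by
    intro b hb t ht h0
    have hsub : closedBall b t ⊆ B := by
      rw [hB, IsUltrametricDist.closedBall_eq_of_mem hb]
      exact closedBall_subset_closedBall ht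
    rw [image_closedBall_of_norm_sub_sub_le h0.le fun y hy z hz => h y (hsub hy) z (hsub hz)]
    have e : (fun y => b - φ b + y) ⁻¹' closedBall b t = closedBall (φ b) t := by
      ext y
      rw [mem_preimage, mem_closedBall, mem_closedBall, dist_eq_norm, dist_eq_norm]
      congr! 2
      abel
    rw [← e, measure_preimage_add]
  have hBfin : μ B < ∞ := (isCompact_closedBall a r).measure_lt_top
  have hνB : ∀ t, ν t = ν (t ∩ B) := fun t => by rw [hν, hν, inter_assoc, inter_self]
  -- the two measures agree on balls, which generate the Borel sets and form a `π`-system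
  have hfinal : μ.restrict B = ν := by
    have : IsFiniteMeasure (μ.restrict B) := ⟨by simpa using hBfin⟩
    refine ext_of_generate_finite _ (BorelSpace.measurable_eq.trans
      isTopologicalBasis_closedBall.borel_eq_generateFrom) ?_ ?_ ?_
    · rintro _ ⟨b, t, ht, rfl⟩ _ ⟨b', t', ht', rfl⟩ ⟨x, hx, hx'⟩
      refine ⟨x, min t t', lt_min ht ht', ?_⟩
      rw [IsUltrametricDist.closedBall_eq_of_mem hx, IsUltrametricDist.closedBall_eq_of_mem hx']
      ext y; simp
    · rintro _ ⟨b, t, ht, rfl⟩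
      rw [hν, Measure.restrict_apply isClosed_closedBall.measurableSet]
      rcases (closedBall b t ∩ B).eq_empty_or_nonempty with he | ⟨x, hx, hx'⟩
      · rw [he]; simp
      · rw [IsUltrametricDist.closedBall_eq_of_mem hx]
        have : closedBall x t ∩ B = closedBall x (min t r) := by
          rw [hB, IsUltrametricDist.closedBall_eq_of_mem hx']
          ext y; simp
        rw [this, hball x hx' _ (min_le_right _ _) (lt_min ht hr)]
    · rw [hν, univ_inter, Measure.restrict_apply_univ,
        hball a (mem_closedBall_self hr.le) r le_rfl hr]
  have := congr($hfinal s)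
  rw [hν, Measure.restrict_apply hsm, inter_eq_self_of_subset_left hs] at this
  exact this.symm

end UltrametricIsometry

/-! ### Change of variables on `F ^ n` -/

section LocalField
open Measure Metric Set
open scoped NNReal

theorem isUltrametricDist_of_padic (p : ℕ) [Fact p.Prime] (F : Type u) [NontriviallyNormedField F]
    [NormedAlgebra ℚ_[p] F] : IsUltrametricDist F := IsUltrametricDist.of_normedAlgebra ℚ_[p]

theorem properSpace_of_padic (p : ℕ) [Fact p.Prime] (F : Type u) [NontriviallyNormedField F]
    [NormedAlgebra ℚ_[p] F] [FiniteDimensional ℚ_[p] F] : ProperSpace F :=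
  FiniteDimensional.proper ℚ_[p] F

variable (p : ℕ) [Fact p.Prime] {F : Type u} [NontriviallyNormedField F] [NormedAlgebra ℚ_[p] F]

theorem absNorm_mul (a b : F) : absNorm p (a * b) = absNorm p a * absNorm p b := by
  simp [absNorm]

theorem absNorm_nonneg (a : F) : 0 ≤ absNorm p a := norm_nonneg _

variable [FiniteDimensional ℚ_[p] F]

variable [MeasurableSpace F] [BorelSpace F] {n : ℕ}

instance isAddHaarMeasure_haar : (haar p F n).IsAddHaarMeasure := by
  have := properSpace_of_padic p F
  have : SecondCountableTopology F := inferInstance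
  unfold haar
  infer_instance

theorem haar_closedBall : haar p F n (closedBall 0 1) = 1 := by
  have := properSpace_of_padic p F
  have : SecondCountableTopology F := inferInstance
  unfold haar
  exact addHaarMeasure_self

/-- An `F`-linear automorphism of `F ^ n` multiplies the Haar measure by the normalised absolute
value of its determinant, because its determinant over `ℚ_p` is the norm of the one over `F`. -/
theorem haar_image_linear (A : (Fin n → F) →L[F] (Fin n → F)) (hA : A.det ≠ 0)
    (s : Set (Fin n → F)) :
    haar p F n (A '' s) = ENNReal.ofReal (absNorm p A.det) * haar p F n s := by
  have := properSpace_of_padic p F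
  have : SecondCountableTopology F := inferInstance
  let e : (Fin n → F) ≃ₗ[F] (Fin n → F) := LinearMap.equivOfDetNeZero (A : (Fin n → F) →ₗ[F] _) hA
  have h := padic_addHaar_image_linearEquiv (p := p) (haar p F n) (e.restrictScalars ℚ_[p]) s
  have h2 : LinearMap.det ((e.restrictScalars ℚ_[p] : (Fin n → F) ≃ₗ[ℚ_[p]] (Fin n → F)) :
      (Fin n → F) →ₗ[ℚ_[p]] (Fin n → F)) = Algebra.norm ℚ_[p] A.det := by
    rw [ContinuousLinearMap.det, ← LinearMap.det_restrictScalars (R := ℚ_[p])]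
    rfl
  rw [h2] at h
  exact h

/-- A map with invertible strict derivative `A` at `x` multiplies the Haar measure by `|det A|`
near `x`. -/
theorem exists_haar_image_eq {φ : (Fin n → F) → (Fin n → F)} {A : (Fin n → F) →L[F] (Fin n → F)}
    {x : Fin n → F} (hφ : HasStrictFDerivAt φ A x) (hA : A.det ≠ 0) :
    ∃ U : Set (Fin n → F), IsOpen U ∧ x ∈ U ∧ ContinuousOn φ U ∧ InjOn φ U ∧
      ∀ s ⊆ U, MeasurableSet s →
        haar p F n (φ '' s) = ENNReal.ofReal (absNorm p A.det) * haar p F n s := by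
  have := properSpace_of_padic p F
  have := isUltrametricDist_of_padic p F
  have : SecondCountableTopology F := inferInstance
  let e : (Fin n → F) ≃L[F] (Fin n → F) :=
    (LinearMap.equivOfDetNeZero (A : (Fin n → F) →ₗ[F] _) hA).toContinuousLinearEquiv
  have he : (e : (Fin n → F) →L[F] (Fin n → F)) = A := rfl
  -- dividing by the derivative reduces to a map with derivative the identity
  let ψ := fun y => e.symm (φ y)
  have hψ : HasStrictFDerivAt ψ (ContinuousLinearMap.id F (Fin n → F)) x := by
    have h1 := e.symm.hasStrictFDerivAt (x := φ x) |>.comp x hφ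
    rw [← he] at h1
    simpa using h1
  have h2 := hψ.isLittleO.def (c := 1 / 2) (by norm_num)
  obtain ⟨r, hr, hb⟩ := Metric.nhds_basis_closedBall.mem_iff.1 h2
  have hd : ∀ y ∈ closedBall x r, ∀ z ∈ closedBall x r,
      ‖ψ y - ψ z - (y - z)‖ ≤ (1 / 2) * ‖y - z‖ := by
    intro y hy z hz
    have : (y, z) ∈ closedBall (x, x) r := by
      rw [← closedBall_prod_same]; exact ⟨hy, hz⟩
    simpa using hb this
  have hφψ : φ = fun y => e (ψ y) := by ext1 y; simp [ψ]
  have hinj : InjOn ψ (closedBall x r) := by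
    intro y hy z hz hyz
    have := norm_sub_eq_of_norm_sub_sub_le (by norm_num) (hd y hy z hz)
    rw [hyz, sub_self, norm_zero, eq_comm, norm_eq_zero, sub_eq_zero] at this
    exact this
  have hcont : ContinuousOn ψ (closedBall x r) := by
    have : LipschitzOnWith 1 ψ (closedBall x r) :=
      LipschitzOnWith.of_dist_le_mul fun y hy z hz => by
      rw [dist_eq_norm, dist_eq_norm, norm_sub_eq_of_norm_sub_sub_le (by norm_num) (hd y hy z hz)]
      simp
    exact this.continuousOn
  refine ⟨closedBall x r, IsUltrametricDist.isOpen_closedBall x hr.ne', mem_closedBall_self hr.le,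
    ?_, ?_, ?_⟩
  · rw [hφψ]; exact e.continuous.comp_continuousOn hcont
  · rw [hφψ]; exact e.injective.comp_injOn hinj
  · intro s hs hsm
    have : φ '' s = A '' (ψ '' s) := by rw [image_image, hφψ]; rfl
    rw [this, haar_image_linear p A hA, measure_image_of_norm_sub_sub_le _ hr hd hs hsm]

/-- Change of variables: if `ψ` is injective on the measurable set `N` and has an invertible strict
derivative `D z` at each `z ∈ N`, then `∫ G'` over `ψ '' N` is `∫ (G' ∘ ψ) |det D|` over `N`.
Neither function has to be measurable. -/
theorem lintegral_image_eq {N : Set (Fin n → F)} (hN : MeasurableSet N)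
    {ψ : (Fin n → F) → (Fin n → F)} (hinj : InjOn ψ N)
    {D : (Fin n → F) → (Fin n → F) →L[F] (Fin n → F)}
    (hD : ∀ z ∈ N, HasStrictFDerivAt ψ (D z) z) (hdet : ∀ z ∈ N, (D z).det ≠ 0)
    (G G' : (Fin n → F) → ℝ≥0∞)
    (hG : ∀ z ∈ N, G z = ENNReal.ofReal (absNorm p (D z).det) * G' (ψ z)) :
    ∫⁻ z in ψ '' N, G' z ∂(haar p F n) = ∫⁻ z in N, G z ∂(haar p F n) := by
  have := properSpace_of_padic p F
  have : SecondCountableTopology F := inferInstance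
  rcases N.eq_empty_or_nonempty with rfl | ⟨z₀, hz₀⟩
  · simp
  have hU : ∀ z : N, ∃ U : Set (Fin n → F), IsOpen U ∧ (z : Fin n → F) ∈ U ∧ ContinuousOn ψ U ∧
      InjOn ψ U ∧ ∀ s ⊆ U, MeasurableSet s →
        haar p F n (ψ '' s) = ENNReal.ofReal (absNorm p (D z).det) * haar p F n s :=
    fun z => exists_haar_image_eq p (hD z z.2) (hdet z z.2)
  choose U hUo hUz hUc hUi hUs using hU
  -- cut `N` into countably many disjoint pieces on each of which `ψ` scales the measure
  obtain ⟨T, hTc, hT⟩ := TopologicalSpace.isOpen_iUnion_countable U hUo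
  have hTne : T.Nonempty := by
    have : (z₀ : Fin n → F) ∈ ⋃ i ∈ T, U i := by
      rw [hT]; exact mem_iUnion.2 ⟨⟨z₀, hz₀⟩, hUz _⟩
    obtain ⟨i, hi, -⟩ := mem_iUnion₂.1 this
    exact ⟨i, hi⟩
  obtain ⟨e, rfl⟩ := hTc.exists_eq_range hTne
  let V : ℕ → Set (Fin n → F) := fun k => N ∩ disjointed (fun k => U (e k)) k
  have hVm : ∀ k, MeasurableSet (V k) := fun k =>
    hN.inter (MeasurableSet.disjointed (fun k => (hUo (e k)).measurableSet) k)
  have hVd : Pairwise (Function.onFun Disjoint V) := fun i j hij =>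
    (disjoint_disjointed (fun k => U (e k)) hij).mono inter_subset_right inter_subset_right
  have hVU : ∀ k, V k ⊆ U (e k) := fun k =>
    inter_subset_right.trans (disjointed_subset (fun k => U (e k)) k)
  have hVN : ∀ k, V k ⊆ N := fun k => inter_subset_left
  have hNV : N = ⋃ k, V k := by
    rw [← inter_iUnion, iUnion_disjointed, eq_comm, inter_eq_left]
    intro z hz
    have : z ∈ ⋃ i ∈ range e, U i := by
      rw [hT]; exact mem_iUnion.2 ⟨⟨z, hz⟩, hUz _⟩
    simpa using this
  have hemb : ∀ k, MeasurableEmbedding ((V k).domRestrict ψ) := fun k =>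
    ContinuousOn.measurableEmbedding (hVm k) ((hUc _).mono (hVU k)) ((hUi _).mono (hVU k))
  have hψV : ∀ k, MeasurableSet (ψ '' V k) := fun k => by
    rw [← range_domRestrict]; exact (hemb k).measurableSet_range
  -- the scaling factor of `ψ` is constant on each piece
  have hconst : ∀ k, ∀ z ∈ V k, ENNReal.ofReal (absNorm p (D z).det)
      = ENNReal.ofReal (absNorm p (D (e k)).det) := by
    intro k z hz
    obtain ⟨O, hO, hzO, -, -, hOs⟩ := exists_haar_image_eq p (hD z (hVN k hz)) (hdet z (hVN k hz))
    have hnhds : O ∩ U (e k) ∈ 𝓝 z :=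
      Filter.inter_mem (hO.mem_nhds hzO) ((hUo _).mem_nhds (hVU k hz))
    obtain ⟨r, hr, hb⟩ := Metric.nhds_basis_closedBall.mem_iff.1 hnhds
    have h1 := hOs _ (hb.trans inter_subset_left) isClosed_closedBall.measurableSet
    have h2 := hUs (e k) _ (hb.trans inter_subset_right) isClosed_closedBall.measurableSet
    rw [h1] at h2
    exact (ENNReal.mul_left_inj (measure_closedBall_pos _ _ hr).ne'
      (isCompact_closedBall _ _).measure_lt_top.ne).1 h2
  have hmain : ∀ k, ∫⁻ z in ψ '' V k, G' z ∂(haar p F n) = ∫⁻ z in V k, G z ∂(haar p F n) := by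
    intro k
    set c := ENNReal.ofReal (absNorm p (D (e k)).det) with hc
    have hcoe : MeasurableEmbedding ((↑) : V k → (Fin n → F)) :=
      MeasurableEmbedding.subtype_coe (hVm k)
    have hmap : (haar p F n).restrict (ψ '' V k)
        = c • ((haar p F n).comap (↑)).map ((V k).domRestrict ψ) := by
      ext s hs
      rw [Measure.restrict_apply hs, Measure.smul_apply, (hemb k).map_apply, hcoe.comap_apply,
        smul_eq_mul]
      have e1 : ((↑) : V k → (Fin n → F)) '' ((V k).domRestrict ψ ⁻¹' s) = V k ∩ ψ ⁻¹' s := by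
        ext; simp [and_comm]
      have e2 : s ∩ ψ '' V k = ψ '' (V k ∩ ψ ⁻¹' s) := by
        rw [image_inter_preimage, inter_comm]
      rw [e1, e2, ← hUs (e k) _ (inter_subset_left.trans (hVU k))]
      rw [← e1]
      exact hcoe.measurableSet_image.2 ((hemb k).measurable hs)
    rw [hmap, lintegral_smul_measure, (hemb k).lintegral_map, smul_eq_mul,
      ← lintegral_const_mul' _ _ ENNReal.ofReal_ne_top]
    have e3 : ∀ z : V k, c * G' ((V k).domRestrict ψ z) = G z := fun z => by
      rw [hG z (hVN k z.2), hconst k z z.2]; rfl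
    refine (lintegral_congr e3).trans ?_
    rw [← hcoe.lintegral_map, map_comap_subtype_coe (hVm k)]
  rw [hNV, image_iUnion, lintegral_iUnion hψV ?_, lintegral_iUnion hVm hVd]
  · exact tsum_congr hmain
  · intro i j hij
    refine Set.disjoint_left.2 ?_
    rintro _ ⟨y, hy, rfl⟩ ⟨z, hz, hzy⟩
    rw [hinj (hVN j hz) (hVN i hy) hzy] at hz
    exact Set.disjoint_left.1 (hVd hij) hy hz

end LocalField

/-! ### Étale coordinates on smooth algebras -/

section EtaleAlgebra
open KaehlerDifferential

variable {R A : Type*} [CommRing R] [CommRing A] [Algebra R A] {n : ℕ}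

/-- A smooth algebra is étale over the polynomial ring generated by étale coordinates. -/
theorem etale_mvPolynomial_of_basis [Algebra.Smooth R A] {t : Fin n → A}
    [Algebra (MvPolynomial (Fin n) R) A] [IsScalarTower R (MvPolynomial (Fin n) R) A]
    (ht : ∀ i, algebraMap (MvPolynomial (Fin n) R) A (MvPolynomial.X i) = t i)
    (b : Module.Basis (Fin n) A (Ω[A⁄R])) (hb : ∀ i, b i = D R A (t i)) :
    Algebra.Etale (MvPolynomial (Fin n) R) A := by
  let S := MvPolynomial (Fin n) R
  -- the base change of the basis `dTᵢ` is mapped to the basis `dtᵢ`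
  let c : Module.Basis (Fin n) A (TensorProduct S A (Ω[S⁄R])) :=
    (mvPolynomialBasis R (Fin n)).baseChange A
  have hc : ∀ i, mapBaseChange R S A (c i) = b i := by
    intro i
    simp [c, mapBaseChange_tmul, mvPolynomialBasis_apply, map_D, ht, hb, S]
  have he : mapBaseChange R S A = (c.equiv b (Equiv.refl _) : _ →ₗ[A] _) :=
    c.ext fun i => by rw [hc]; simp
  have hbij : Function.Bijective (mapBaseChange R S A) := by
    rw [he]; exact (c.equiv b (Equiv.refl _)).bijective
  -- the exact sequence of differentials then gives `Ω[A⁄S] = 0` and `H₁(L_{A/S}) = 0`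
  have h1 : Subsingleton (Ω[A⁄S]) := by
    refine subsingleton_of_forall_eq 0 fun y => ?_
    obtain ⟨z, rfl⟩ := KaehlerDifferential.map_surjective R S A y
    obtain ⟨w, rfl⟩ := hbij.2 z
    exact (exact_mapBaseChange_map R S A _).2 ⟨w, rfl⟩
  have h2 : Subsingleton (Algebra.H1Cotangent S A) := by
    refine subsingleton_of_forall_eq 0 fun y => ?_
    have hδ : Algebra.H1Cotangent.δ R S A y = 0 := by
      apply hbij.1
      rw [map_zero]
      exact (Algebra.H1Cotangent.exact_δ_mapBaseChange R S A _).2 ⟨y, rfl⟩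
    obtain ⟨w, rfl⟩ := (Algebra.H1Cotangent.exact_map_δ R S A _).1 hδ
    rw [Subsingleton.elim w 0, map_zero]
  have h3 : Algebra.FinitePresentation S A :=
    Algebra.FinitePresentation.of_restrict_scalars_finitePresentation R S A
  exact { formallyEtale := ⟨h1, h2⟩ }

end EtaleAlgebra

/-! ### The inverse function theorem for étale coordinates -/

section LocalInverse
open KaehlerDifferential Filter

variable {R : Type*} [CommRing R] {F : Type*} [NontriviallyNormedField F] [Algebra R F] {n : ℕ}
  {ι : Type*}

/-- Evaluation of a polynomial in two groups of variables. -/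
noncomputable def evalPair (q : (Fin n → F) × (ι → F)) :
    MvPolynomial ι (MvPolynomial (Fin n) R) →+* F :=
  MvPolynomial.eval₂Hom (MvPolynomial.eval₂Hom (algebraMap R F) q.1) q.2

theorem exists_hasStrictFDerivAt_eval₂ (a : MvPolynomial (Fin n) R) (z : Fin n → F) :
    ∃ L : (Fin n → F) →L[F] F,
      HasStrictFDerivAt (fun z => MvPolynomial.eval₂Hom (algebraMap R F) z a) L z := by
  induction a using MvPolynomial.induction_on with
  | C r => exact ⟨0, by simpa using! hasStrictFDerivAt_const _ _⟩
  | add a b ha hb =>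
    obtain ⟨L, hL⟩ := ha
    obtain ⟨M, hM⟩ := hb
    exact ⟨_, by simpa using! hL.add hM⟩
  | mul_X a i ha =>
    obtain ⟨L, hL⟩ := ha
    exact ⟨_, by
      simpa using! hL.mul (hasStrictFDerivAt_apply (𝕜 := F) (F' := fun _ : Fin n => F) i z)⟩

/-- A polynomial function in two groups of variables is strictly differentiable, and its derivative
along the second group is given by the formal partial derivatives. -/
theorem exists_hasStrictFDerivAt_evalPair [Fintype ι] (P : MvPolynomial ι (MvPolynomial (Fin n) R))
    (q : (Fin n → F) × (ι → F)) :
    ∃ L : ((Fin n → F) × (ι → F)) →L[F] F, HasStrictFDerivAt (fun q => evalPair q P) L q ∧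
      ∀ v, L (0, v) = ∑ i, evalPair q (MvPolynomial.pderiv i P) * v i := by
  classical
  induction P using MvPolynomial.induction_on with
  | C a =>
    obtain ⟨L, hL⟩ := exists_hasStrictFDerivAt_eval₂ a q.1
    refine ⟨L ∘L ContinuousLinearMap.fst F _ _, ?_, fun v => by simp⟩
    simpa [evalPair] using! HasStrictFDerivAt.comp q hL hasStrictFDerivAt_fst
  | add a b ha hb =>
    obtain ⟨L, hL, hL'⟩ := ha
    obtain ⟨M, hM, hM'⟩ := hb
    refine ⟨L + M, by simpa using! hL.add hM, fun v => ?_⟩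
    simp [hL', hM', add_mul, Finset.sum_add_distrib]
  | mul_X a i ha =>
    obtain ⟨L, hL, hL'⟩ := ha
    have hX : HasStrictFDerivAt (fun q : (Fin n → F) × (ι → F) => q.2 i)
        ((ContinuousLinearMap.proj i : (ι → F) →L[F] F) ∘L
          ContinuousLinearMap.snd F (Fin n → F) (ι → F)) q :=
      ((ContinuousLinearMap.proj i : (ι → F) →L[F] F) ∘L
          ContinuousLinearMap.snd F (Fin n → F) (ι → F)).hasStrictFDerivAt
    refine ⟨_, by simpa [evalPair] using! hL.mul hX, fun v => ?_⟩
    simp only [add_apply, smul_apply, smul_eq_mul,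
      hL', Derivation.leibniz, map_add, map_mul, ContinuousLinearMap.comp_apply,
      ContinuousLinearMap.proj_apply, MvPolynomial.pderiv_X, add_mul, Finset.sum_add_distrib,
      Finset.mul_sum]
    congr 1
    · rw [Finset.sum_eq_single i]
      · simp [evalPair]
      · intro j _ hj
        simp [hj.symm]
      · simp
    · refine Finset.sum_congr rfl fun j _ => ?_
      simp [evalPair]; ring

variable {A : Type*} [CommRing A] [Algebra R A]

/-- Let `τ` be a family of points, parametrised by the values of the functions `t`, along which all
functions are differentiable. Differentiation along `τ` is a derivation of `A`, so it factors
through the module of differentials, and the derivative of `s` is read off from the expression of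
`ds`. -/
theorem hasStrictFDerivAt_of_derivation {t : Fin n → A} {x : A →ₐ[R] F}
    {τ : (Fin n → F) → (A →ₐ[R] F)} (hx : τ (fun i => x (t i)) = x)
    (hτ : ∀ᶠ z in 𝓝 (fun i => x (t i)), ∀ i, τ z (t i) = z i)
    (hd : ∀ s, ∃ L : (Fin n → F) →L[F] F,
      HasStrictFDerivAt (fun z => τ z s) L (fun i => x (t i)))
    (s : A) (c : Fin n → A) (hs : D R A s = ∑ j, c j • D R A (t j)) :
    HasStrictFDerivAt (fun z => τ z s)
      (∑ j, x (c j) • (ContinuousLinearMap.proj j : (Fin n → F) →L[F] F)) (fun i => x (t i)) := by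
  choose L hL using hd
  have hunique : ∀ {f : (Fin n → F) → F} {M M' : (Fin n → F) →L[F] F},
      HasStrictFDerivAt f M (fun i => x (t i)) → HasStrictFDerivAt f M' (fun i => x (t i)) →
      M = M' := fun h h' => h.hasFDerivAt.unique h'.hasFDerivAt
  let : Module A F := Module.compHom F (x : A →+* F)
  have hsm : ∀ (a : A) (y : F), a • y = x a * y := fun _ _ => rfl
  have : IsScalarTower R A F := ⟨fun r a y => by
    rw [hsm, hsm, map_smul, Algebra.smul_def, Algebra.smul_def, mul_assoc]⟩
  suffices h : L s = ∑ j, x (c j) • (ContinuousLinearMap.proj j : (Fin n → F) →L[F] F) from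
    h ▸ hL s
  ext1 v
  -- differentiation in the direction `v` is a derivation of `A` along `x`
  let δ : Derivation R A F := Derivation.mk'
    { toFun := fun a => L a v
      map_add' := fun a a' => by
        have h1 : HasStrictFDerivAt (fun z => τ z (a + a')) (L a + L a') (fun i => x (t i)) := by
          simpa using! (hL a).add (hL a')
        rw [hunique (hL _) h1]; rfl
      map_smul' := fun r a => by
        have h1 : HasStrictFDerivAt (fun z => τ z (r • a)) (algebraMap R F r • L a)
            (fun i => x (t i)) := by
          have e : (fun z => τ z (r • a)) = algebraMap R F r • fun z => τ z a := by
            ext z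
            simp [Algebra.smul_def]
          rw [e]
          exact (hL a).const_smul (algebraMap R F r)
        rw [hunique (hL _) h1]
        simp [Algebra.smul_def] } fun a a' => by
      have h1 := (hL a).mul (hL a')
      rw [hx] at h1
      have h2 : HasStrictFDerivAt (fun z => τ z (a * a')) (x a • L a' + x a' • L a)
          (fun i => x (t i)) := by
        simpa using! h1
      change L (a * a') v = _
      rw [hunique (hL _) h2]
      simp [hsm]
  have hδ : ∀ a, δ a = L a v := fun _ => rfl
  have ht : ∀ j, δ (t j) = v j := by
    intro j
    have h1 : HasStrictFDerivAt (fun z => τ z (t j))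
        (ContinuousLinearMap.proj j : (Fin n → F) →L[F] F)
        (fun i => x (t i)) := by
      refine ((ContinuousLinearMap.proj j : (Fin n → F) →L[F] F).hasStrictFDerivAt
        (x := fun i => x (t i))).congr_of_eventuallyEq ?_
      filter_upwards [hτ] with z hz
      exact (hz j).symm
    rw [hδ, hunique (hL _) h1]; rfl
  have h3 : L s v = δ.liftKaehlerDifferential (D R A s) := by
    rw [Derivation.liftKaehlerDifferential_comp_D, hδ]
  rw [h3, hs, map_sum]
  simp [Derivation.liftKaehlerDifferential_comp_D, hsm, ht]

/-- Étale coordinates `t` identify a neighbourhood of `x` in the set of `F`-points of a smooth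
algebra with an open subset of `F ^ n`: there is a local inverse `τ`, and a function `s` with
`ds = ∑ cⱼ dtⱼ` has partial derivatives `cⱼ(x)` in the coordinates `t`. -/
theorem exists_localInverse [CompleteSpace F] [Algebra.Smooth R A] {t : Fin n → A}
    (b : Module.Basis (Fin n) A (Ω[A⁄R])) (hb : ∀ i, b i = D R A (t i)) (x : A →ₐ[R] F) :
    ∃ τ : (Fin n → F) → (A →ₐ[R] F),
      (∀ᶠ y in comap (fun (y : A →ₐ[R] F) s => y s) (𝓝 (fun s => x s)),
        τ (fun i => y (t i)) = y) ∧
      (∀ᶠ z in 𝓝 (fun i => x (t i)), ∀ i, τ z (t i) = z i) ∧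
      ∀ (s : A) (c : Fin n → A), D R A s = ∑ j, c j • D R A (t j) →
        HasStrictFDerivAt (fun z => τ z s)
          (∑ j, x (c j) • (ContinuousLinearMap.proj j : (Fin n → F) →L[F] F))
            (fun i => x (t i)) := by
  classical
  let : Algebra (MvPolynomial (Fin n) R) A := (MvPolynomial.aeval t).toAlgebra
  have : IsScalarTower R (MvPolynomial (Fin n) R) A :=
    IsScalarTower.of_algebraMap_eq' (MvPolynomial.aeval t).comp_algebraMap.symm
  have ht : ∀ i, algebraMap (MvPolynomial (Fin n) R) A (MvPolynomial.X i) = t i :=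
    fun i => MvPolynomial.aeval_X t i
  have hE := etale_mvPolynomial_of_basis ht b hb
  rw [Algebra.Etale.iff_isStandardSmoothOfRelativeDimension_zero] at hE
  obtain ⟨ι, σ, hσ, hι, P, hP⟩ := hE.out
  cases nonempty_fintype ι
  cases nonempty_fintype σ
  have hcard : Fintype.card σ = Fintype.card ι := by
    have h1 := P.card_relations_le_card_vars_of_isFinite
    have h2 : Nat.card ι - Nat.card σ = 0 := hP
    rw [← Nat.card_eq_fintype_card, ← Nat.card_eq_fintype_card]; omega
  have hmap : Function.Bijective P.map :=
    (Fintype.bijective_iff_injective_and_card _).2 ⟨P.map_inj, hcard⟩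
  -- the coordinates of a point, and the description of points by coordinates
  let pt : (A →ₐ[R] F) → (Fin n → F) × (ι → F) := fun y => (fun i => y (t i), fun i => y (P.val i))
  have hpt : ∀ (y : A →ₐ[R] F) (Q : MvPolynomial ι (MvPolynomial (Fin n) R)),
      y (MvPolynomial.aeval P.val Q) = evalPair (pt y) Q := by
    intro y Q
    have : (y : A →+* F).comp (MvPolynomial.aeval P.val : _ →ₐ[MvPolynomial (Fin n) R] A).toRingHom
        = evalPair (pt y) := by
      refine MvPolynomial.ringHom_ext (fun a => ?_) (fun i => by simp [evalPair, pt])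
      have : (y : A →+* F).comp (algebraMap (MvPolynomial (Fin n) R) A)
          = MvPolynomial.eval₂Hom (algebraMap R F) (pt y).1 := by
        refine MvPolynomial.ringHom_ext (fun r => ?_) (fun i => by simp [pt, ht])
        have := IsScalarTower.algebraMap_apply R (MvPolynomial (Fin n) R) A r
        rw [MvPolynomial.algebraMap_eq] at this
        simp [← this]
      simpa [evalPair] using! congr($this a)
    exact congr($this Q)
  have hptinj : Function.Injective pt := by
    intro y y' h
    ext s
    obtain ⟨Q, rfl⟩ := P.aeval_val_surjective s
    rw [hpt, hpt, h]
  have hptsurj : ∀ q : (Fin n → F) × (ι → F), (∀ j, evalPair q (P.relation j) = 0) →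
      ∃ y, pt y = q := by
    intro q hq
    let g : MvPolynomial ι (MvPolynomial (Fin n) R) →+* F := evalPair q
    let π : MvPolynomial ι (MvPolynomial (Fin n) R) →+* A :=
      (MvPolynomial.aeval P.val : _ →ₐ[MvPolynomial (Fin n) R] A).toRingHom
    have hπ : Function.Surjective π := P.aeval_val_surjective
    have hk : RingHom.ker π ≤ RingHom.ker g := by
      have h1 : P.ker = RingHom.ker π := by
        rw [Algebra.Generators.ker_eq_ker_aeval_val]; rfl
      rw [← h1, ← P.span_range_relation_eq_ker, Ideal.span_le]
      rintro _ ⟨j, rfl⟩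
      exact hq j
    let y₀ : A →+* F := RingHom.liftOfSurjective π hπ ⟨g, hk⟩
    have hy₀ : ∀ Q, y₀ (π Q) = evalPair q Q := fun Q =>
      RingHom.liftOfRightInverse_comp_apply π _ _ ⟨g, hk⟩ Q
    have hC : ∀ a : MvPolynomial (Fin n) R, π (MvPolynomial.C a) = algebraMap _ A a := fun a => by
      simp [π]
    refine ⟨⟨y₀, fun r => ?_⟩, ?_⟩
    · have := hy₀ (MvPolynomial.C (MvPolynomial.C r))
      rw [hC, ← MvPolynomial.algebraMap_eq, ← IsScalarTower.algebraMap_apply] at this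
      simpa [evalPair] using this
    · refine Prod.ext (funext fun i => ?_) (funext fun i => ?_)
      · have := hy₀ (MvPolynomial.C (MvPolynomial.X i))
        rw [hC, ht] at this
        exact (by simpa [evalPair] using this : y₀ (t i) = q.1 i)
      · have := hy₀ (MvPolynomial.X i)
        exact (by simpa [evalPair, π] using this : y₀ (P.val i) = q.2 i)
  choose L hL hL' using fun j => exists_hasStrictFDerivAt_evalPair (P.relation j) (pt x)
  let e : σ ≃ ι := Equiv.ofBijective _ hmap
  -- the points of `A` are the zeros of the second component of `G`, and `t` is the first one
  let G : (Fin n → F) × (ι → F) → (Fin n → F) × (ι → F) := fun q =>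
    (q.1, fun i => evalPair q (P.relation (e.symm i)))
  let G' : ((Fin n → F) × (ι → F)) →L[F] (Fin n → F) × (ι → F) :=
    (ContinuousLinearMap.fst F _ _).prod (ContinuousLinearMap.pi fun i => L (e.symm i))
  have hG : HasStrictFDerivAt G G' (pt x) :=
    hasStrictFDerivAt_fst.prodMk (hasStrictFDerivAt_pi.2 fun i => hL _)
  -- the relations have an invertible Jacobian matrix, so the derivative of `G` is invertible
  have hinj : Function.Injective G' := by
    rw [injective_iff_map_eq_zero]
    rintro ⟨u, v⟩ huv
    have hu : u = 0 := congr($huv.1)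
    subst hu
    have hv : ∀ j, ∑ i, evalPair (pt x) (MvPolynomial.pderiv i (P.relation j)) * v i = 0 := by
      intro j
      rw [← hL']
      have := congr($huv.2 (e j))
      simpa [G'] using this
    let M : Matrix σ σ F := P.jacobiMatrix.map (evalPair (pt x))
    have hM : IsUnit M.det := by
      have h1 := P.jacobian_isUnit.map x
      rw [P.jacobian_eq_jacobiMatrix_det] at h1
      have h2 : ∀ Q, algebraMap P.Ring A Q = MvPolynomial.aeval P.val Q := fun Q => by
        rw [P.algebraMap_eq]; rfl
      rw [h2, hpt] at h1
      rw [show M.det = _ from (RingHom.map_det (evalPair (pt x)) P.jacobiMatrix).symm]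
      exact h1
    have h0 : Matrix.vecMul (fun j => v (e j)) M = 0 := by
      ext j
      simp only [Matrix.vecMul, dotProduct, Pi.zero_apply]
      rw [← hv j, ← e.sum_comp]
      refine Finset.sum_congr rfl fun i _ => ?_
      change v (e i) * evalPair (pt x) (P.jacobiMatrix i j) = _
      rw [P.jacobiMatrix_apply, mul_comm]
      rfl
    have h1 : (fun j => v (e j)) = 0 :=
      Matrix.eq_zero_of_vecMul_eq_zero hM.ne_zero h0
    have h2 : v = 0 := by
      ext i
      have := congr($h1 (e.symm i))
      simpa using this
    rw [h2]; rfl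
  let E : ((Fin n → F) × (ι → F)) ≃L[F] (Fin n → F) × (ι → F) :=
    (LinearEquiv.ofInjectiveEndo (G' : _ →ₗ[F] _) hinj).toContinuousLinearEquiv
  have hG2 : HasStrictFDerivAt G (E : _ →L[F] _) (pt x) := by
    rw [show (E : _ →L[F] _) = G' from ContinuousLinearMap.ext fun _ => rfl]
    exact hG
  have hGpt : ∀ y, G (pt y) = ((fun i => y (t i)), 0) := by
    intro y
    refine Prod.ext rfl (funext fun i => ?_)
    have h0 : MvPolynomial.aeval P.val (P.relation (e.symm i)) = 0 := by
      have : P.relation (e.symm i) ∈ P.ker := by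
        rw [← P.span_range_relation_eq_ker]; exact Ideal.subset_span ⟨_, rfl⟩
      rw [Algebra.Generators.ker_eq_ker_aeval_val] at this
      exact this
    change evalPair (pt y) _ = 0
    rw [← hpt, h0, map_zero]
  have hHs := hG2.to_localInverse
  have hHr := hG2.eventually_right_inverse
  have hHl := hG2.eventually_left_inverse
  rw [hGpt x] at hHs hHr
  let jj : (Fin n → F) → (Fin n → F) × (ι → F) := fun z => (z, 0)
  have hjj : HasStrictFDerivAt jj (ContinuousLinearMap.inl F _ _) (fun i => x (t i)) :=
    (ContinuousLinearMap.inl F (Fin n → F) (ι → F)).hasStrictFDerivAt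
  have hr : ∀ᶠ z in 𝓝 (fun i => x (t i)), G (hG2.localInverse G E (pt x) (jj z)) = jj z :=
    hjj.continuousAt.eventually hHr
  -- the point with coordinates given by the local inverse of `G` at `(z, 0)`
  have hτ : ∀ z, ∃ y : A →ₐ[R] F, G (hG2.localInverse G E (pt x) (jj z)) = jj z →
      pt y = hG2.localInverse G E (pt x) (jj z) := by
    intro z
    by_cases hz : G (hG2.localInverse G E (pt x) (jj z)) = jj z
    · obtain ⟨y, hy⟩ := hptsurj (hG2.localInverse G E (pt x) (jj z)) fun j => by
        have := congr($hz.2 (e j))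
        simpa [G, jj] using this
      exact ⟨y, fun _ => hy⟩
    · exact ⟨x, fun h => absurd h hz⟩
  choose τ hτ using hτ
  have hleft : ∀ᶠ y in comap (fun (y : A →ₐ[R] F) s => y s) (𝓝 (fun s => x s)),
      τ (fun i => y (t i)) = y := by
    have hcont : Tendsto pt (comap (fun (y : A →ₐ[R] F) s => y s) (𝓝 (fun s => x s)))
        (𝓝 (pt x)) := by
      have h1 : Continuous fun (y : A → F) =>
          ((fun i => y (t i), fun i => y (P.val i)) : (Fin n → F) × (ι → F)) := by fun_prop
      exact (h1.tendsto _).comp tendsto_comap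
    filter_upwards [hcont.eventually hHl] with y hy
    rw [hGpt] at hy
    apply hptinj
    rw [hτ _ (by change G (hG2.localInverse G E (pt x) (_, 0)) = _; rw [hy, hGpt])]
    exact hy
  have hright : ∀ᶠ z in 𝓝 (fun i => x (t i)), ∀ i, τ z (t i) = z i := by
    filter_upwards [hr] with z hz i
    have h1 := congr($(hτ z hz).1 i)
    have h2 := congr($(hz).1 i)
    exact h1.trans h2
  refine ⟨τ, hleft, hright, fun s c hs => ?_⟩
  have hx : τ (fun i => x (t i)) = x := by
    obtain ⟨u, hu, hsub⟩ := mem_comap.1 hleft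
    exact hsub (mem_of_mem_nhds hu : (fun s => x s) ∈ u)
  refine hasStrictFDerivAt_of_derivation hx hright (fun a => ?_) s c hs
  obtain ⟨Q, rfl⟩ := P.aeval_val_surjective a
  have hH0 : hG2.localInverse G E (pt x) (jj fun i => x (t i)) = pt x := by
    have := hHl.self_of_nhds
    rwa [hGpt] at this
  obtain ⟨M, hM, -⟩ := exists_hasStrictFDerivAt_evalPair Q (pt x)
  rw [← hH0] at hM
  have h1 : HasStrictFDerivAt (hG2.localInverse G E (pt x)) _ (jj fun i => x (t i)) := hHs
  have h2 := h1.comp (fun i => x (t i)) hjj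
  have h3 := HasStrictFDerivAt.comp (fun i => x (t i)) hM h2
  refine ⟨_, h3.congr_of_eventuallyEq ?_⟩
  filter_upwards [hr] with z hz
  rw [hpt, hτ z hz]

end LocalInverse

/-! ### Functions on open subschemes -/

section SectionsPull

variable {R : Type u} [CommRing R] {X : Scheme.{u}} {f : X ⟶ Spec (.of R)}

/-- Pull-back of functions from an open subset `V` of `X` to an open subset `W` of the open
subscheme `U`. -/
noncomputable def Sections.pull (f : X ⟶ Spec (.of R)) (U : X.Opens) {V : X.Opens}
    {W : U.toScheme.Opens} (h : W ≤ U.ι ⁻¹ᵁ V) : Sections f V →ₐ[R] Sections (U.ι ≫ f) W where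
  toRingHom := (U.ι.appLE V W h).hom
  commutes' r := by
    have := U.ι.appLE_comp_appLE f ⊤ V W le_top h
    exact congr($(this).hom ((Scheme.ΓSpecIso (.of R)).inv.hom r))

theorem Sections.pull_bijective {U V : X.Opens} (h : V ≤ U) :
    Function.Bijective (Sections.pull f U (V := V) le_rfl) := by
  have : IsIso (U.ι.app V) := U.ι.isIso_app V (by simpa using h)
  have h2 : IsIso (U.ι.appLE V (U.ι ⁻¹ᵁ V) le_rfl) := by rwa [← Scheme.Hom.app_eq_appLE]
  exact ConcreteCategory.bijective_of_isIso (U.ι.appLE V (U.ι ⁻¹ᵁ V) le_rfl)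

theorem Sections.res_pull {U V : X.Opens} {W W' : U.toScheme.Opens} (h : W ≤ U.ι ⁻¹ᵁ V)
    (h' : W' ≤ W) :
    (Sections.res (U.ι ≫ f) h').comp (Sections.pull f U h) = Sections.pull f U (h'.trans h) := by
  ext s
  exact congr($(U.ι.appLE_map h (homOfLE h').op).hom s)

end SectionsPull

/-! ### Points and their evaluation on functions -/

section Points

variable {R : Type u} [CommRing R] {X : Scheme.{u}} {f : X ⟶ Spec (.of R)}
  {A : Type u} [CommRing A] [Algebra R A]

/-- Evaluation at an `A`-valued point, as a homomorphism of `R`-algebras. -/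
noncomputable def Points.evalHom (x : Points f A) {V : X.Opens} (hx : x.1 ⁻¹ᵁ V = ⊤) :
    Sections f V →ₐ[R] A where
  toRingHom := (Scheme.ΓSpecIso (.of A)).hom.hom.comp (x.1.appLE V ⊤ hx.ge).hom
  commutes' r := by
    have h1 := x.1.appLE_comp_appLE f ⊤ V ⊤ le_top hx.ge
    have h2 : (x.1 ≫ f).appLE ⊤ ⊤ le_top =
        (Spec.map (CommRingCat.ofHom (algebraMap R A))).appTop := by
      rw [Scheme.Hom.appTop, Scheme.Hom.app_eq_appLE]
      simp only [x.2]
      rfl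
    have h3 := Scheme.ΓSpecIso_naturality (CommRingCat.ofHom (algebraMap R A))
    rw [← h2, ← h1] at h3
    have h4 := congr($(h3).hom ((Scheme.ΓSpecIso (.of R)).inv.hom r))
    simp only [CommRingCat.hom_comp, RingHom.comp_apply] at h4
    refine h4.trans ?_
    have h5 := congr($((Scheme.ΓSpecIso (.of R)).inv_hom_id).hom r)
    simp only [CommRingCat.hom_comp, RingHom.comp_apply] at h5
    rw [h5]; rfl

theorem Points.eval_eq (x : Points f A) {V : X.Opens} (hx : x.1 ⁻¹ᵁ V = ⊤) (s : Sections f V) :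
    x.eval hx s = x.evalHom hx s := rfl

/-- The open immersion of the spectrum of the ring of functions on an affine open `V`. -/
noncomputable def sectionsFromSpec (f : X ⟶ Spec (.of R)) (V : X.affineOpens) :
    Spec (.of (Sections f V.1)) ⟶ X :=
  IsAffineOpen.fromSpec (show IsAffineOpen V.1 from V.2)

instance (V : X.affineOpens) : IsOpenImmersion (sectionsFromSpec f V) :=
  IsAffineOpen.isOpenImmersion_fromSpec (show IsAffineOpen V.1 from V.2)

theorem sectionsFromSpec_preimage (V : X.affineOpens) : sectionsFromSpec f V ⁻¹ᵁ V.1 = ⊤ :=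
  IsAffineOpen.fromSpec_preimage_self (show IsAffineOpen V.1 from V.2)

theorem sectionsFromSpec_comp (V : X.affineOpens) :
    sectionsFromSpec f V ≫ f = Spec.map (CommRingCat.ofHom (algebraMap R (Sections f V.1))) := by
  have h := IsAffineOpen.SpecMap_appLE_fromSpec f (isAffineOpen_top (Spec (.of R)))
    (show IsAffineOpen V.1 from V.2) le_top
  refine h.symm.trans ?_
  rw [IsAffineOpen.fromSpec_top, Scheme.isoSpec_Spec_inv, ← Spec.map_comp]
  rfl

/-- A point of an affine open is determined by its evaluation homomorphism. -/
theorem Points.eq_fromSpec (x : Points f A) {V : X.affineOpens} (hx : x.1 ⁻¹ᵁ V.1 = ⊤) :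
    x.1 = Spec.map (CommRingCat.ofHom (x.evalHom hx).toRingHom) ≫ sectionsFromSpec f V := by
  have h := IsAffineOpen.SpecMap_appLE_fromSpec x.1 (show IsAffineOpen V.1 from V.2)
    (isAffineOpen_top (Spec (.of A))) hx.ge
  rw [IsAffineOpen.fromSpec_top, Iso.eq_inv_comp, Scheme.isoSpec_Spec_hom, ← Category.assoc,
    ← Spec.map_comp] at h
  exact h.symm

/-- The `A`-valued point of an affine open `V` given by a homomorphism from its ring of
functions. -/
noncomputable def Points.ofAlgHom (V : X.affineOpens) (φ : Sections f V.1 →ₐ[R] A) : Points f A :=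
  ⟨Spec.map (CommRingCat.ofHom φ.toRingHom) ≫ sectionsFromSpec f V, by
    rw [Category.assoc, sectionsFromSpec_comp, ← Spec.map_comp, ← CommRingCat.ofHom_comp]
    congr 2
    exact φ.comp_algebraMap⟩

theorem Points.preimage_ofAlgHom (V : X.affineOpens) (φ : Sections f V.1 →ₐ[R] A) :
    (Points.ofAlgHom V φ).1 ⁻¹ᵁ V.1 = ⊤ := by
  rw [Points.ofAlgHom, Scheme.Hom.comp_preimage, sectionsFromSpec_preimage]
  rfl

theorem Points.ofAlgHom_evalHom (x : Points f A) {V : X.affineOpens} (hx : x.1 ⁻¹ᵁ V.1 = ⊤) :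
    Points.ofAlgHom V (x.evalHom hx) = x :=
  Subtype.ext (x.eq_fromSpec hx).symm

theorem Points.evalHom_ofAlgHom (V : X.affineOpens) (φ : Sections f V.1 →ₐ[R] A) :
    (Points.ofAlgHom V φ).evalHom (Points.preimage_ofAlgHom V φ) = φ := by
  have h := (Points.ofAlgHom V φ).eq_fromSpec (Points.preimage_ofAlgHom V φ)
  have h2 := Spec.map_injective ((cancel_mono (sectionsFromSpec f V)).1 h)
  ext s
  exact congr($(h2).hom s).symm

theorem Points.ext_of_evalHom {x y : Points f A} {V : X.affineOpens} (hx : x.1 ⁻¹ᵁ V.1 = ⊤)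
    (hy : y.1 ⁻¹ᵁ V.1 = ⊤) (h : ∀ s, x.eval hx s = y.eval hy s) : x = y := by
  rw [← x.ofAlgHom_evalHom hx, ← y.ofAlgHom_evalHom hy]
  congr 1
  ext s
  exact h s

theorem Points.preimage_mono {x : Points f A} {V W : X.Opens} (h : W ≤ V)
    (hx : x.1 ⁻¹ᵁ W = ⊤) : x.1 ⁻¹ᵁ V = ⊤ :=
  top_le_iff.1 (hx.ge.trans (x.1.preimage_mono h))

theorem Points.eval_res (x : Points f A) {V W : X.Opens} (h : W ≤ V) (hx : x.1 ⁻¹ᵁ W = ⊤)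
    (s : Sections f V) : x.eval hx (Sections.res f h s) = x.eval (Points.preimage_mono h hx) s := by
  have := x.1.map_appLE hx.ge (homOfLE h).op
  exact congr((Scheme.ΓSpecIso (.of A)).hom.hom ($(this).hom s))

theorem Points.preimage_basicOpen (x : Points f A) {V : X.Opens} (hx : x.1 ⁻¹ᵁ V = ⊤)
    {g : Sections f V} (hg : IsUnit (x.eval hx g)) : x.1 ⁻¹ᵁ (X.basicOpen (U := V) g) = ⊤ := by
  have h1 : IsUnit ((x.1.appLE V ⊤ hx.ge).hom g) := by
    have h2 := hg.map (Scheme.ΓSpecIso (.of A)).inv.hom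
    have h3 := congr($((Scheme.ΓSpecIso (.of A)).hom_inv_id).hom ((x.1.appLE V ⊤ hx.ge).hom g))
    simp only [CommRingCat.hom_comp, RingHom.comp_apply] at h3
    rw [Points.eval, h3] at h2
    exact h2
  have h4 := (Spec (.of A)).basicOpen_of_isUnit h1
  have h5 : (x.1.appLE V ⊤ hx.ge).hom g =
      ((Spec (.of A)).presheaf.map (homOfLE hx.ge).op).hom ((x.1.app V).hom g) := rfl
  rw [h5, Scheme.basicOpen_res] at h4
  have h6 := Scheme.Hom.preimage_basicOpen x.1 (U := V) g
  refine h6.trans (top_le_iff.1 ?_)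
  rw [← h4]
  exact inf_le_right

theorem Points.isUnit_eval (x : Points f A) {V : X.Opens} {g : Sections f V}
    (hx : x.1 ⁻¹ᵁ (X.basicOpen (U := V) g) = ⊤) :
    IsUnit (x.eval (Points.preimage_mono (X.basicOpen_le g) hx) g) := by
  rw [← x.eval_res (X.basicOpen_le g) hx]
  refine IsUnit.map (x.evalHom hx) ?_
  exact RingedSpace.isUnit_res_basicOpen X.toRingedSpace g

section Map

variable (B : Type u) [CommRing B] [Algebra R B] [Algebra A B] [IsScalarTower R A B]

theorem Points.preimage_map {x : Points f A} {V : X.Opens} (hx : x.1 ⁻¹ᵁ V = ⊤) :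
    (x.map B).1 ⁻¹ᵁ V = ⊤ := by
  rw [Points.map, Scheme.Hom.comp_preimage, hx]; rfl

theorem Points.map_ofAlgHom (V : X.affineOpens) (φ : Sections f V.1 →ₐ[R] A) :
    (Points.ofAlgHom V φ).map B = Points.ofAlgHom V ((IsScalarTower.toAlgHom R A B).comp φ) := by
  apply Subtype.ext
  have h : CommRingCat.ofHom ((IsScalarTower.toAlgHom R A B).comp φ).toRingHom =
    CommRingCat.ofHom φ.toRingHom ≫ CommRingCat.ofHom (algebraMap A B) := rfl
  simp only [Points.map, Points.ofAlgHom]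
  rw [h, Spec.map_comp, Category.assoc]

theorem Points.evalHom_map {x : Points f A} {V : X.affineOpens} (hx : x.1 ⁻¹ᵁ V.1 = ⊤) :
    (x.map B).evalHom (Points.preimage_map B hx) =
      (IsScalarTower.toAlgHom R A B).comp (x.evalHom hx) := by
  have h := Points.evalHom_ofAlgHom V ((IsScalarTower.toAlgHom R A B).comp (x.evalHom hx))
  rw [← h]
  congr 1
  rw [← Points.map_ofAlgHom, Points.ofAlgHom_evalHom]

theorem Points.eval_map {x : Points f A} {V : X.affineOpens} (hx : x.1 ⁻¹ᵁ V.1 = ⊤)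
    (s : Sections f V.1) :
    (x.map B).eval (Points.preimage_map B hx) s = algebraMap A B (x.eval hx s) := by
  rw [Points.eval_eq, Points.evalHom_map B hx]; rfl

/-- If a local homomorphism `A → B` is given, a point over `A` lies in an open set as soon as its
image over `B` does: both have the same image of the closed point. -/
theorem Points.preimage_of_preimage_map [IsLocalRing A] [IsLocalRing B]
    [IsLocalHom (algebraMap A B)] {x : Points f A} {V : X.Opens} (hx : (x.map B).1 ⁻¹ᵁ V = ⊤) :
    x.1 ⁻¹ᵁ V = ⊤ := by
  have h1 : IsLocalRing.closedPoint B ∈ (x.map B).1 ⁻¹ᵁ V := by rw [hx]; trivial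
  have h2 : x.1 (IsLocalRing.closedPoint A) ∈ V := by
    rw [← IsLocalRing.comap_closedPoint (algebraMap A B)]
    exact h1
  exact (IsLocalRing.closedPoint_mem_iff (x.1 ⁻¹ᵁ V)).1 h2

end Map

/-- A point with values in a local ring lies in an affine open, which may be chosen inside any given
open subset containing the point. -/
theorem Points.exists_affine [IsLocalRing A] (x : Points f A) {U : X.Opens} (hx : x.1 ⁻¹ᵁ U = ⊤) :
    ∃ V : X.affineOpens, V.1 ≤ U ∧ x.1 ⁻¹ᵁ V.1 = ⊤ := by
  have h1 : x.1 (IsLocalRing.closedPoint A) ∈ U := by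
    have : IsLocalRing.closedPoint A ∈ x.1 ⁻¹ᵁ U := by rw [hx]; trivial
    exact this
  obtain ⟨V, hV, hxV, hVU⟩ := exists_isAffineOpen_mem_and_subset h1
  exact ⟨⟨V, hV⟩, hVU, (IsLocalRing.closedPoint_mem_iff (x.1 ⁻¹ᵁ V)).1 hxV⟩

theorem Points.preimage_inf {x : Points f A} {V W : X.Opens} (hV : x.1 ⁻¹ᵁ V = ⊤)
    (hW : x.1 ⁻¹ᵁ W = ⊤) : x.1 ⁻¹ᵁ (V ⊓ W) = ⊤ := by
  rw [Scheme.Hom.preimage_inf, hV, hW, top_inf_eq]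

section OfOpen

variable {U : X.Opens}

theorem Points.ofOpen_injective :
    Function.Injective (Points.ofOpen : Points (U.ι ≫ f) A → Points f A) := by
  intro x y h
  exact Subtype.ext ((cancel_mono U.ι).1 (congrArg Subtype.val h))

theorem Points.preimage_ofOpen (y : Points (U.ι ≫ f) A) (V : X.Opens) :
    (Points.ofOpen y).1 ⁻¹ᵁ V = y.1 ⁻¹ᵁ (U.ι ⁻¹ᵁ V) := rfl

theorem Points.preimage_ofOpen_self (y : Points (U.ι ≫ f) A) : (Points.ofOpen y).1 ⁻¹ᵁ U = ⊤ := by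
  rw [Points.preimage_ofOpen, Scheme.Opens.ι_preimage_self]; rfl

theorem Points.range_ofOpen :
    Set.range (Points.ofOpen : Points (U.ι ≫ f) A → Points f A) = {x | x.1 ⁻¹ᵁ U = ⊤} := by
  ext x
  constructor
  · rintro ⟨y, rfl⟩; exact y.preimage_ofOpen_self
  · intro hx
    have h : Set.range x.1 ⊆ Set.range U.ι := by
      rw [Scheme.Opens.range_ι]
      rintro _ ⟨z, rfl⟩
      have : z ∈ x.1 ⁻¹ᵁ U := by
        rw [show x.1 ⁻¹ᵁ U = ⊤ from hx]; trivial
      exact this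
    refine ⟨⟨IsOpenImmersion.lift U.ι x.1 h, ?_⟩, Subtype.ext ?_⟩
    · rw [← Category.assoc, IsOpenImmersion.lift_fac, x.2]
    · exact IsOpenImmersion.lift_fac _ _ _

theorem Points.eval_pull (y : Points (U.ι ≫ f) A) {V : X.Opens} {W : U.toScheme.Opens}
    (h : W ≤ U.ι ⁻¹ᵁ V) (hy : y.1 ⁻¹ᵁ W = ⊤) (hx : (Points.ofOpen y).1 ⁻¹ᵁ V = ⊤)
    (s : Sections f V) :
    y.eval hy (Sections.pull f U h s) = (Points.ofOpen y).eval hx s := by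
  have := y.1.appLE_comp_appLE U.ι V W ⊤ h hy.ge
  exact congr((Scheme.ΓSpecIso (.of A)).hom.hom ($(this).hom s))

theorem Points.map_ofOpen (B : Type u) [CommRing B] [Algebra R B] [Algebra A B]
    [IsScalarTower R A B] (y : Points (U.ι ≫ f) A) :
    (Points.ofOpen y).map B = Points.ofOpen (y.map B) :=
  Subtype.ext (Category.assoc (Spec.map (CommRingCat.ofHom (algebraMap A B))) y.1 U.ι).symm

/-- The part in `U` of an affine open subset of `X` contained in `U`. -/
def affinePreimage (U : X.Opens) (V : X.affineOpens) (h : V.1 ≤ U) : U.toScheme.affineOpens :=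
  ⟨U.ι ⁻¹ᵁ V.1, V.2.preimage_of_isOpenImmersion U.ι (by simpa using h)⟩

end OfOpen

end Points

/-! ### The topology on the set of points -/

/-- A topological ring whose units form an open set on which inversion is continuous. -/
class HasOpenUnits (A : Type*) [CommRing A] [TopologicalSpace A] : Prop where
  isOpen_units : IsOpen {a : A | IsUnit a}
  continuousAt_inverse : ∀ a : A, IsUnit a → ContinuousAt Ring.inverse a

instance {F : Type*} [NontriviallyNormedField F] : HasOpenUnits F where
  isOpen_units := by
    simp only [isUnit_iff_ne_zero]
    exact isOpen_ne
  continuousAt_inverse a ha := by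
    have : (Ring.inverse : F → F) = Inv.inv := Ring.inverse_eq_inv'
    rw [this]
    exact continuousAt_inv₀ ha.ne_zero

section Topology
open Filter

variable {R : Type u} [CommRing R] {X : Scheme.{u}} {f : X ⟶ Spec (.of R)}
  {A : Type u} [CommRing A] [Algebra R A]

/-- The set `V(A)` inside `X(A)`. -/
def pointsIn (f : X ⟶ Spec (.of R)) (A : Type u) [CommRing A] [Algebra R A] (V : X.Opens) :
    Set (Points f A) :=
  {x | x.1 ⁻¹ᵁ V = ⊤}

variable [TopologicalSpace A]

theorem isOpen_setOf_eval_mem (V : X.affineOpens) (s : Sections f V.1) {O : Set A} (hO : IsOpen O) :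
    IsOpen {x : Points f A | ∃ hx : x.1 ⁻¹ᵁ V.1 = ⊤, x.eval hx s ∈ O} :=
  TopologicalSpace.isOpen_generateFrom_of_mem ⟨V, s, O, hO, rfl⟩

theorem isOpen_pointsIn_affine (V : X.affineOpens) : IsOpen (pointsIn f A V.1) := by
  convert isOpen_setOf_eval_mem (f := f) (A := A) V 0 isOpen_univ using 1
  ext x
  simp [pointsIn]

theorem isOpen_pointsIn [IsLocalRing A] (U : X.Opens) : IsOpen (pointsIn f A U) := by
  rw [isOpen_iff_forall_mem_open]
  intro x hx
  obtain ⟨V, hVU, hxV⟩ := x.exists_affine hx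
  exact ⟨_, fun y hy => Points.preimage_mono hVU hy, isOpen_pointsIn_affine V, hxV⟩

theorem continuous_eval (V : X.affineOpens) (s : Sections f V.1) :
    Continuous fun x : pointsIn f A V.1 => x.1.eval x.2 s := by
  refine ⟨fun O hO => ?_⟩
  refine ⟨_, isOpen_setOf_eval_mem (f := f) V s hO, ?_⟩
  ext x
  exact ⟨fun ⟨_, h⟩ => h, fun h => ⟨x.2, h⟩⟩

/-- A function on the basic open set of `g` is a quotient `a / g ^ k`. -/
theorem exists_pow_mul_res_eq {V : X.Opens} (hV : IsAffineOpen V) (g : Sections f V)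
    (s : Sections f (X.basicOpen (U := V) g)) :
    ∃ (k : ℕ) (a : Sections f V), Sections.res f (X.basicOpen_le g) g ^ k * s =
      Sections.res f (X.basicOpen_le g) a := by
  let g' : Γ(X, V) := g
  have := hV.isLocalization_basicOpen g'
  obtain ⟨⟨a, ⟨_, k, rfl⟩⟩, h⟩ := IsLocalization.surj (Submonoid.powers g')
    (show Γ(X, X.basicOpen g') from s)
  refine ⟨k, a, ?_⟩
  rw [mul_comm, ← map_pow]
  exact h

/-- On the points of an affine open `V`, the topology is that of pointwise convergence of the
functions on `V`: a function on a smaller basic open is a quotient of functions on `V`. -/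
theorem isInducing_eval [IsTopologicalRing A] [HasOpenUnits A] [IsLocalRing A] (V : X.affineOpens) :
    IsInducing fun (x : pointsIn f A V.1) (s : Sections f V.1) => x.1.eval x.2 s := by
  set E : pointsIn f A V.1 → Sections f V.1 → A := fun x s => x.1.eval x.2 s with hE
  refine ⟨le_antisymm ?_ ?_⟩
  · exact continuous_iff_le_induced.1 (continuous_pi fun s => continuous_eval V s)
  · refine continuous_iff_le_induced.1 ?_
    let := TopologicalSpace.induced E inferInstance
    refine continuous_generateFrom_iff.2 ?_
    rintro _ ⟨V₁, s, O, hO, rfl⟩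
    refine isOpen_iff_mem_nhds.2 ?_
    rintro x ⟨hx₁, hxO⟩
    rw [nhds_induced E x]
    have hc : (x.1.1 (IsLocalRing.closedPoint A)) ∈ V.1 ⊓ V₁.1 := by
      have h : IsLocalRing.closedPoint A ∈ x.1.1 ⁻¹ᵁ (V.1 ⊓ V₁.1) := by
        rw [Points.preimage_inf x.2 hx₁]; trivial
      exact h
    obtain ⟨g, g₁, hgg, hxg⟩ := exists_basicOpen_le_affine_inter V.2 V₁.2 _ hc
    have hxg' : x.1.1 ⁻¹ᵁ (X.basicOpen g) = ⊤ :=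
      (IsLocalRing.closedPoint_mem_iff (x.1.1 ⁻¹ᵁ (X.basicOpen g))).1 hxg
    have hle : X.basicOpen g ≤ V₁.1 := hgg ▸ X.basicOpen_le g₁
    obtain ⟨k, a, ha⟩ := exists_pow_mul_res_eq (f := f) V.2 g (Sections.res f hle s)
    -- on `D(g)` the function `s` is `a / g ^ k`
    have key : ∀ y : pointsIn f A V.1, IsUnit (y.1.eval y.2 g) → ∃ hy : y.1.1 ⁻¹ᵁ V₁.1 = ⊤,
        y.1.eval hy s = Ring.inverse (y.1.eval y.2 g) ^ k * y.1.eval y.2 a := by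
      intro y hy
      have hyg := y.1.preimage_basicOpen y.2 hy
      refine ⟨Points.preimage_mono hle hyg, ?_⟩
      have h1 := congrArg (y.1.evalHom hyg) ha
      rw [map_mul, map_pow] at h1
      change (y.1.eval hyg _) ^ k * y.1.eval hyg _ = y.1.eval hyg _ at h1
      have e1 := Points.eval_res y.1 (X.basicOpen_le g) hyg g
      have e2 := Points.eval_res y.1 hle hyg s
      have e3 := Points.eval_res y.1 (X.basicOpen_le g) hyg a
      have h2 : y.1.eval y.2 g ^ k * y.1.eval (Points.preimage_mono hle hyg) s =
          y.1.eval y.2 a :=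
        (congrArg₂ (fun c d => c ^ k * d) e1 e2).symm.trans (h1.trans e3)
      rw [← h2, ← mul_assoc, ← mul_pow, Ring.inverse_mul_cancel _ hy, one_pow, one_mul]
    have hxu : IsUnit (x.1.eval x.2 g) := x.1.isUnit_eval hxg'
    have hcont : ContinuousAt
        (fun e : Sections f V.1 → A => Ring.inverse (e g) ^ k * e a) (E x) := by
      refine ContinuousAt.mul (ContinuousAt.pow ?_ k) (continuous_apply a).continuousAt
      exact ContinuousAt.comp (f := fun e : Sections f V.1 → A => e g)
        (HasOpenUnits.continuousAt_inverse _ hxu) (continuous_apply g).continuousAt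
    obtain ⟨hx₁', hxs⟩ := key x hxu
    have hmem : Ring.inverse (E x g) ^ k * E x a ∈ O := by
      rw [hE]; dsimp only; rw [← hxs]; exact hxO
    refine mem_comap.2 ⟨_, inter_mem (hcont.preimage_mem_nhds (hO.mem_nhds hmem))
      ((HasOpenUnits.isOpen_units.preimage (continuous_apply g)).mem_nhds hxu), ?_⟩
    rintro y ⟨hy1, hy2⟩
    obtain ⟨hy, hys⟩ := key y hy2
    refine ⟨hy, ?_⟩
    rw [hys]; exact hy1

/-- The neighbourhoods of a point of an affine open `V` are those of pointwise convergence of the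
functions on `V`. -/
theorem Points.nhds_eq [IsTopologicalRing A] [HasOpenUnits A] [IsLocalRing A] (V : X.affineOpens)
    (x : pointsIn f A V.1) :
    𝓝 (x : Points f A) = Filter.map Subtype.val
      (comap (fun (y : pointsIn f A V.1) s => y.1.eval y.2 s) (𝓝 fun s => x.1.eval x.2 s)) := by
  rw [← map_nhds_subtype_coe_eq_nhds x.2 ((isOpen_pointsIn_affine V).mem_nhds x.2),
    (isInducing_eval V).nhds_eq_comap x]

theorem isOpenEmbedding_ofOpen [IsLocalRing A] (U : X.Opens) :
    IsOpenEmbedding (Points.ofOpen : Points (U.ι ≫ f) A → Points f A) := by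
  refine ⟨⟨⟨le_antisymm ?_ ?_⟩, Points.ofOpen_injective⟩, ?_⟩
  · refine continuous_iff_le_induced.1 (continuous_generateFrom_iff.2 ?_)
    rintro _ ⟨V, s, O, hO, rfl⟩
    rw [isOpen_iff_forall_mem_open]
    rintro y ⟨hy, hyO⟩
    obtain ⟨V', hV', hyV'⟩ := (Points.ofOpen y).exists_affine
      (Points.preimage_inf hy y.preimage_ofOpen_self)
    have hV'V := hV'.trans inf_le_left
    have hV'U := hV'.trans inf_le_right
    refine ⟨_, ?_, isOpen_setOf_eval_mem (affinePreimage U V' hV'U)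
      (Sections.pull f U le_rfl (Sections.res f hV'V s)) hO, hyV', ?_⟩
    · rintro z ⟨hz, hzO⟩
      refine ⟨Points.preimage_mono hV'V hz, ?_⟩
      have h := (Points.eval_pull z le_rfl hz hz (Sections.res f hV'V s)).trans
        (Points.eval_res _ hV'V hz s)
      exact Set.mem_of_eq_of_mem h.symm hzO
    · have h := (Points.eval_pull y le_rfl hyV' hyV' (Sections.res f hV'V s)).trans
        (Points.eval_res _ hV'V hyV' s)
      exact Set.mem_of_eq_of_mem h hyO
  · refine le_generateFrom ?_
    rintro _ ⟨V, s, O, hO, rfl⟩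
    let V' : X.affineOpens := ⟨U.ι ''ᵁ V.1, V.2.image_of_isOpenImmersion U.ι⟩
    have hV' : V'.1 ≤ U := by
      rintro _ ⟨z, -, rfl⟩; exact z.2
    have hVV' : U.ι ⁻¹ᵁ V'.1 = V.1 := U.ι.preimage_image_eq V.1
    have hle : V.1 ≤ U.ι ⁻¹ᵁ V'.1 := hVV'.ge
    have hbij : Function.Bijective (Sections.pull f U hle) := by
      have h := Sections.pull_bijective (f := f) hV'
      have hiso : ∀ W (hW : W ≤ U.ι ⁻¹ᵁ V'.1), U.ι ⁻¹ᵁ V'.1 = W →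
          Function.Bijective (Sections.pull f U hW) := by
        rintro W hW rfl; exact h
      exact hiso _ hle hVV'
    obtain ⟨s', rfl⟩ := hbij.2 s
    refine ⟨_, isOpen_setOf_eval_mem V' s' hO, ?_⟩
    ext y
    have hyy : (Points.ofOpen y).1 ⁻¹ᵁ V'.1 = y.1 ⁻¹ᵁ V.1 := by
      rw [Points.preimage_ofOpen, hVV']
    constructor
    · rintro ⟨hy, hyO⟩
      refine ⟨hyy ▸ hy, ?_⟩
      rw [Points.eval_pull y hle _ hy]; exact hyO
    · rintro ⟨hy, hyO⟩
      refine ⟨hyy.trans hy, ?_⟩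
      rw [Points.eval_pull y hle hy (hyy.trans hy)] at hyO
      exact hyO
  · rw [Points.range_ofOpen]; exact isOpen_pointsIn U

end Topology

/-! ### Finiteness and countability of points -/

section SecondCountable

variable {R : Type u} [CommRing R] {X : Scheme.{u}} {f : X ⟶ Spec (.of R)}
  {A : Type u} [CommRing A] [Algebra R A]

theorem smooth_sections [Smooth f] (V : X.affineOpens) : Algebra.Smooth R (Sections f V.1) := by
  have h := f.smooth_appLE (isAffineOpen_top _) V.2 le_top
  have h2 : (algebraMap R (Sections f V.1)).Smooth :=
    RingHom.Smooth.respectsIso.2 _ (Scheme.ΓSpecIso (.of R)).symm.commRingCatIsoToRingEquiv h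
  exact RingHom.smooth_algebraMap.1 h2

theorem exists_finite_affine_cover [CompactSpace X] :
    ∃ S : Set X.affineOpens, S.Finite ∧ ∀ x : X, ∃ V ∈ S, x ∈ V.1 := by
  obtain ⟨S, hS, hX⟩ := (isCompact_and_isOpen_iff_finite_and_eq_biUnion_affineOpens
    (X := X) (U := Set.univ)).1 ⟨isCompact_univ, isOpen_univ⟩
  refine ⟨S, hS, fun x => ?_⟩
  have : x ∈ ⋃ i ∈ S, ((i : X.affineOpens) : Set X) := hX ▸ Set.mem_univ x
  simpa using this

theorem Points.exists_mem_of_cover [IsLocalRing A] {S : Set X.affineOpens}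
    (hS : ∀ x : X, ∃ V ∈ S, x ∈ V.1) (x : Points f A) : ∃ V ∈ S, x.1 ⁻¹ᵁ V.1 = ⊤ := by
  obtain ⟨V, hV, hx⟩ := hS (x.1 (IsLocalRing.closedPoint A))
  exact ⟨V, hV, (IsLocalRing.closedPoint_mem_iff (x.1 ⁻¹ᵁ V.1)).1 hx⟩

theorem Points.eval_aeval (x : Points f A) {V : X.Opens} (hx : x.1 ⁻¹ᵁ V = ⊤) {σ : Type*}
    (g : σ → Sections f V) (Q : MvPolynomial σ R) :
    x.eval hx (MvPolynomial.aeval g Q) = MvPolynomial.aeval (fun i => x.eval hx (g i)) Q := by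
  rw [Points.eval_eq, ← AlgHom.comp_apply, MvPolynomial.comp_aeval]; rfl

theorem exists_generators [Smooth f] (V : X.affineOpens) :
    ∃ (m : ℕ) (g : Fin m → Sections f V.1),
      Function.Surjective (MvPolynomial.aeval g : MvPolynomial (Fin m) R →ₐ[R] Sections f V.1) := by
  have := smooth_sections (f := f) V
  obtain ⟨m, φ, hφ⟩ := (Algebra.FiniteType.iff_quotient_mvPolynomial'' (R := R)
    (S := Sections f V.1)).1 inferInstance
  exact ⟨m, fun i => φ (MvPolynomial.X i), (MvPolynomial.aeval_unique φ) ▸ hφ⟩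

/-- A point with values in a finite local ring lies in one of finitely many affine opens, where it
is given by its values on finitely many generators. -/
theorem finite_points [Smooth f] [CompactSpace X] [IsLocalRing A] [Finite A] :
    Finite (Points f A) := by
  obtain ⟨S, hSf, hS⟩ := exists_finite_affine_cover (X := X)
  have hfin : ∀ V : X.affineOpens, (pointsIn f A V.1).Finite := by
    intro V
    obtain ⟨m, g, hg⟩ := exists_generators (f := f) V
    refine Set.finite_coe_iff.1 ?_
    refine Finite.of_injective (fun (x : pointsIn f A V.1) i => x.1.eval x.2 (g i)) ?_
    intro x y hxy
    refine Subtype.ext (Points.ext_of_evalHom x.2 y.2 fun s => ?_)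
    obtain ⟨Q, rfl⟩ := hg s
    have hxy' : (fun i => x.1.eval x.2 (g i)) = fun i => y.1.eval y.2 (g i) := hxy
    exact (Points.eval_aeval x.1 x.2 g Q).trans ((congrArg (fun z => MvPolynomial.aeval z Q)
      hxy').trans (Points.eval_aeval y.1 y.2 g Q).symm)
  rw [← Set.finite_univ_iff]
  refine (hSf.biUnion fun V _ => hfin V).subset fun x _ => ?_
  obtain ⟨V, hV, hx⟩ := x.exists_mem_of_cover hS
  exact Set.mem_biUnion hV hx

variable [TopologicalSpace A] [IsTopologicalRing A] [HasOpenUnits A] [IsLocalRing A]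

/-- The topology on the points of an affine open is already induced by finitely many functions. -/
theorem isInducing_eval_generators (V : X.affineOpens) {σ : Type*} (g : σ → Sections f V.1)
    (hg : Function.Surjective (MvPolynomial.aeval g : MvPolynomial σ R →ₐ[R] Sections f V.1)) :
    IsInducing fun (x : pointsIn f A V.1) i => x.1.eval x.2 (g i) := by
  refine ⟨le_antisymm ?_ ?_⟩
  · exact continuous_iff_le_induced.1 (continuous_pi fun i => continuous_eval V (g i))
  · rw [(isInducing_eval V).eq_induced]
    refine continuous_iff_le_induced.1 ?_
    let := TopologicalSpace.induced (fun (x : pointsIn f A V.1) i => x.1.eval x.2 (g i))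
      inferInstance
    refine continuous_pi fun s => ?_
    obtain ⟨Q, rfl⟩ := hg s
    have h : Continuous fun z : σ → A => MvPolynomial.aeval z Q := by
      simp only [MvPolynomial.aeval_def, MvPolynomial.eval₂_eq]
      fun_prop
    exact (h.comp continuous_induced_dom).congr fun x => (Points.eval_aeval x.1 x.2 g Q).symm

theorem secondCountableTopology_points [Smooth f] [CompactSpace X] [SecondCountableTopology A] :
    SecondCountableTopology (Points f A) := by
  obtain ⟨S, hSf, hS⟩ := exists_finite_affine_cover (X := X)
  have := hSf.countable.to_subtype
  have h : ∀ V : S, SecondCountableTopology (pointsIn f A V.1.1) := by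
    intro V
    obtain ⟨m, g, hg⟩ := exists_generators (f := f) V.1
    exact (isInducing_eval_generators V.1 g hg).secondCountableTopology
  refine TopologicalSpace.secondCountableTopology_of_countable_cover
    (U := fun V : S => pointsIn f A V.1.1) (fun V => isOpen_pointsIn_affine V.1) ?_
  refine Set.eq_univ_of_forall fun x => ?_
  obtain ⟨V, hV, hx⟩ := x.exists_mem_of_cover hS
  exact Set.mem_iUnion.2 ⟨⟨V, hV⟩, hx⟩

end SecondCountable

/-! ### The ring of integers -/

section Integers
open IsLocalRing

variable (p : ℕ) [Fact p.Prime] (F : Type u) [NontriviallyNormedField F] [NormedAlgebra ℚ_[p] F]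

variable {F} in
theorem isUnit_integers_iff (a : integers p F) : IsUnit a ↔ ‖(a : F)‖ = 1 := by
  constructor
  · intro h
    obtain ⟨b, hb⟩ := h.exists_right_inv
    have h1 : ‖(a : F)‖ ≤ 1 := a.2
    have h2 : ‖(b : F)‖ ≤ 1 := b.2
    have h3 : ‖(a : F)‖ * ‖(b : F)‖ = 1 := by
      rw [← norm_mul]; simpa using congr(‖(($hb : integers p F) : F)‖)
    nlinarith [norm_nonneg (a : F), norm_nonneg (b : F)]
  · intro h
    have h0 : (a : F) ≠ 0 := norm_ne_zero_iff.1 (by rw [h]; exact one_ne_zero)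
    have hi : (a : F)⁻¹ ∈ integers p F := by rw [mem_integers, norm_inv, h, inv_one]
    exact IsUnit.of_mul_eq_one ⟨(a : F)⁻¹, hi⟩ (Subtype.ext (mul_inv_cancel₀ h0))

variable {F} in
theorem mem_maximalIdeal_integers (a : integers p F) :
    a ∈ maximalIdeal (integers p F) ↔ ‖(a : F)‖ < 1 := by
  have h1 : ‖(a : F)‖ ≤ 1 := a.2
  rw [mem_maximalIdeal, mem_nonunits_iff, isUnit_integers_iff, ← ne_eq, h1.lt_iff_ne]

variable {F} in
theorem residue_eq_iff (a b : integers p F) :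
    residue (integers p F) a = residue (integers p F) b ↔ ‖(a : F) - b‖ < 1 := by
  rw [← sub_eq_zero, ← map_sub, residue_eq_zero_iff, mem_maximalIdeal_integers]; rfl

instance : HasOpenUnits (integers p F) where
  isOpen_units := by
    have := isUltrametricDist_of_padic p F
    simp only [isUnit_integers_iff]
    have h : {a : integers p F | ‖(a : F)‖ = 1} = Subtype.val ⁻¹' Metric.sphere (0 : F) 1 := by
      ext; simp
    rw [h]
    exact (IsUltrametricDist.isOpen_sphere (0 : F) one_ne_zero).preimage continuous_subtype_val
  continuousAt_inverse a ha := by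
    have := isUltrametricDist_of_padic p F
    have hc : ∀ b : integers p F, IsUnit b → ((Ring.inverse b : integers p F) : F) = (b : F)⁻¹ := by
      rintro _ ⟨b, rfl⟩
      rw [Ring.inverse_unit]
      refine eq_inv_of_mul_eq_one_left ?_
      exact congr((($(b.inv_mul) : integers p F) : F))
    have hu : {a : integers p F | ‖(a : F)‖ = 1} ∈ 𝓝 a := by
      have h : {a : integers p F | ‖(a : F)‖ = 1} = Subtype.val ⁻¹' Metric.sphere (0 : F) 1 := by
        ext; simp
      rw [h]
      exact ((IsUltrametricDist.isOpen_sphere (0 : F) one_ne_zero).preimage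
        continuous_subtype_val).mem_nhds (by simpa using (isUnit_integers_iff p a).1 ha)
    rw [ContinuousAt, tendsto_subtype_rng, hc a ha]
    have h0 : (a : F) ≠ 0 := norm_ne_zero_iff.1
      (by rw [(isUnit_integers_iff p a).1 ha]; exact one_ne_zero)
    have hcomp : ContinuousAt (fun b : integers p F => (b : F)⁻¹) a :=
      (continuousAt_inv₀ h0).comp (f := fun b : integers p F => (b : F))
        continuous_subtype_val.continuousAt
    refine Filter.Tendsto.congr' ?_ hcomp
    filter_upwards [hu] with b hb
    exact (hc b ((isUnit_integers_iff p b).2 hb)).symm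

instance : IsTopologicalRing (integers p F) :=
  inferInstanceAs (IsTopologicalRing (integers p F).toSubring)

theorem isClosed_maximalIdeal_integers :
    IsClosed (maximalIdeal (integers p F) : Set (integers p F)) := by
  have h := (HasOpenUnits.isOpen_units (A := integers p F)).isClosed_compl
  convert h using 1
  ext a
  exact mem_maximalIdeal a

theorem isOpen_maximalIdeal_integers :
    IsOpen (maximalIdeal (integers p F) : Set (integers p F)) := by
  have h : (maximalIdeal (integers p F) : Set (integers p F)) =
      Subtype.val ⁻¹' Metric.ball (0 : F) 1 := by
    ext a
    rw [SetLike.mem_coe, mem_maximalIdeal_integers]; simp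
  rw [h]
  exact Metric.isOpen_ball.preimage continuous_subtype_val

variable [FiniteDimensional ℚ_[p] F]

instance : CompactSpace (integers p F) := by
  have := properSpace_of_padic p F
  have h : (integers p F : Set F) = Metric.closedBall 0 1 := by
    ext; simp [mem_integers]
  refine (isCompact_iff_compactSpace (s := (integers p F : Set F))).1 ?_
  rw [h]; exact isCompact_closedBall _ _

/-- A uniformiser exists: the norm attains its maximum on the compact set `𝔪`. -/
theorem exists_uniformizer : ∃ ϖ : integers p F, 0 < ‖(ϖ : F)‖ ∧ ‖(ϖ : F)‖ < 1 ∧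
    ∀ (k : ℕ) (a : integers p F),
      a ∈ maximalIdeal (integers p F) ^ k ↔ ‖(a : F)‖ ≤ ‖(ϖ : F)‖ ^ k := by
  obtain ⟨ϖ, hϖ, hmax⟩ := (isClosed_maximalIdeal_integers p F).isCompact.exists_isMaxOn
    ⟨0, zero_mem (maximalIdeal (integers p F))⟩
    (continuous_norm.comp continuous_subtype_val : Continuous fun a : integers p F => ‖(a : F)‖
    ).continuousOn
  have hmax' : ∀ a : integers p F, ‖(a : F)‖ < 1 → ‖(a : F)‖ ≤ ‖(ϖ : F)‖ := fun a ha =>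
    hmax ((mem_maximalIdeal_integers p a).2 ha)
  have hpos : 0 < ‖(ϖ : F)‖ := by
    obtain ⟨a, ha0, ha1⟩ := NormedField.exists_norm_lt_one F
    exact ha0.trans_le (hmax' ⟨a, ha1.le⟩ ha1)
  have hdvd : ∀ (c a : integers p F), (c : F) ≠ 0 → ‖(a : F)‖ ≤ ‖(c : F)‖ → c ∣ a := by
    intro c a hc hac
    refine ⟨⟨(c : F)⁻¹ * a, ?_⟩, Subtype.ext (mul_inv_cancel_left₀ hc _).symm⟩
    rw [mem_integers, norm_mul, norm_inv, inv_mul_le_one₀ (norm_pos_iff.2 hc)]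
    exact hac
  have hspan : maximalIdeal (integers p F) = Ideal.span {ϖ} := by
    refine le_antisymm (fun a ha => Ideal.mem_span_singleton.2 ?_)
      ((Ideal.span_singleton_le_iff_mem _).2 hϖ)
    exact hdvd _ _ (norm_pos_iff.1 hpos) (hmax ha)
  refine ⟨ϖ, hpos, (mem_maximalIdeal_integers p ϖ).1 hϖ, fun k a => ?_⟩
  rw [hspan, Ideal.span_singleton_pow, Ideal.mem_span_singleton]
  constructor
  · rintro ⟨b, rfl⟩
    have hb : ‖(b : F)‖ ≤ 1 := b.2
    simpa using mul_le_of_le_one_right (pow_nonneg (norm_nonneg (ϖ : F)) k) hb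
  · intro h
    refine hdvd _ _ ?_ ?_
    · simpa using pow_ne_zero k (norm_pos_iff.1 hpos)
    · simpa using h

theorem isClosed_maximalIdeal_pow (k : ℕ) :
    IsClosed ((maximalIdeal (integers p F) ^ k : Ideal _) : Set (integers p F)) := by
  obtain ⟨ϖ, -, -, h⟩ := exists_uniformizer p F
  have h' : ((maximalIdeal (integers p F) ^ k : Ideal _) : Set (integers p F)) =
      Subtype.val ⁻¹' Metric.closedBall (0 : F) (‖(ϖ : F)‖ ^ k) := by
    ext a; simp [h]
  rw [h']
  exact Metric.isClosed_closedBall.preimage continuous_subtype_val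

theorem iInf_maximalIdeal_pow : ⨅ k : ℕ, maximalIdeal (integers p F) ^ k = ⊥ := by
  obtain ⟨ϖ, h0, h1, h⟩ := exists_uniformizer p F
  refine eq_bot_iff.2 fun a ha => ?_
  have ha' : ∀ k : ℕ, ‖(a : F)‖ ≤ ‖(ϖ : F)‖ ^ k := fun k =>
    (h k a).1 ((Submodule.mem_iInf _).1 ha k)
  have h2 : ‖(a : F)‖ ≤ 0 := ge_of_tendsto' (tendsto_pow_atTop_nhds_zero_of_lt_one h0.le h1) ha'
  exact Subtype.ext (norm_le_zero_iff.1 h2)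

open scoped Pointwise in
/-- Completeness follows from compactness: the residue classes that form a compatible system are
nested, closed and nonempty. -/
instance : IsAdicComplete (maximalIdeal (integers p F)) (integers p F) where
  haus' x hx := by
    have h : x ∈ ⨅ k : ℕ, maximalIdeal (integers p F) ^ k := by
      refine (Submodule.mem_iInf _).2 fun k => ?_
      simpa [SModEq.zero] using hx k
    rwa [iInf_maximalIdeal_pow] at h
  prec' s hs := by
    let S (k : ℕ) : Set (integers p F) :=
      s k +ᵥ ((maximalIdeal (integers p F) ^ k : Ideal _) : Set (integers p F))
    have hS k : S (k + 1) ⊆ S k := by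
      apply (Set.vadd_set_subset_vadd_set_iff.mpr (Ideal.pow_le_pow_right k.le_succ)).trans
      simpa [S] using (hs k.le_succ).symm
    have h k : IsClosed (S k) := (isClosed_maximalIdeal_pow p F k).vadd (s k)
    obtain ⟨L, hL⟩ := (h 0).isCompact.nonempty_iInter_of_sequence_nonempty_isCompact_isClosed S hS
      (by simp [S]) h
    refine ⟨L, fun k ↦ ?_⟩
    obtain ⟨y, hy, rfl⟩ := Set.mem_iInter.mp hL k
    simpa [SModEq.sub_mem] using hy

/-- The residue field is finite, being the quotient of a compact ring by an open ideal. -/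
instance finite_residue : Finite (Residue p F) :=
  AddSubgroup.quotient_finite_of_isOpen (maximalIdeal (integers p F)).toAddSubgroup
    (isOpen_maximalIdeal_integers p F)

variable [MeasurableSpace F] [BorelSpace F]

/-- The polydisc `R ^ n` is the disjoint union of `q ^ n` translates of `𝔪 ^ n`. -/
theorem haar_ball (n : ℕ) (z : Fin n → F) :
    haar p F n {w | ∀ i, ‖w i - z i‖ < 1} = ((Nat.card (Residue p F) : ℝ≥0∞) ^ n)⁻¹ := by
  have := properSpace_of_padic p F
  have := isUltrametricDist_of_padic p F
  let B (z : Fin n → F) : Set (Fin n → F) := {w | ∀ i, ‖w i - z i‖ < 1}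
  have hB : ∀ z, B z = (fun w => -z + w) ⁻¹' B 0 := by
    intro z; ext w; simp [B, add_comm, sub_eq_add_neg]
  have hBeq : ∀ z, haar p F n (B z) = haar p F n (B 0) := by
    intro z; rw [hB z]; exact measure_preimage_add _ _ _
  have hBm : ∀ z, MeasurableSet (B z) := by
    intro z
    refine IsOpen.measurableSet ?_
    simp only [B, Set.ofPred_forall]
    exact isOpen_iInter_of_finite fun i =>
      isOpen_lt (by fun_prop) continuous_const
  let lift : Residue p F → integers p F := Function.surjInv residue_surjective
  have hlift : ∀ a, residue (integers p F) (lift a) = a := Function.surjInv_eq residue_surjective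
  have hU : Metric.closedBall (0 : Fin n → F) 1 =
      ⋃ c : Fin n → Residue p F, B fun i => (lift (c i) : F) := by
    ext w
    simp only [Metric.mem_closedBall, dist_zero_right, pi_norm_le_iff_of_nonneg zero_le_one,
      Set.mem_iUnion]
    constructor
    · intro hw
      refine ⟨fun i => residue (integers p F) ⟨w i, hw i⟩, fun i => ?_⟩
      exact (residue_eq_iff p ⟨w i, hw i⟩ _).1 (hlift _).symm
    · rintro ⟨c, hc⟩ i
      have h := IsUltrametricDist.norm_add_le_max (w i - lift (c i)) (lift (c i) : F)
      rw [sub_add_cancel] at h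
      exact h.trans (max_le (hc i).le (lift (c i)).2)
  have hdisj : Pairwise (Function.onFun Disjoint fun c : Fin n → Residue p F =>
      B fun i => (lift (c i) : F)) := by
    intro c d hcd
    refine Set.disjoint_left.2 fun w hc hd => hcd (funext fun i => ?_)
    rw [← hlift (c i), ← hlift (d i), residue_eq_iff]
    have h := IsUltrametricDist.norm_add_le_max (w i - lift (d i)) (lift (c i) - w i)
    rw [add_comm, sub_add_sub_cancel, norm_sub_rev _ (w i)] at h
    exact h.trans_lt (max_lt (hd i) (hc i))
  have h1 := haar_closedBall (F := F) p (n := n)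
  have : Fintype (Residue p F) := Fintype.ofFinite _
  rw [hU, measure_iUnion hdisj fun c => hBm _, tsum_fintype] at h1
  simp only [hBeq, Finset.sum_const, Finset.card_univ, nsmul_eq_mul, Fintype.card_pi,
    Finset.prod_const, Fintype.card_fin, Nat.cast_pow] at h1
  change haar p F n (B z) = _
  rw [hBeq, Nat.card_eq_fintype_card]
  exact ENNReal.eq_inv_of_mul_eq_one_left (by rwa [mul_comm])

end Integers
/-! ### Hensel lifting in étale coordinates -/

section Hensel
open IsLocalRing

variable {R A : Type u} [CommRing R] [IsLocalRing R] [CommRing A] [Algebra R A] {n : ℕ}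
  {t : Fin n → A}

/-- Hensel's lemma, existence: a point `x` over the residue field lifts to a point over the complete
local ring `R` with prescribed values `z` of the étale coordinates, because `A` is formally smooth
over the polynomial ring which they generate. -/
theorem exists_lift_of_residue [IsAdicComplete (maximalIdeal R) R] [Algebra.Smooth R A]
    (b : Module.Basis (Fin n) A (Ω[A⁄R])) (hb : ∀ i, b i = KaehlerDifferential.D R A (t i))
    (x : A →ₐ[R] ResidueField R) (z : Fin n → R) (hz : ∀ i, residue R (z i) = x (t i)) :
    ∃ y : A →ₐ[R] R, (∀ s, residue R (y s) = x s) ∧ ∀ i, y (t i) = z i := by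
  let P := MvPolynomial (Fin n) R
  let : Algebra P A := (MvPolynomial.aeval t : P →ₐ[R] A).toRingHom.toAlgebra
  let : Algebra P R := (MvPolynomial.aeval z : P →ₐ[R] R).toRingHom.toAlgebra
  have tA : IsScalarTower R P A :=
    IsScalarTower.of_algebraMap_eq' (MvPolynomial.aeval t).comp_algebraMap.symm
  have tR : IsScalarTower R P R :=
    IsScalarTower.of_algebraMap_eq' (MvPolynomial.aeval z : P →ₐ[R] R).comp_algebraMap.symm
  have hX : ∀ i, algebraMap P A (MvPolynomial.X i) = t i := MvPolynomial.aeval_X t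
  have het := etale_mvPolynomial_of_basis hX b hb
  let φ : A →ₐ[P] R ⧸ maximalIdeal R :=
    { (x : A →+* ResidueField R) with
      commutes' := by
        intro Q
        have h : ((x.comp (MvPolynomial.aeval t)) : P →ₐ[R] ResidueField R) =
            (IsScalarTower.toAlgHom R R (ResidueField R)).comp (MvPolynomial.aeval z) := by
          ext i
          simpa using (hz i).symm
        exact congr($h Q) }
  obtain ⟨y, hy⟩ := Algebra.FormallySmooth.exists_mkₐ_comp_eq_of_isAdicComplete φ
  refine ⟨y.restrictScalars R, fun s => congr($hy s), fun i => ?_⟩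
  have := y.commutes (MvPolynomial.X i)
  rw [hX] at this
  exact this.trans (MvPolynomial.aeval_X z i)

/-- Hensel's lemma, uniqueness: a point over `R` is determined by its reduction and by the values of
the étale coordinates, because `A` is formally unramified over the polynomial ring which they
generate. -/
theorem lift_of_residue_unique (hR : ⨅ k : ℕ, maximalIdeal R ^ k = ⊥) [Algebra.Smooth R A]
    (b : Module.Basis (Fin n) A (Ω[A⁄R])) (hb : ∀ i, b i = KaehlerDifferential.D R A (t i))
    {y y' : A →ₐ[R] R} (h : ∀ s, residue R (y s) = residue R (y' s))
    (ht : ∀ i, y (t i) = y' (t i)) : y = y' := by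
  let P := MvPolynomial (Fin n) R
  let z : Fin n → R := fun i => y (t i)
  let : Algebra P A := (MvPolynomial.aeval t : P →ₐ[R] A).toRingHom.toAlgebra
  let : Algebra P R := (MvPolynomial.aeval z : P →ₐ[R] R).toRingHom.toAlgebra
  have tA : IsScalarTower R P A :=
    IsScalarTower.of_algebraMap_eq' (MvPolynomial.aeval t).comp_algebraMap.symm
  have hX : ∀ i, algebraMap P A (MvPolynomial.X i) = t i := MvPolynomial.aeval_X t
  have het := etale_mvPolynomial_of_basis hX b hb
  have hlin : ∀ w : A →ₐ[R] R, (∀ i, w (t i) = z i) →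
      ∀ Q, w (algebraMap P A Q) = algebraMap P R Q := by
    intro w hw Q
    have e : (w.comp (MvPolynomial.aeval t) : P →ₐ[R] R) = MvPolynomial.aeval z := by
      ext i; simpa using hw i
    exact congr($e Q)
  let g : A →ₐ[P] R := { (y : A →+* R) with commutes' := hlin y fun i => rfl }
  let g' : A →ₐ[P] R := { (y' : A →+* R) with commutes' := hlin y' fun i => (ht i).symm }
  have hgg : g = g' := Algebra.FormallyUnramified.ext_of_iInf (maximalIdeal R) hR h
  ext s
  exact congr($hgg s)

end Hensel

/-! ### Top exterior powers -/

section Algebra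
open KaehlerDifferential

/-- If `M` is free of rank `n` then `⋀ⁿ M` is free on the wedge product of a basis, and the wedge
product of `n` vectors is their determinant times that generator. -/
theorem ιMulti_eq_det_smul {A M : Type*} [CommRing A] [AddCommGroup M] [Module A M] {n : ℕ}
    (b : Module.Basis (Fin n) A M) (m : Fin n → M) :
    exteriorPower.ιMulti A n m = b.det m • exteriorPower.ιMulti A n b := by
  have h : (exteriorPower.ιMulti A n (M := M)) =
      (LinearMap.toSpanSingleton A _ (exteriorPower.ιMulti A n b)).compAlternatingMap b.det := by
    refine b.ext_alternating fun v hv => ?_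
    let σ : Equiv.Perm (Fin n) := Equiv.ofBijective v (Finite.injective_iff_bijective.1 hv)
    have hσ : (fun i => b (v i)) = b ∘ σ := rfl
    rw [hσ, AlternatingMap.map_perm, AlternatingMap.map_perm]
    simp [Module.Basis.det_self]
  exact congr($h m)

theorem smul_ιMulti_bijective {A M : Type*} [CommRing A] [AddCommGroup M] [Module A M] {n : ℕ}
    (b : Module.Basis (Fin n) A M) :
    Function.Bijective fun a : A => a • exteriorPower.ιMulti A n b := by
  let δ : ⋀[A]^n M →ₗ[A] A := exteriorPower.alternatingMapLinearEquiv b.det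
  have hδ : ∀ m, δ (exteriorPower.ιMulti A n m) = b.det m :=
    exteriorPower.alternatingMapLinearEquiv_apply_ιMulti b.det
  constructor
  · intro a a' h
    have := congrArg δ h
    simpa [hδ, Module.Basis.det_self] using this
  · intro η
    have h : (LinearMap.toSpanSingleton A _ (exteriorPower.ιMulti A n b)).comp δ =
        LinearMap.id := by
      refine exteriorPower.linearMap_ext (AlternatingMap.ext fun m => ?_)
      simpa [hδ] using (ιMulti_eq_det_smul b m).symm
    exact ⟨δ η, congr($h η)⟩

variable {R A B : Type u} [CommRing R] [CommRing A] [CommRing B] [Algebra R A] [Algebra R B]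

theorem formMap_smul (φ : A →ₐ[R] B) (n : ℕ) (a : A) (η : ⋀[A]^n (Ω[A⁄R])) :
    formMap φ n (a • η) = φ a • formMap φ n η := by
  let : Algebra A B := φ.toRingHom.toAlgebra
  have : IsScalarTower R A B := IsScalarTower.of_algebraMap_eq' φ.comp_algebraMap.symm
  unfold formMap
  rw [map_smul]
  exact algebra_compatible_smul B a _

theorem formMap_ιMulti_D (φ : A →ₐ[R] B) {n : ℕ} (t : Fin n → A) :
    formMap φ n (exteriorPower.ιMulti A n fun i => D R A (t i)) =
      exteriorPower.ιMulti B n fun i => D R B (φ (t i)) := by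
  let : Algebra A B := φ.toRingHom.toAlgebra
  have : IsScalarTower R A B := IsScalarTower.of_algebraMap_eq' φ.comp_algebraMap.symm
  unfold formMap
  refine (exteriorPower.alternatingMapLinearEquiv_apply_ιMulti _ _).trans ?_
  change exteriorPower.ιMulti B n (fun i => KaehlerDifferential.map R R A B (D R A (t i))) = _
  congr 1
  funext i
  exact KaehlerDifferential.map_D R R A B (t i)

/-- Étale homomorphisms preserve étale coordinates, because `Ω[A⁄R] ⊗ B = Ω[B⁄R]`. -/
theorem exists_basis_of_etale (φ : A →ₐ[R] B) (hφ : φ.toRingHom.Etale) {n : ℕ} {t : Fin n → A}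
    (b : Module.Basis (Fin n) A (Ω[A⁄R])) (hb : ∀ i, b i = D R A (t i)) :
    ∃ b' : Module.Basis (Fin n) B (Ω[B⁄R]), ∀ i, b' i = D R B (φ (t i)) := by
  let : Algebra A B := φ.toRingHom.toAlgebra
  have : IsScalarTower R A B := IsScalarTower.of_algebraMap_eq' φ.comp_algebraMap.symm
  have : Algebra.Etale A B := hφ
  refine ⟨(b.baseChange B).map (tensorKaehlerEquivOfFormallyEtale R A B), fun i => ?_⟩
  rw [Module.Basis.map_apply, Module.Basis.baseChange_apply, hb,
    tensorKaehlerEquivOfFormallyEtale_apply, mapBaseChange_tmul, one_smul, map_D]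
  rfl

/-- The ratio of two generators of a free module of rank one is a unit. -/
theorem isUnit_of_bijective_smul {M : Type*} [AddCommGroup M] [Module A M] {η : M} {h : A}
    (hη : Function.Bijective fun a : A => a • η)
    (hη' : Function.Bijective fun a : A => a • h • η) : IsUnit h := by
  obtain ⟨a, ha⟩ := hη'.2 η
  have : (a * h) • η = (1 : A) • η := by rw [mul_smul, one_smul]; exact ha
  exact IsUnit.of_mul_eq_one a (by rw [mul_comm]; exact hη.1 this)

end Algebra

/-! ### Étale coordinates and differential forms on schemes -/

section Forms

variable {R : Type u} [CommRing R] {X : Scheme.{u}} {f : X ⟶ Spec (.of R)} {n : ℕ}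

theorem etale_res {V W : X.Opens} (hV : IsAffineOpen V) (hW : IsAffineOpen W) (h : W ≤ V) :
    (Sections.res f h).toRingHom.Etale := by
  have h1 := (𝟙 X : X ⟶ X).etale_appLE hV hW h
  have h2 : (𝟙 X : X ⟶ X).appLE V W h = X.presheaf.map (homOfLE h).op :=
    Category.id_comp _
  rw [h2] at h1
  exact h1

theorem etale_pull (U V : X.Opens) (hV : IsAffineOpen V) {W : U.toScheme.Opens}
    (hW : IsAffineOpen W) (h : W ≤ U.ι ⁻¹ᵁ V) :
    (Sections.pull f U h).toRingHom.Etale :=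
  U.ι.etale_appLE hV hW h

theorem IsEtaleCoordinates.res {V W : X.affineOpens} (h : W.1 ≤ V.1) {t : Fin n → Sections f V.1}
    (ht : IsEtaleCoordinates t) : IsEtaleCoordinates fun i => Sections.res f h (t i) := by
  obtain ⟨b, hb⟩ := ht
  exact exists_basis_of_etale _ (etale_res V.2 W.2 h) b hb

theorem IsEtaleCoordinates.pull {U : X.Opens} {V : X.affineOpens} {W : U.toScheme.affineOpens}
    (h : W.1 ≤ U.ι ⁻¹ᵁ V.1) {t : Fin n → Sections f V.1}
    (ht : IsEtaleCoordinates t) : IsEtaleCoordinates fun i => Sections.pull f U h (t i) := by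
  obtain ⟨b, hb⟩ := ht
  exact exists_basis_of_etale _ (etale_pull U V.1 V.2 W.2 h) b hb

theorem IsEtaleCoordinates.smul_dWedge_bijective {V : X.Opens} {t : Fin n → Sections f V}
    (ht : IsEtaleCoordinates t) :
    Function.Bijective fun a : Sections f V => a • dWedge t := by
  obtain ⟨b, hb⟩ := ht
  have h : dWedge t = exteriorPower.ιMulti _ n b := by
    unfold dWedge; congr 1; funext i; exact (hb i).symm
  rw [h]
  exact smul_ιMulti_bijective b

/-- The Jacobian matrix of two systems of étale coordinates is invertible, and its determinant is
the ratio of the forms `dt'₁ ∧ … ∧ dt'ₙ` and `dt₁ ∧ … ∧ dtₙ`. -/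
theorem IsEtaleCoordinates.exists_jacobian {V : X.Opens} {t t' : Fin n → Sections f V}
    (ht : IsEtaleCoordinates t) (ht' : IsEtaleCoordinates t') :
    ∃ J : Matrix (Fin n) (Fin n) (Sections f V), IsUnit J.det ∧
      (∀ i, KaehlerDifferential.D R _ (t' i) = ∑ j, J i j • KaehlerDifferential.D R _ (t j)) ∧
      dWedge t' = J.det • dWedge t := by
  obtain ⟨b, hb⟩ := ht
  obtain ⟨b', hb'⟩ := ht'
  have h : ∀ i, KaehlerDifferential.D R _ (t' i) = b' i := fun i => (hb' i).symm
  have e : dWedge t = exteriorPower.ιMulti _ n b := by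
    unfold dWedge; congr 1; funext i; exact (hb i).symm
  have e' : dWedge t' = exteriorPower.ιMulti _ n b' := by
    unfold dWedge; congr 1; funext i; exact (hb' i).symm
  have hdet : (b.toMatrix b').transpose.det = b.det b' := by
    rw [Matrix.det_transpose, Module.Basis.det_apply]
  refine ⟨(b.toMatrix b').transpose, ?_, fun i => ?_, ?_⟩
  · rw [hdet]; exact b.isUnit_det b'
  · rw [h, ← b.sum_toMatrix_smul_self b' i]
    exact Finset.sum_congr rfl fun j _ => by rw [hb]; rfl
  · rw [hdet, e, e']
    exact ιMulti_eq_det_smul b b'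

/-- The coefficient of a gauge form in étale coordinates is a unit. -/
theorem Form.IsGauge.exists_unit {ω : Form f n} (hω : ω.IsGauge) (V : X.affineOpens)
    {t : Fin n → Sections f V.1} (ht : IsEtaleCoordinates t) :
    ∃ h : Sections f V.1, IsUnit h ∧ ω.val V = h • dWedge t := by
  obtain ⟨h, hh⟩ := ht.smul_dWedge_bijective.2 (ω.val V)
  have h2 := hω V
  rw [← hh] at h2
  exact ⟨h, isUnit_of_bijective_smul (M := ⋀[Sections f V.1]^n (Ω[Sections f V.1⁄R]))
    ht.smul_dWedge_bijective h2, hh.symm⟩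

theorem Form.exists_eq_smul (ω : Form f n) (V : X.affineOpens)
    {t : Fin n → Sections f V.1} (ht : IsEtaleCoordinates t) :
    ∃ h : Sections f V.1, ω.val V = h • dWedge t := by
  obtain ⟨h, hh⟩ := ht.smul_dWedge_bijective.2 (ω.val V)
  exact ⟨h, hh.symm⟩

theorem Form.val_res (ω : Form f n) {V W : X.affineOpens} (hWV : W.1 ≤ V.1)
    {t : Fin n → Sections f V.1} {h : Sections f V.1} (hω : ω.val V = h • dWedge t) :
    ω.val W = Sections.res f hWV h • dWedge fun i => Sections.res f hWV (t i) := by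
  rw [← ω.compat V W hWV, hω, formMap_smul]
  congr 1
  exact formMap_ιMulti_D _ t

/-- The gauge form `dt₁ ∧ … ∧ dtₙ` on the domain `V` of étale coordinates. -/
noncomputable def coordinateForm {V : X.affineOpens} (t : Fin n → Sections f V.1) :
    Form (V.1.ι ≫ f) n where
  val W := dWedge fun i => Sections.pull f V.1 (V := V.1) (W := W.1)
    (by rw [Scheme.Opens.ι_preimage_self]; exact le_top) (t i)
  compat W W' h := by
    refine (formMap_ιMulti_D _ _).trans ?_
    unfold dWedge
    congr 1
    funext i
    congr 1
    exact congr($(Sections.res_pull (f := f) (U := V.1) (V := V.1) (W := W.1) (W' := W'.1)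
      (by rw [Scheme.Opens.ι_preimage_self]; exact le_top) h) (t i))

theorem coordinateForm_isGauge {V : X.affineOpens} {t : Fin n → Sections f V.1}
    (ht : IsEtaleCoordinates t) : (coordinateForm t).IsGauge := fun W =>
  (ht.pull (W := W) (by rw [Scheme.Opens.ι_preimage_self]; exact le_top)).smul_dWedge_bijective

/-- A smooth scheme has étale coordinates locally. -/
theorem exists_isEtaleCoordinates [SmoothOfRelativeDimension n f] (U : X.Opens) {x : X}
    (hx : x ∈ U) : ∃ V : X.affineOpens, V.1 ≤ U ∧ x ∈ V.1 ∧
      ∃ t : Fin n → Sections f V.1, IsEtaleCoordinates t := by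
  obtain ⟨V₀, hV₀, hxV₀, hV₀U⟩ := exists_isAffineOpen_mem_and_subset hx
  obtain ⟨s, hs, hP⟩ := HasRingHomProperty.appLE (P := @SmoothOfRelativeDimension n) f
    inferInstance ⟨⊤, isAffineOpen_top _⟩ ⟨V₀, hV₀⟩ le_top
  have hxs : x ∈ ⨆ i ∈ s, X.basicOpen i := by
    rw [iSup_basicOpen_of_span_eq_top V₀ s hs]; exact hxV₀
  simp only [TopologicalSpace.Opens.mem_iSup] at hxs
  obtain ⟨g, hg, hxg⟩ := hxs
  refine ⟨⟨X.basicOpen g, hV₀.basicOpen g⟩, (X.basicOpen_le g).trans hV₀U, hxg, ?_⟩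
  have hloc := hV₀.isLocalization_basicOpen g
  have hiso := RingHom.isStandardSmoothOfRelativeDimension_respectsIso (n := n)
  let e : Localization.Away g ≃ₐ[Γ(X, V₀)] Γ(X, X.basicOpen g) :=
    IsLocalization.algEquiv (Submonoid.powers g) _ _
  have h1 := hiso.1 _ e.toRingEquiv (hP g hg)
  have h2 := hiso.2 _ (Scheme.ΓSpecIso (.of R)).symm.commRingCatIsoToRingEquiv h1
  have h3 : (algebraMap R (Sections f (X.basicOpen g))).IsStandardSmoothOfRelativeDimension n := by
    refine (RingHom.ext fun r => ?_ : algebraMap R (Sections f (X.basicOpen g)) = _) ▸ h2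
    have h := f.appLE_map (U := ⊤) (V := V₀) (V' := X.basicOpen g) le_top
      (homOfLE (X.basicOpen_le g)).op
    have h' := congr($(h).hom ((Scheme.ΓSpecIso (.of R)).inv.hom r))
    refine h'.symm.trans ?_
    exact (e.commutes _).symm
  have h4 := RingHom.isStandardSmoothOfRelativeDimension_algebraMap n |>.1 h3
  obtain ⟨φ, hφ⟩ := Algebra.IsStandardSmoothOfRelativeDimension.exists_etale_mvPolynomial n R
    (Sections f (X.basicOpen g))
  -- `φ` lives on a polynomial ring over `R`, whose differentials are free on the `dTᵢ`
  refine ⟨fun i => φ (MvPolynomial.X i), ?_⟩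
  exact exists_basis_of_etale φ hφ (KaehlerDifferential.mvPolynomialBasis R (Fin n))
    (fun i => KaehlerDifferential.mvPolynomialBasis_apply R (Fin n) i)

end Forms

/-! ### Étale coordinates on `F`-valued points -/

section Coordinates
open Filter

variable {R : Type u} [CommRing R] {X : Scheme.{u}} {f : X ⟶ Spec (.of R)} {n : ℕ}

open Classical in
/-- The value of a function on an open subscheme `V` at a point, extended by zero to the points
outside `V`. -/
noncomputable def Points.value {A : Type u} [CommRing A] [Algebra R A] {V : X.Opens}
    (s : Sections f V) (y : Points f A) : A :=
  if hy : y.1 ⁻¹ᵁ V = ⊤ then y.eval hy s else 0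

theorem Points.value_eq {A : Type u} [CommRing A] [Algebra R A] {V : X.Opens}
    (s : Sections f V) {y : Points f A} (hy : y.1 ⁻¹ᵁ V = ⊤) : Points.value s y = y.eval hy s :=
  dif_pos hy

/-- The map to affine space given by functions `t₁, …, tₙ` on `V`. -/
noncomputable def coordMap {A : Type u} [CommRing A] [Algebra R A] {V : X.Opens}
    (t : Fin n → Sections f V) (y : Points f A) : Fin n → A :=
  fun i => Points.value (t i) y

theorem coordMap_eq {A : Type u} [CommRing A] [Algebra R A] {V : X.Opens}
    (t : Fin n → Sections f V) {y : Points f A} (hy : y.1 ⁻¹ᵁ V = ⊤) :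
    coordMap t y = fun i => y.eval hy (t i) :=
  funext fun i => Points.value_eq (t i) hy

variable {F : Type u} [NontriviallyNormedField F] [Algebra R F]

theorem continuousAt_coordMap {V : X.affineOpens} (t : Fin n → Sections f V.1) {x : Points f F}
    (hx : x.1 ⁻¹ᵁ V.1 = ⊤) : ContinuousAt (coordMap t) x := by
  have h := (isOpen_pointsIn_affine (f := f) (A := F) V).isOpenEmbedding_subtypeVal
  refine (h.continuousAt_iff (x := ⟨x, hx⟩)).1 ?_
  have h2 : Continuous fun (y : pointsIn f F V.1) i => y.1.eval y.2 (t i) :=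
    continuous_pi fun i => continuous_eval V (t i)
  refine (h2.congr fun y => (coordMap_eq t y.2).symm).continuousAt

variable [CompleteSpace F] [Smooth f]

/-- Étale coordinates are local homeomorphisms from `V(F)` to `F ^ n`; in these coordinates a
function `s` with `ds = ∑ cⱼ dtⱼ` has partial derivatives `cⱼ`. -/
theorem exists_localSection {V : X.affineOpens} {t : Fin n → Sections f V.1}
    (ht : IsEtaleCoordinates t) {x : Points f F} (hx : x.1 ⁻¹ᵁ V.1 = ⊤) :
    ∃ σ : (Fin n → F) → Points f F, (∀ z, (σ z).1 ⁻¹ᵁ V.1 = ⊤) ∧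
      (∀ᶠ y in 𝓝 x, σ (coordMap t y) = y) ∧
      (∀ᶠ z in 𝓝 (coordMap t x), coordMap t (σ z) = z) ∧
      ContinuousAt σ (coordMap t x) ∧
      ∀ (s : Sections f V.1) (c : Fin n → Sections f V.1),
        KaehlerDifferential.D R _ s = ∑ j, c j • KaehlerDifferential.D R _ (t j) →
        HasStrictFDerivAt (fun z => Points.value s (σ z))
          (∑ j, Points.value (c j) x • (ContinuousLinearMap.proj j : (Fin n → F) →L[F] F))
          (coordMap t x) := by
  have := smooth_sections (f := f) V
  obtain ⟨b, hb⟩ := ht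
  obtain ⟨τ, h1, h2, h3⟩ := exists_localInverse b hb (x.evalHom hx)
  have hcx : coordMap t x = fun i => x.evalHom hx (t i) := coordMap_eq t hx
  have hval : ∀ (s : Sections f V.1) z, Points.value s (Points.ofAlgHom V (τ z)) = τ z s := by
    intro s z
    rw [Points.value_eq s (Points.preimage_ofAlgHom V (τ z)), Points.eval_eq,
      Points.evalHom_ofAlgHom]
  have hstrict : ∀ (s : Sections f V.1) (c : Fin n → Sections f V.1),
        KaehlerDifferential.D R _ s = ∑ j, c j • KaehlerDifferential.D R _ (t j) →
        HasStrictFDerivAt (fun z => τ z s)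
          (∑ j, Points.value (c j) x • (ContinuousLinearMap.proj j : (Fin n → F) →L[F] F))
          (coordMap t x) := by
    intro s c hc
    rw [hcx]
    simp only [Points.value_eq _ hx]
    exact h3 s c hc
  have hself : τ (coordMap t x) = x.evalHom hx := by
    rw [hcx]
    obtain ⟨O, hO, hOτ⟩ := mem_comap.1 h1
    exact hOτ (show (fun s => x.evalHom hx s) ∈ O from mem_of_mem_nhds hO)
  refine ⟨fun z => Points.ofAlgHom V (τ z), fun z => Points.preimage_ofAlgHom V _, ?_, ?_, ?_, ?_⟩
  · rw [Points.nhds_eq V ⟨x, hx⟩, eventually_map]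
    have h4 : ∀ᶠ y : pointsIn f F V.1 in comap (fun y : pointsIn f F V.1 => y.1.evalHom y.2)
        (comap (fun (y : Sections f V.1 →ₐ[R] F) s => y s) (𝓝 fun s => x.evalHom hx s)),
        τ (fun i => y.1.evalHom y.2 (t i)) = y.1.evalHom y.2 := h1.comap _
    rw [comap_comap] at h4
    refine h4.mono fun y hy => ?_
    rw [coordMap_eq t y.2]
    exact (congrArg (Points.ofAlgHom V) hy).trans (y.1.ofAlgHom_evalHom y.2)
  · rw [hcx]
    filter_upwards [h2] with z hz
    funext i
    exact (hval _ _).trans (hz i)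
  · rw [ContinuousAt, hself, Points.ofAlgHom_evalHom, Points.nhds_eq V ⟨x, hx⟩]
    have h5 : Tendsto (fun z => (⟨Points.ofAlgHom V (τ z), Points.preimage_ofAlgHom V (τ z)⟩ :
        pointsIn f F V.1)) (𝓝 (coordMap t x)) (comap
          (fun (y : pointsIn f F V.1) s => y.1.eval y.2 s)
          (𝓝 fun s => x.eval hx s)) := by
      rw [tendsto_comap_iff, tendsto_pi_nhds]
      intro s
      obtain ⟨c, hc⟩ : ∃ c : Fin n → Sections f V.1, KaehlerDifferential.D R _ s =
          ∑ j, c j • KaehlerDifferential.D R _ (t j) := by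
        refine ⟨fun j => b.repr (KaehlerDifferential.D R _ s) j, ?_⟩
        conv_lhs => rw [← b.sum_repr (KaehlerDifferential.D R _ s)]
        exact Finset.sum_congr rfl fun j _ => by rw [hb]
      have h6 := (hstrict s c hc).continuousAt
      rw [ContinuousAt, hself] at h6
      refine h6.congr fun z => ?_
      exact congr($(Points.evalHom_ofAlgHom V (τ z)) s).symm
    exact tendsto_map.comp h5
  · intro s c hc
    simp only [hval]
    exact hstrict s c hc

/-- Étale coordinates are open and continuous at each point of their domain. -/
theorem map_coordMap_nhds {V : X.affineOpens} {t : Fin n → Sections f V.1}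
    (ht : IsEtaleCoordinates t) {x : Points f F} (hx : x.1 ⁻¹ᵁ V.1 = ⊤) :
    Filter.map (coordMap t) (𝓝 x) = 𝓝 (coordMap t x) := by
  obtain ⟨σ, -, h1, h2, h3, -⟩ := exists_localSection ht hx
  refine le_antisymm (continuousAt_coordMap t hx) ?_
  have h4 : Tendsto σ (𝓝 (coordMap t x)) (𝓝 x) := by
    have := h1.self_of_nhds
    rw [ContinuousAt, this] at h3; exact h3
  calc 𝓝 (coordMap t x) = Filter.map (fun z => coordMap t (σ z)) (𝓝 (coordMap t x)) := by
        rw [Filter.map_congr (m₁ := fun z => coordMap t (σ z)) (m₂ := id) h2, Filter.map_id]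
    _ = Filter.map (coordMap t) (Filter.map σ (𝓝 (coordMap t x))) := by
        rw [Filter.map_map]; rfl
    _ ≤ _ := Filter.map_mono h4

/-- So are all local parameters in which a form has a coefficient, since they differ from étale
coordinates by a map with invertible derivative. -/
theorem Form.HasCoefficientAt.map_nhds {ω : Form f n} {x : Points f F}
    {θ : Points f F → Fin n → F} {c : F} (hω : ω.HasCoefficientAt x θ c) :
    Filter.map θ (𝓝 x) = 𝓝 (θ x) := by
  obtain ⟨V, hx, t, h, Φ, Φ', ht, -, hθ, hΦ, hΦ', hdet, -⟩ := hω
  have hθ' : ∀ᶠ y in 𝓝 x, θ y = Φ (coordMap t y) := by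
    filter_upwards [hθ] with y ⟨hy, hyθ⟩
    rw [hyθ, coordMap_eq t hy]
  rw [← coordMap_eq t hx] at hΦ hΦ'
  have hs : HasStrictFDerivAt Φ (Φ'.toContinuousLinearEquivOfDetNeZero hdet : (Fin n → F) →L[F] _)
      (coordMap t x) := by
    rw [ContinuousLinearMap.coe_toContinuousLinearEquivOfDetNeZero, ← hΦ'.fderiv]
    exact hΦ.hasStrictFDerivAt
  rw [Filter.map_congr hθ', ← Function.comp_def, ← Filter.map_map, map_coordMap_nhds ht hx,
    hs.map_nhds_eq_of_equiv, hθ'.self_of_nhds]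

/-- The change of coordinates between two systems of étale coordinates is strictly differentiable,
and its differential is the Jacobian matrix. -/
theorem exists_localSection_jacobian {V : X.affineOpens} {t t' : Fin n → Sections f V.1}
    (ht : IsEtaleCoordinates t) (ht' : IsEtaleCoordinates t') {x : Points f F}
    (hx : x.1 ⁻¹ᵁ V.1 = ⊤) :
    ∃ (σ : (Fin n → F) → Points f F) (J : Sections f V.1) (D : (Fin n → F) →L[F] Fin n → F),
      (∀ᶠ y in 𝓝 x, σ (coordMap t y) = y) ∧ dWedge t' = J • dWedge t ∧
      D.det = x.eval hx J ∧ D.det ≠ 0 ∧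
      HasStrictFDerivAt (fun z => coordMap t' (σ z)) D (coordMap t x) := by
  obtain ⟨σ, -, h1, -, -, h3⟩ := exists_localSection ht hx
  obtain ⟨J, hJu, hJ, hdJ⟩ := ht.exists_jacobian ht'
  let M : Matrix (Fin n) (Fin n) F := (x.evalHom hx).toRingHom.mapMatrix J
  let D : (Fin n → F) →L[F] Fin n → F := LinearMap.toContinuousLinearMap (Matrix.toLin' M)
  have hD : D.det = x.eval hx J.det := by
    have : D.det = LinearMap.det (Matrix.toLin' M) := rfl
    rw [this, LinearMap.det_toLin']
    exact ((x.evalHom hx).toRingHom.map_det J).symm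
  refine ⟨σ, J.det, D, h1, hdJ, hD, ?_, ?_⟩
  · rw [hD]; exact (hJu.map (x.evalHom hx)).ne_zero
  · refine hasStrictFDerivAt_pi'' fun i => ?_
    have hDi : (ContinuousLinearMap.proj i : (Fin n → F) →L[F] F).comp D =
        ∑ j, Points.value (J i j) x • (ContinuousLinearMap.proj j : (Fin n → F) →L[F] F) := by
      ext v
      simp [D, M, Matrix.mulVec, dotProduct, Points.value_eq _ hx]
      rfl
    rw [hDi]
    exact h3 (t' i) (J i) (hJ i)

/-- If `ω` has the coefficients `c` and `c'` in the local parameters `θ` and `θ'`, then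
`c = c' det D` for the differential `D` of the change of parameters. -/
theorem Form.HasCoefficientAt.transition {ω : Form f n} {x : Points f F}
    {θ θ' : Points f F → Fin n → F} {c c' : F} (hω : ω.HasCoefficientAt x θ c)
    (hω' : ω.HasCoefficientAt x θ' c') {ρ : (Fin n → F) → Points f F}
    (hρ : ∀ᶠ y in 𝓝 x, ρ (θ y) = y) :
    ∃ D : (Fin n → F) →L[F] Fin n → F, D.det ≠ 0 ∧ c = D.det * c' ∧
      HasStrictFDerivAt (fun z => θ' (ρ z)) D (θ x) := by
  have hmap := hω.map_nhds
  obtain ⟨V, hx, t, h, Φ, Φ', ht, hh, hθ, hΦ, hΦ', hdet, hc⟩ := hω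
  obtain ⟨V₁, hx₁, t₁, h₁, Φ₁, Φ₁', ht₁, hh₁, hθ₁, hΦ₁, hΦ₁', hdet₁, hc₁⟩ := hω'
  have hθ' : ∀ᶠ y in 𝓝 x, θ y = Φ (coordMap t y) := by
    filter_upwards [hθ] with y ⟨hy, hyθ⟩
    rw [hyθ, coordMap_eq t hy]
  have hθ₁' : ∀ᶠ y in 𝓝 x, θ' y = Φ₁ (coordMap t₁ y) := by
    filter_upwards [hθ₁] with y ⟨hy, hyθ⟩
    rw [hyθ, coordMap_eq t₁ hy]
  rw [← coordMap_eq t hx] at hΦ hΦ'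
  rw [← coordMap_eq t₁ hx₁] at hΦ₁ hΦ₁'
  -- pass to a common affine neighbourhood `W`
  obtain ⟨W, hW, hxW⟩ := x.exists_affine (Points.preimage_inf hx hx₁)
  have hWV : W.1 ≤ V.1 := hW.trans inf_le_left
  have hWV₁ : W.1 ≤ V₁.1 := hW.trans inf_le_right
  obtain ⟨σ, J, D, h1, hJ, hDJ, hD0, hD⟩ :=
    exists_localSection_jacobian (ht.res hWV) (ht₁.res hWV₁) hxW
  have hres : ∀ y : Points f F, y.1 ⁻¹ᵁ W.1 = ⊤ →
      coordMap (fun i => Sections.res f hWV (t i)) y = coordMap t y := by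
    intro y hy
    rw [coordMap_eq _ hy, coordMap_eq _ (Points.preimage_mono hWV hy)]
    exact funext fun i => Points.eval_res y hWV hy (t i)
  have hres₁ : ∀ y : Points f F, y.1 ⁻¹ᵁ W.1 = ⊤ →
      coordMap (fun i => Sections.res f hWV₁ (t₁ i)) y = coordMap t₁ y := by
    intro y hy
    rw [coordMap_eq _ hy, coordMap_eq _ (Points.preimage_mono hWV₁ hy)]
    exact funext fun i => Points.eval_res y hWV₁ hy (t₁ i)
  rw [hres x hxW] at hD
  have hxnhds : ∀ᶠ y : Points f F in 𝓝 x, y.1 ⁻¹ᵁ W.1 = ⊤ :=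
    (isOpen_pointsIn_affine (f := f) (A := F) W).mem_nhds hxW
  -- the coefficient functions satisfy `h = h₁ J`
  have hhJ : x.eval hx h = x.eval hx₁ h₁ * x.eval hxW J := by
    have e := ω.val_res hWV hh
    rw [ω.val_res hWV₁ hh₁, hJ, smul_smul] at e
    have e' := (ht.res hWV).smul_dWedge_bijective.1 e
    have e'' := congrArg (x.evalHom hxW) e'
    rw [map_mul] at e''
    have a1 := Points.eval_res x hWV hxW h
    have a2 := Points.eval_res x hWV₁ hxW h₁
    exact a1.symm.trans (e''.symm.trans (congrArg (fun a => a * _) a2))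
  let eΦ := Φ'.toContinuousLinearEquivOfDetNeZero hdet
  have heΦ : (eΦ : (Fin n → F) →L[F] Fin n → F) = Φ' :=
    ContinuousLinearMap.coe_toContinuousLinearEquivOfDetNeZero Φ' hdet
  have hs : HasStrictFDerivAt Φ (eΦ : (Fin n → F) →L[F] Fin n → F) (coordMap t x) := by
    rw [heΦ, ← hΦ'.fderiv]
    exact hΦ.hasStrictFDerivAt
  have hs₁ : HasStrictFDerivAt Φ₁ Φ₁' (coordMap t₁ x) := by
    rw [← hΦ₁'.fderiv]
    exact hΦ₁.hasStrictFDerivAt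
  have hinv := hs.to_localInverse
  set Ψ := hs.localInverse Φ eΦ (coordMap t x) with hΨ
  have hΨx : Ψ (θ x) = coordMap t x := by
    rw [hθ'.self_of_nhds]; exact hs.localInverse_apply_image
  have hσx : σ (coordMap t x) = x := by
    have := h1.self_of_nhds
    rwa [hres x hxW] at this
  rw [← hθ'.self_of_nhds] at hinv
  have hD' : HasStrictFDerivAt (fun z => coordMap (fun i => Sections.res f hWV₁ (t₁ i)) (σ z)) D
      (Ψ (θ x)) := by rw [hΨx]; exact hD
  have hs₁' : HasStrictFDerivAt Φ₁ Φ₁'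
      (coordMap (fun i => Sections.res f hWV₁ (t₁ i)) (σ (Ψ (θ x)))) := by
    rw [hΨx, hσx, hres₁ x hxW]; exact hs₁
  have hcomp := hs₁'.comp (θ x) (hD'.comp (θ x) hinv)
  have hdetinv : (eΦ.symm : (Fin n → F) →L[F] Fin n → F).det * Φ'.det = 1 := by
    rw [← heΦ]
    change LinearMap.det _ * LinearMap.det _ = 1
    rw [← LinearMap.det_comp]
    convert LinearMap.det_id using 2
    ext v
    simp
  have hdetcomp : (Φ₁'.comp (D.comp (eΦ.symm : (Fin n → F) →L[F] Fin n → F))).det =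
      Φ₁'.det * (D.det * (eΦ.symm : (Fin n → F) →L[F] Fin n → F).det) := by
    change LinearMap.det _ = LinearMap.det _ * (LinearMap.det _ * LinearMap.det _)
    rw [← LinearMap.det_comp, ← LinearMap.det_comp]
    rfl
  refine ⟨_, ?_, ?_, hcomp.congr_of_eventuallyEq ?_⟩
  · rw [hdetcomp]
    exact mul_ne_zero hdet₁ (mul_ne_zero hD0 (left_ne_zero_of_mul_eq_one hdetinv))
  · rw [hdetcomp, hDJ]
    have : c = c * Φ'.det * (eΦ.symm : (Fin n → F) →L[F] Fin n → F).det := by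
      rw [mul_assoc, mul_comm Φ'.det, hdetinv, mul_one]
    rw [this, ← hc, hhJ, hc₁]
    ring
  · rw [Filter.EventuallyEq, ← hmap, Filter.eventually_map]
    have hleft : ∀ᶠ y in 𝓝 x, Ψ (Φ (coordMap t y)) = coordMap t y :=
      (continuousAt_coordMap t hx).eventually hs.eventually_left_inverse
    filter_upwards [hρ, hθ', hθ₁', h1, hxnhds, hleft] with y y1 y2 y3 y4 y5 y6
    rw [hres y y5] at y4
    rw [y1, y3, y2, y6, y4, hres₁ y y5]

end Coordinates

/-! ### Charts -/

instance {R : Type u} [CommRing R] {X : Scheme.{u}} {f : X ⟶ Spec (.of R)} (A : Type u)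
    [CommRing A] [Algebra R A] [TopologicalSpace A] : BorelSpace (Points f A) := ⟨rfl⟩

section Chart
open Filter Set

/-- An injective local homeomorphism is an open embedding. -/
theorem isOpenEmbedding_domRestrict {α β : Type*} [TopologicalSpace α] [TopologicalSpace β]
    {W : Set α} {θ : α → β} (hW : IsOpen W) (hinj : InjOn θ W)
    (hθ : ∀ x ∈ W, Filter.map θ (𝓝 x) = 𝓝 (θ x)) : IsOpenEmbedding (W.domRestrict θ) := by
  have hmap : ∀ x : W, Filter.map (W.domRestrict θ) (𝓝 x) = 𝓝 (W.domRestrict θ x) := by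
    intro x
    have h1 : 𝓝 (x : α) = Filter.map Subtype.val (𝓝 x) :=
      (map_nhds_subtype_coe_eq_nhds x.2 (hW.mem_nhds x.2)).symm
    have h2 := hθ x x.2
    rw [h1, Filter.map_map] at h2
    exact h2
  exact .of_continuous_injective_isOpenMap (continuous_iff_continuousAt.2 fun x => (hmap x).le)
    hinj.injective (isOpenMap_iff_nhds_le.2 fun x => (hmap x).ge)

/-- An open embedding of a subspace maps Borel sets contained in it to Borel sets, whether or not
the subspace itself is Borel. -/
theorem _root_.Topology.IsOpenEmbedding.measurableSet_image_of_domRestrict {α β : Type*}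
    [TopologicalSpace α] [TopologicalSpace β] [MeasurableSpace α] [BorelSpace α]
    [MeasurableSpace β] [BorelSpace β] {W : Set α} {θ : α → β}
    (h : IsOpenEmbedding (W.domRestrict θ)) {E : Set α} (hE : E ⊆ W) (hEm : MeasurableSet E) :
    MeasurableSet (θ '' E) := by
  have h1 : θ '' E = W.domRestrict θ '' (Subtype.val ⁻¹' E) := by
    rw [domRestrict_eq, image_comp, Subtype.image_preimage_coe, inter_eq_self_of_subset_right hE]
  rw [h1]
  exact h.measurableEmbedding.measurableSet_image.2 (measurable_subtype_coe hEm)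

variable {R : Type u} [CommRing R] {F : Type u} [NontriviallyNormedField F] [Algebra R F]
  {X : Scheme.{u}} {f : X ⟶ Spec (.of R)} {n : ℕ}
  {ω : Form f n} {W : Set (Points f F)} {θ : Points f F → Fin n → F} {g : (Fin n → F) → F}

/-- In étale coordinates the coefficient of a form is the algebraic one. -/
theorem Form.hasCoefficientAt_coordMap {V : X.affineOpens} {t : Fin n → Sections f V.1}
    (ht : IsEtaleCoordinates t) {h : Sections f V.1} (hh : ω.val V = h • dWedge t)
    {y : Points f F} (hy : y.1 ⁻¹ᵁ V.1 = ⊤) :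
    ω.HasCoefficientAt y (coordMap t) (y.eval hy h) := by
  refine ⟨V, hy, t, h, id, ContinuousLinearMap.id F _, ht, hh, ?_, analyticAt_id,
    hasFDerivAt_id _, ?_, ?_⟩
  · filter_upwards [(isOpen_pointsIn_affine (f := f) (A := F) V).mem_nhds hy] with z hz
    exact ⟨hz, coordMap_eq t hz⟩
  · rw [ContinuousLinearMap.det]; simp
  · rw [ContinuousLinearMap.det]
    simp only [ContinuousLinearMap.coe_id, LinearMap.det_id, mul_one]

variable [CompleteSpace F] [Smooth f]

theorem Form.IsChart.measurableSet_image [MeasurableSpace F] [BorelSpace F]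
    [SecondCountableTopology F] (h : ω.IsChart W θ g) {E : Set (Points f F)} (hE : E ⊆ W)
    (hEm : MeasurableSet E) : MeasurableSet (θ '' E) :=
  (isOpenEmbedding_domRestrict h.isOpen h.injOn
    fun x hx => (h.coeff x hx).map_nhds).measurableSet_image_of_domRestrict hE hEm

/-- Étale coordinates are a chart near each point of their domain. -/
theorem Form.exists_isChart [SmoothOfRelativeDimension n f] (ω : Form f n) (x : Points f F) :
    ∃ W θ g, x ∈ W ∧ ω.IsChart W θ g := by
  obtain ⟨V, -, hxV, t, ht⟩ := exists_isEtaleCoordinates (f := f) (n := n) ⊤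
    (x := x.1 (IsLocalRing.closedPoint F)) trivial
  have hx : x.1 ⁻¹ᵁ V.1 = ⊤ := (IsLocalRing.closedPoint_mem_iff (x.1 ⁻¹ᵁ V.1)).1 hxV
  obtain ⟨h, hh⟩ := ω.exists_eq_smul V ht
  obtain ⟨σ, hσ, h1, -⟩ := exists_localSection ht hx
  have h2 : ∀ᶠ y in 𝓝 x, σ (coordMap t y) = y ∧ y.1 ⁻¹ᵁ V.1 = ⊤ :=
    h1.and ((isOpen_pointsIn_affine (f := f) (A := F) V).mem_nhds hx)
  obtain ⟨W, hW, hWo, hxW⟩ := eventually_nhds_iff.1 h2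
  -- `σ` inverts the coordinates on `W`, so the coefficient is a function of the coordinates
  refine ⟨W, coordMap t, fun z => Points.value h (σ z), hxW, hWo, ?_, ?_⟩
  · intro y hy y' hy' hyy
    rw [← (hW y hy).1, ← (hW y' hy').1, hyy]
  · intro y hy
    obtain ⟨hy1, hy2⟩ := hW y hy
    rw [hy1, Points.value_eq h hy2]
    exact ω.hasCoefficientAt_coordMap ht hh hy2

end Chart

/-! ### The Weil measure -/

section Weil
open Filter Set

variable {R : Type u} [CommRing R] {F : Type u} [NontriviallyNormedField F] [Algebra R F]
  {X : Scheme.{u}} {f : X ⟶ Spec (.of R)} {n : ℕ}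
  (p : ℕ) [Fact p.Prime] [NormedAlgebra ℚ_[p] F] [FiniteDimensional ℚ_[p] F]
  [MeasurableSpace F] [BorelSpace F]
  {ω : Form f n} {W : Set (Points f F)} {θ : Points f F → Fin n → F} {g : (Fin n → F) → F}

/-- Two charts give the same measure to a set which lies in both. -/
theorem Form.IsChart.lintegral_image_eq [Smooth f] (h : ω.IsChart W θ g)
    {W' : Set (Points f F)} {θ' : Points f F → Fin n → F} {g' : (Fin n → F) → F}
    (h' : ω.IsChart W' θ' g') {E : Set (Points f F)} (hE : E ⊆ W) (hE' : E ⊆ W')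
    (hEm : MeasurableSet E) :
    ∫⁻ z in θ '' E, ENNReal.ofReal (absNorm p (g z)) ∂(haar p F n) =
      ∫⁻ z in θ' '' E, ENNReal.ofReal (absNorm p (g' z)) ∂(haar p F n) := by
  have := properSpace_of_padic p F
  rcases E.eq_empty_or_nonempty with rfl | ⟨x₀, hx₀⟩
  · simp
  have : Nonempty (Points f F) := ⟨x₀⟩
  let ρ := Function.invFunOn θ W
  have hρ : ∀ y ∈ W, ρ (θ y) = y := fun y hy => h.injOn.leftInvOn_invFunOn hy
  have htr : ∀ x ∈ E, ∃ D : (Fin n → F) →L[F] Fin n → F, D.det ≠ 0 ∧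
      g (θ x) = D.det * g' (θ' x) ∧ HasStrictFDerivAt (fun z => θ' (ρ z)) D (θ x) :=
    fun x hx => (h.coeff x (hE hx)).transition (h'.coeff x (hE' hx))
      (eventually_of_mem (h.isOpen.mem_nhds (hE hx)) hρ)
  have htr' : ∀ z : Fin n → F, ∃ D : (Fin n → F) →L[F] Fin n → F, z ∈ θ '' E → D.det ≠ 0 ∧
      g z = D.det * g' (θ' (ρ z)) ∧ HasStrictFDerivAt (fun z => θ' (ρ z)) D z := by
    intro z
    by_cases hz : z ∈ θ '' E
    · obtain ⟨x, hx, rfl⟩ := hz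
      obtain ⟨D, h1, h2, h3⟩ := htr x hx
      refine ⟨D, fun _ => ⟨h1, ?_, h3⟩⟩
      rw [hρ x (hE hx)]; exact h2
    · exact ⟨0, fun h => absurd h hz⟩
  choose D hD using htr'
  have himg : (fun z => θ' (ρ z)) '' (θ '' E) = θ' '' E := by
    rw [image_image]
    exact image_congr fun x hx => by rw [hρ x (hE hx)]
  rw [← himg]
  refine (PadicMeasure.lintegral_image_eq p (h.measurableSet_image hE hEm) ?_
    (fun z hz => (hD z hz).2.2) (fun z hz => (hD z hz).1) _ _ fun z hz => ?_).symm
  · rintro _ ⟨x, hx, rfl⟩ _ ⟨y, hy, rfl⟩ hxy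
    simp only [hρ x (hE hx), hρ y (hE hy)] at hxy
    rw [h'.injOn (hE' hx) (hE' hy) hxy]
  · rw [(hD z hz).2.1, absNorm_mul, ENNReal.ofReal_mul (absNorm_nonneg p _)]

theorem Form.IsChart.lintegral_iUnion (h : ω.IsChart W θ g) [Smooth f] {ι : Type*} [Countable ι]
    {E : ι → Set (Points f F)} (hE : ∀ i, E i ⊆ W) (hEm : ∀ i, MeasurableSet (E i))
    (hdisj : Pairwise (Function.onFun Disjoint E)) :
    ∫⁻ z in θ '' ⋃ i, E i, ENNReal.ofReal (absNorm p (g z)) ∂(haar p F n) =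
      ∑' i, ∫⁻ z in θ '' E i, ENNReal.ofReal (absNorm p (g z)) ∂(haar p F n) := by
  have := properSpace_of_padic p F
  rw [image_iUnion]
  refine MeasureTheory.lintegral_iUnion (fun i => h.measurableSet_image (hE i) (hEm i)) ?_ _
  intro i j hij
  exact (hdisj hij).image h.injOn (hE i) (hE j)

/-- Weil's measure is glued from the measures `|g(t)| dt` on countably many disjoint pieces of
charts which cover `X(F)`. -/
theorem Form.existsUnique_isWeilMeasure [SmoothOfRelativeDimension n f]
    [SecondCountableTopology (Points f F)] (ω : Form f n) :
    ∃! ν : Measure (Points f F), ω.IsWeilMeasure p ν := by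
  have := properSpace_of_padic p F
  have : Smooth f := SmoothOfRelativeDimension.smooth n f
  rcases isEmpty_or_nonempty (Points f F) with he | hne
  · refine ⟨0, fun W θ g _ E hE _ => ?_, fun ν _ => Subsingleton.elim _ _⟩
    rw [eq_empty_of_isEmpty E]; simp
  choose W θ g hxW hchart using fun x : Points f F => ω.exists_isChart x
  obtain ⟨S, hS, hSW⟩ := TopologicalSpace.countable_cover_nhds
    (fun x => (hchart x).isOpen.mem_nhds (hxW x))
  have hSne : S.Nonempty := by
    by_contra h
    rw [not_nonempty_iff_eq_empty.1 h] at hSW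
    rw [biUnion_empty] at hSW
    exact empty_ne_univ hSW
  obtain ⟨a, rfl⟩ := hS.exists_eq_range hSne
  let P : ℕ → Set (Points f F) := disjointed fun k => W (a k)
  have hPW : ∀ k, P k ⊆ W (a k) := disjointed_subset _
  have hPm : ∀ k, MeasurableSet (P k) := fun k =>
    MeasurableSet.disjointed (fun k => (hchart (a k)).isOpen.measurableSet) k
  have hPd : Pairwise (Function.onFun Disjoint P) := disjoint_disjointed _
  have hPU : ⋃ k, P k = univ := by
    rw [iUnion_disjointed, ← hSW, biUnion_range]
  have hEP : ∀ E : Set (Points f F), ⋃ k, E ∩ P k = E := by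
    intro E; rw [← inter_iUnion, hPU, inter_univ]
  let m (E : Set (Points f F)) : ℝ≥0∞ := ∑' k, ∫⁻ z in θ (a k) '' (E ∩ P k),
    ENNReal.ofReal (absNorm p (g (a k) z)) ∂(haar p F n)
  -- `m` has the value required by any chart
  have hm : ∀ {W' θ' g'}, ω.IsChart W' θ' g' → ∀ E ⊆ W', MeasurableSet E →
      m E = ∫⁻ z in θ' '' E, ENNReal.ofReal (absNorm p (g' z)) ∂(haar p F n) := by
    intro W' θ' g' h' E hE hEm
    have h1 := h'.lintegral_iUnion p (E := fun k => E ∩ P k)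
      (fun k => inter_subset_left.trans hE) (fun k => hEm.inter (hPm k))
      (fun i j hij => (hPd hij).mono inter_subset_right inter_subset_right)
    rw [hEP] at h1
    rw [h1]
    refine tsum_congr fun k => ?_
    exact (hchart (a k)).lintegral_image_eq p h' (inter_subset_right.trans (hPW k))
      (inter_subset_left.trans hE) (hEm.inter (hPm k))
  let ν : Measure (Points f F) := Measure.ofMeasurable (fun E _ => m E) (by simp [m]) (by
    intro E hE hEd
    simp only [m]
    rw [ENNReal.tsum_comm]
    refine tsum_congr fun k => ?_
    rw [iUnion_inter]
    exact (hchart (a k)).lintegral_iUnion p (fun i => inter_subset_right.trans (hPW k))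
      (fun i => (hE i).inter (hPm k))
      (fun i j hij => (hEd hij).mono inter_subset_left inter_subset_left))
  have hν : ∀ E, MeasurableSet E → ν E = m E := fun E hE => Measure.ofMeasurable_apply E hE
  refine ⟨ν, fun W' θ' g' h' E hE hEm => (hν E hEm).trans (hm h' E hE hEm), fun ν' hν' => ?_⟩
  ext E hE
  rw [hν E hE]
  conv_lhs => rw [← hEP E]
  rw [measure_iUnion (fun i j hij => (hPd hij).mono inter_subset_right inter_subset_right)
    (fun k => hE.inter (hPm k))]
  exact tsum_congr fun k =>
    hν' _ _ _ (hchart (a k)) _ (inter_subset_right.trans (hPW k)) (hE.inter (hPm k))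

end Weil

/-! ### Residue classes of integral points -/

section Classes
open Filter Set IsLocalRing

variable (p : ℕ) [Fact p.Prime] {F : Type u} [NontriviallyNormedField F] [NormedAlgebra ℚ_[p] F]
  {X : Scheme.{u}} {f : X ⟶ Spec (.of (integers p F))} {n : ℕ}

/-- The residue class of a point with values in the residue field: the integral points which
reduce to it. -/
def residueClass (x : Points f (Residue p F)) : Set (Points f (integers p F)) :=
  {y | y.map (Residue p F) = x}

variable {p}

instance : IsLocalHom (algebraMap (integers p F) (Residue p F)) :=
  inferInstanceAs (IsLocalHom (residue (integers p F)))

theorem preimage_map_residue_iff {y : Points f (integers p F)} {V : X.Opens} :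
    (y.map (Residue p F)).1 ⁻¹ᵁ V = ⊤ ↔ y.1 ⁻¹ᵁ V = ⊤ :=
  ⟨Points.preimage_of_preimage_map _, Points.preimage_map _⟩

theorem residueClass_subset_pointsIn {x : Points f (Residue p F)} {V : X.Opens}
    (hx : x.1 ⁻¹ᵁ V = ⊤) : residueClass p x ⊆ pointsIn f (integers p F) V := by
  rintro y rfl
  exact preimage_map_residue_iff.1 hx

theorem eval_map_residue {y : Points f (integers p F)} {V : X.affineOpens} (hy : y.1 ⁻¹ᵁ V.1 = ⊤)
    (s : Sections f V.1) :
    (y.map (Residue p F)).eval (Points.preimage_map _ hy) s =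
      residue (integers p F) (y.eval hy s) :=
  Points.eval_map _ hy s

theorem residueClass_eval {x : Points f (Residue p F)} {V : X.affineOpens} (hx : x.1 ⁻¹ᵁ V.1 = ⊤)
    {y : Points f (integers p F)} (hy : y ∈ residueClass p x) (s : Sections f V.1) :
    residue (integers p F) (y.eval (residueClass_subset_pointsIn hx hy) s) = x.eval hx s := by
  obtain rfl := hy
  exact (eval_map_residue _ s).symm

theorem mem_residueClass_iff {x : Points f (Residue p F)} {V : X.affineOpens} (hx : x.1 ⁻¹ᵁ V.1 = ⊤)
    {y : Points f (integers p F)} (hy : y.1 ⁻¹ᵁ V.1 = ⊤) :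
    y ∈ residueClass p x ↔ ∀ s, residue (integers p F) (y.eval hy s) = x.eval hx s := by
  refine ⟨fun h => residueClass_eval hx h, fun h => ?_⟩
  exact Points.ext_of_evalHom (Points.preimage_map _ hy) hx fun s =>
    (eval_map_residue hy s).trans (h s)

theorem coordMap_map {V : X.affineOpens} (t : Fin n → Sections f V.1) {y : Points f (integers p F)}
    (hy : y.1 ⁻¹ᵁ V.1 = ⊤) :
    coordMap t (y.map F) = fun i => ((y.eval hy (t i) : integers p F) : F) := by
  rw [coordMap_eq t (Points.preimage_map F hy)]
  exact funext fun i => Points.eval_map F hy (t i)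

/-- The integral points of an affine open subscheme form a topological subspace of its `F`-valued
points. -/
theorem isEmbedding_map [Smooth f] (V : X.affineOpens) :
    IsEmbedding fun y : pointsIn f (integers p F) V.1 => y.1.map F := by
  obtain ⟨m, g, hg⟩ := exists_generators (f := f) V
  let φ : pointsIn f (integers p F) V.1 → pointsIn f F V.1 :=
    fun y => ⟨y.1.map F, Points.preimage_map F y.2⟩
  have h1 := isInducing_eval_generators (A := F) V g hg
  have h2 := isInducing_eval_generators (A := integers p F) V g hg
  have h3 : IsInducing fun (z : Fin m → integers p F) i => (z i : F) :=
    IsInducing.piMap fun _ => IsInducing.subtypeVal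
  have h4 : IsInducing φ := by
    refine h1.of_comp_iff.1 ?_
    convert h3.comp h2 using 1
    funext y i
    exact Points.eval_map F y.2 (g i)
  refine ⟨IsInducing.subtypeVal.comp h4, fun y y' h => Subtype.ext ?_⟩
  refine Points.ext_of_evalHom y.2 y'.2 fun s => Subtype.ext ?_
  have e1 := Points.eval_map F y.2 s
  have e2 := Points.eval_map F y'.2 s
  have h' : y.1.map F = y'.1.map F := h
  refine e1.symm.trans (Eq.trans ?_ e2)
  simp only [h']

/-- An `F`-valued point whose values on generators of the ring of functions lie in the residue
classes given by `x` is integral, so the residue class of `x` is open in the space of `F`-valued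
points. -/
theorem isOpen_image_residueClass [Smooth f] (x : Points f (Residue p F)) :
    IsOpen (Points.map F '' residueClass p x) := by
  have := isUltrametricDist_of_padic p F
  obtain ⟨V, -, hx⟩ := x.exists_affine (U := ⊤) rfl
  obtain ⟨m, g, hg⟩ := exists_generators (f := f) V
  choose a ha using fun i => residue_surjective (x.eval hx (g i))
  let O : Set (Points f F) := ⋂ i,
    {y | ∃ hy : y.1 ⁻¹ᵁ V.1 = ⊤, y.eval hy (g i) ∈ Metric.ball (a i : F) 1}
  have hO : IsOpen (pointsIn f F V.1 ∩ O) := (isOpen_pointsIn_affine V).inter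
    (isOpen_iInter_of_finite fun i => isOpen_setOf_eval_mem V (g i) Metric.isOpen_ball)
  convert hO using 1
  ext y
  constructor
  · rintro ⟨z, hz, rfl⟩
    have hzV := residueClass_subset_pointsIn hx hz
    refine ⟨Points.preimage_map F hzV, mem_iInter.2 fun i => ⟨Points.preimage_map F hzV, ?_⟩⟩
    rw [Points.eval_map F hzV, mem_ball_iff_norm]
    refine (residue_eq_iff p _ _).1 ?_
    rw [residueClass_eval hx hz, ha]
  · rintro ⟨(hy : y.1 ⁻¹ᵁ V.1 = ⊤), hyO⟩
    have hb : ∀ i, ‖y.eval hy (g i) - a i‖ < 1 := fun i => by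
      obtain ⟨_, h⟩ := mem_iInter.1 hyO i
      exact mem_ball_iff_norm.1 h
    have hint : ∀ i, y.eval hy (g i) ∈ integers p F := fun i => by
      have h := IsUltrametricDist.norm_add_le_max (y.eval hy (g i) - a i) (a i : F)
      rw [sub_add_cancel] at h
      exact h.trans (max_le (hb i).le (a i).2)
    -- the integral point with the same values on the generators
    have hfac : ∀ Q : MvPolynomial (Fin m) (integers p F), y.eval hy (MvPolynomial.aeval g Q) =
        algebraMap (integers p F) F
          (MvPolynomial.aeval (fun i => (⟨_, hint i⟩ : integers p F)) Q) := by
      intro Q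
      rw [Points.eval_aeval, ← MvPolynomial.aeval_algebraMap_apply]
      rfl
    have hintall : ∀ s, y.evalHom hy s ∈ (IsScalarTower.toAlgHom (integers p F) (integers p F) F
        ).range := by
      intro s
      obtain ⟨Q, rfl⟩ := hg s
      exact ⟨_, (hfac Q).symm⟩
    let ι := AlgEquiv.ofInjective (IsScalarTower.toAlgHom (integers p F) (integers p F) F)
      Subtype.val_injective
    let ψ : Sections f V.1 →ₐ[integers p F] integers p F :=
      (ι.symm : _ →ₐ[integers p F] _).comp ((y.evalHom hy).codRestrict _ hintall)
    have hψ : ∀ s, ((ψ s : integers p F) : F) = y.eval hy s := fun s =>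
      congrArg Subtype.val (ι.apply_symm_apply ((y.evalHom hy).codRestrict _ hintall s))
    have hzV := Points.preimage_ofAlgHom V ψ
    have hev : ∀ s, (Points.ofAlgHom V ψ).eval hzV s = ψ s := fun s =>
      congr($(Points.evalHom_ofAlgHom V ψ) s)
    refine ⟨Points.ofAlgHom V ψ, ?_, ?_⟩
    · refine (mem_residueClass_iff hx hzV).2 fun s => ?_
      rw [hev]
      obtain ⟨Q, rfl⟩ := hg s
      have e : ((IsScalarTower.toAlgHom (integers p F) (integers p F) (Residue p F)).comp ψ).comp
          (MvPolynomial.aeval g) = (x.evalHom hx).comp (MvPolynomial.aeval g) := by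
        refine MvPolynomial.algHom_ext fun i => ?_
        have h1 : residue (integers p F) (ψ (g i)) = x.eval hx (g i) := by
          rw [← ha, residue_eq_iff, hψ]
          exact hb i
        simp only [AlgHom.comp_apply, MvPolynomial.aeval_X]
        exact h1
      exact congr($e Q)
    · refine Points.ext_of_evalHom (Points.preimage_map F hzV) hy fun s => ?_
      rw [Points.eval_map F hzV, hev]
      exact hψ s

theorem injOn_map_pointsIn [Smooth f] (V : X.affineOpens) :
    InjOn (Points.map F) (pointsIn f (integers p F) V.1) := fun y hy y' hy' h =>
  congrArg Subtype.val ((isEmbedding_map V).injective (a₁ := ⟨y, hy⟩) (a₂ := ⟨y', hy'⟩) h)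

theorem injOn_map_residueClass [Smooth f] (x : Points f (Residue p F)) :
    InjOn (Points.map F) (residueClass p x) := by
  obtain ⟨V, -, hx⟩ := x.exists_affine (U := ⊤) rfl
  exact (injOn_map_pointsIn V).mono (residueClass_subset_pointsIn hx)

theorem isOpen_residueClass [Smooth f] (x : Points f (Residue p F)) :
    IsOpen (residueClass p x) := by
  obtain ⟨V, -, hx⟩ := x.exists_affine (U := ⊤) rfl
  have h1 := (isOpen_image_residueClass x).preimage (isEmbedding_map V).continuous
  have h2 := (isOpen_pointsIn_affine (f := f) (A := integers p F) V).isOpenMap_subtype_val _ h1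
  convert h2 using 1
  ext y
  constructor
  · intro hy
    exact ⟨⟨y, residueClass_subset_pointsIn hx hy⟩, ⟨y, hy, rfl⟩, rfl⟩
  · rintro ⟨z, ⟨y', hy', hz⟩, rfl⟩
    rw [← injOn_map_pointsIn V (residueClass_subset_pointsIn hx hy') z.2 hz]
    exact hy'

theorem residueClass_disjoint {x x' : Points f (Residue p F)} (h : x ≠ x') :
    Disjoint (residueClass p x) (residueClass p x') :=
  disjoint_left.2 fun _ hy hy' => h (hy.symm.trans hy')

theorem iUnion_inter_residueClass (E : Set (Points f (integers p F))) :
    ⋃ x, E ∩ residueClass p x = E := by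
  rw [← inter_iUnion]
  exact inter_eq_left.2 fun y _ => mem_iUnion.2 ⟨_, rfl⟩

theorem measurableSet_image_ofOpen (U : X.Opens) {E : Set (Points (U.ι ≫ f) (integers p F))}
    (hE : MeasurableSet E) : MeasurableSet (Points.ofOpen '' E) :=
  (isOpenEmbedding_ofOpen U).measurableEmbedding.measurableSet_image.2 hE

theorem isOpenEmbedding_map_residueClass [Smooth f] (x : Points f (Residue p F)) :
    IsOpenEmbedding ((residueClass p x).domRestrict (Points.map F)) := by
  obtain ⟨V, -, hx⟩ := x.exists_affine (U := ⊤) rfl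
  have hsub := residueClass_subset_pointsIn (p := p) hx
  refine ⟨(isEmbedding_map V).comp (IsEmbedding.inclusion hsub), ?_⟩
  rw [range_domRestrict]
  exact isOpen_image_residueClass x

theorem measurableSet_image_map [Smooth f] (x : Points f (Residue p F))
    {E : Set (Points f (integers p F))} (hE : E ⊆ residueClass p x) (hEm : MeasurableSet E) :
    MeasurableSet (Points.map F '' E) :=
  (isOpenEmbedding_map_residueClass x).measurableSet_image_of_domRestrict hE hEm

variable [FiniteDimensional ℚ_[p] F]

/-- Étale coordinates are injective on a residue class, by the uniqueness part of Hensel's lemma. -/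
theorem injOn_coordMap_residueClass [Smooth f] {V : X.affineOpens} {t : Fin n → Sections f V.1}
    (ht : IsEtaleCoordinates t) {x : Points f (Residue p F)} (hx : x.1 ⁻¹ᵁ V.1 = ⊤) :
    InjOn (coordMap t) (Points.map F '' residueClass p x) := by
  have := smooth_sections (f := f) V
  rintro _ ⟨y, hy, rfl⟩ _ ⟨y', hy', rfl⟩ h
  have hyV := residueClass_subset_pointsIn hx hy
  have hyV' := residueClass_subset_pointsIn hx hy'
  rw [coordMap_map t hyV, coordMap_map t hyV'] at h
  obtain ⟨b, hb⟩ := ht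
  have key : y.evalHom hyV = y'.evalHom hyV' := by
    refine lift_of_residue_unique (iInf_maximalIdeal_pow p F) b hb (fun s => ?_)
      (fun i => Subtype.ext (congrFun h i))
    exact (residueClass_eval hx hy s).trans (residueClass_eval hx hy' s).symm
  rw [Points.ext_of_evalHom hyV hyV' fun s => congr($key s)]

/-- Étale coordinates map a residue class onto a translate of `𝔪 ^ n`, by the existence part of
Hensel's lemma. -/
theorem exists_image_coordMap_residueClass [Smooth f] {V : X.affineOpens}
    {t : Fin n → Sections f V.1}
    (ht : IsEtaleCoordinates t) {x : Points f (Residue p F)} (hx : x.1 ⁻¹ᵁ V.1 = ⊤) :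
    ∃ z : Fin n → F, coordMap t '' (Points.map F '' residueClass p x) =
      {w | ∀ i, ‖w i - z i‖ < 1} := by
  have := smooth_sections (f := f) V
  have := isUltrametricDist_of_padic p F
  choose z hz using fun i => residue_surjective (x.eval hx (t i))
  refine ⟨fun i => z i, ?_⟩
  ext w
  constructor
  · rintro ⟨_, ⟨y, hy, rfl⟩, rfl⟩ i
    have hyV := residueClass_subset_pointsIn hx hy
    rw [coordMap_map t hyV]
    exact (residue_eq_iff p _ _).1 ((residueClass_eval hx hy (t i)).trans (hz i).symm)
  · intro hw
    have hint : ∀ i, w i ∈ integers p F := fun i => by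
      have h := IsUltrametricDist.norm_add_le_max (w i - z i) (z i : F)
      rw [sub_add_cancel] at h
      exact h.trans (max_le (hw i).le (z i).2)
    obtain ⟨b, hb⟩ := ht
    obtain ⟨ψ, h1, h2⟩ := exists_lift_of_residue b hb (x.evalHom hx)
      (fun i => (⟨w i, hint i⟩ : integers p F)) fun i =>
        ((residue_eq_iff p _ _).2 (hw i)).trans (hz i)
    have hyV := Points.preimage_ofAlgHom V ψ
    have hev : ∀ s, (Points.ofAlgHom V ψ).eval hyV s = ψ s := fun s =>
      congr($(Points.evalHom_ofAlgHom V ψ) s)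
    refine ⟨_, ⟨Points.ofAlgHom V ψ, (mem_residueClass_iff hx hyV).2 fun s => ?_, rfl⟩, ?_⟩
    · rw [hev]; exact h1 s
    · rw [coordMap_map t hyV]
      funext i
      rw [hev, h2]

theorem isOpenEmbedding_coordMap_residueClass [Smooth f] {V : X.affineOpens}
    {t : Fin n → Sections f V.1}
    (ht : IsEtaleCoordinates t) {x : Points f (Residue p F)} (hx : x.1 ⁻¹ᵁ V.1 = ⊤) :
    IsOpenEmbedding ((Points.map F '' residueClass p x).domRestrict (coordMap t)) := by
  have := properSpace_of_padic p F
  refine isOpenEmbedding_domRestrict (isOpen_image_residueClass x)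
    (injOn_coordMap_residueClass ht hx) ?_
  rintro _ ⟨y, hy, rfl⟩
  exact map_coordMap_nhds ht (Points.preimage_map F (residueClass_subset_pointsIn hx hy))

variable [MeasurableSpace F] [BorelSpace F]

theorem measurableSet_image_coordMap [Smooth f] {V : X.affineOpens}
    {t : Fin n → Sections f V.1}
    (ht : IsEtaleCoordinates t) {x : Points f (Residue p F)} (hx : x.1 ⁻¹ᵁ V.1 = ⊤)
    {E : Set (Points f (integers p F))} (hE : E ⊆ residueClass p x) (hEm : MeasurableSet E) :
    MeasurableSet (coordMap t '' (Points.map F '' E)) := by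
  have := properSpace_of_padic p F
  exact (isOpenEmbedding_coordMap_residueClass ht hx).measurableSet_image_of_domRestrict
    (image_mono hE) (measurableSet_image_map x hE hEm)

/-- A unit of the ring of integers has normalised absolute value one, because multiplication by it
preserves the unit disc, whose Haar measure is one. -/
theorem absNorm_eq_one_of_isUnit {u : integers p F} (hu : IsUnit u) : absNorm p (u : F) = 1 := by
  have hu1 := (isUnit_integers_iff p u).1 hu
  have hu0 : (u : F) ≠ 0 := norm_ne_zero_iff.1 (by rw [hu1]; exact one_ne_zero)
  let A : (Fin 1 → F) →L[F] (Fin 1 → F) := (u : F) • ContinuousLinearMap.id F _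
  have hA : A.det = u := by
    have : A.det = LinearMap.det ((u : F) • (LinearMap.id : (Fin 1 → F) →ₗ[F] _)) := rfl
    rw [this, LinearMap.det_smul]; simp
  -- multiplication by `u` preserves the unit disc
  have himg : A '' Metric.closedBall 0 1 = Metric.closedBall 0 1 := by
    have hnorm : ∀ v, ‖A v‖ = ‖v‖ := fun v => by
      have : A v = (u : F) • v := rfl
      rw [this, norm_smul, hu1, one_mul]
    ext w
    simp only [mem_image, Metric.mem_closedBall, dist_zero_right]
    constructor
    · rintro ⟨v, hv, rfl⟩; rwa [hnorm]
    · intro hw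
      have : A ((u : F)⁻¹ • w) = w := by
        have : A ((u : F)⁻¹ • w) = (u : F) • (u : F)⁻¹ • w := rfl
        rw [this, smul_inv_smul₀ hu0]
      exact ⟨(u : F)⁻¹ • w, by rwa [← hnorm, this], this⟩
  have h := haar_image_linear p A (by rw [hA]; exact hu0) (Metric.closedBall 0 1)
  rw [himg, haar_closedBall, hA, mul_one] at h
  exact ENNReal.ofReal_eq_one.1 h.symm

/-- The Weil measure of a gauge form is the Haar measure in étale coordinates over the integers,
because its coefficient is a unit. -/
theorem Form.IsWeilMeasure.apply_image_map [Smooth f] {ω : Form f n} (hω : ω.IsGauge)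
    {ν : Measure (Points f F)} (hν : ω.IsWeilMeasure p ν) {V : X.affineOpens}
    {t : Fin n → Sections f V.1} (ht : IsEtaleCoordinates t) {x : Points f (Residue p F)}
    (hx : x.1 ⁻¹ᵁ V.1 = ⊤) {E : Set (Points f (integers p F))} (hE : E ⊆ residueClass p x)
    (hEm : MeasurableSet E) :
    ν (Points.map F '' E) = haar p F n (coordMap t '' (Points.map F '' E)) := by
  have := properSpace_of_padic p F
  obtain ⟨h, hu, hh⟩ := hω.exists_unit V ht
  rcases E.eq_empty_or_nonempty with rfl | ⟨y₀, hy₀⟩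
  · simp
  have : Nonempty (Points f F) := ⟨y₀.map F⟩
  have hinj := injOn_coordMap_residueClass ht hx
  let σ := Function.invFunOn (coordMap t) (Points.map F '' residueClass p x)
  have hσ : ∀ y ∈ Points.map F '' residueClass p x, σ (coordMap t y) = y := fun y hy =>
    hinj.leftInvOn_invFunOn hy
  have hchart : ω.IsChart (Points.map F '' residueClass p x) (coordMap t)
      fun z => Points.value h (σ z) := by
    refine ⟨isOpen_image_residueClass x, hinj, fun y hy => ?_⟩
    rw [hσ y hy]
    obtain ⟨y', hy', rfl⟩ := hy
    have hyV := Points.preimage_map F (residueClass_subset_pointsIn hx hy')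
    rw [Points.value_eq h hyV]
    exact ω.hasCoefficientAt_coordMap ht hh hyV
  rw [hν _ _ _ hchart _ (image_mono hE) (measurableSet_image_map x hE hEm)]
  rw [setLIntegral_congr_fun (measurableSet_image_coordMap ht hx hE hEm) (g := fun _ => 1),
    setLIntegral_one]
  rintro _ ⟨_, ⟨y, hy, rfl⟩, rfl⟩
  have hyV := residueClass_subset_pointsIn hx (hE hy)
  have hyV' := Points.preimage_map F hyV
  dsimp only
  rw [hσ _ (mem_image_of_mem _ (hE hy)), Points.value_eq h hyV']
  have e : (y.map F).eval hyV' h = ((y.eval hyV h : integers p F) : F) := Points.eval_map F hyV h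
  have hu' : IsUnit (y.eval hyV h) := hu.map (y.evalHom hyV)
  rw [e, absNorm_eq_one_of_isUnit hu', ENNReal.ofReal_one]

end Classes

/-! ### The canonical measure -/

section Canonical
open Filter Set IsLocalRing

variable (p : ℕ) [Fact p.Prime] {F : Type u} [NontriviallyNormedField F] [NormedAlgebra ℚ_[p] F]
  [FiniteDimensional ℚ_[p] F] {X : Scheme.{u}} {f : X ⟶ Spec (.of (integers p F))} {n : ℕ}

theorem smoothOfRelativeDimension_ι_comp {R : Type u} [CommRing R] {X : Scheme.{u}}
    (f : X ⟶ Spec (.of R)) (n : ℕ) [SmoothOfRelativeDimension n f] (U : X.Opens) :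
    SmoothOfRelativeDimension n (U.ι ≫ f) := by
  have h : SmoothOfRelativeDimension (0 + n) (U.ι ≫ f) := inferInstance
  rwa [zero_add] at h

/-- The `F`-valued points of a smooth scheme of finite type over the integers have a countable
basis of open sets, and so have those of its open subschemes. -/
theorem secondCountableTopology_points_ι_comp [Smooth f] [QuasiCompact f] (U : X.Opens) :
    SecondCountableTopology (Points (U.ι ≫ f) F) := by
  have := properSpace_of_padic p F
  have : CompactSpace X := QuasiCompact.compactSpace_of_compactSpace f
  have := secondCountableTopology_points (f := f) (A := F)
  exact (isOpenEmbedding_ofOpen U).isEmbedding.secondCountableTopology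

variable [MeasurableSpace F] [BorelSpace F]

theorem existsUnique_isWeilMeasure_ι_comp [SmoothOfRelativeDimension n f] [QuasiCompact f]
    (U : X.Opens) (ω : Form (U.ι ≫ f) n) :
    ∃! ν : Measure (Points (U.ι ≫ f) F), ω.IsWeilMeasure p ν := by
  have : Smooth f := SmoothOfRelativeDimension.smooth n f
  have := smoothOfRelativeDimension_ι_comp f n U
  have := secondCountableTopology_points_ι_comp p (f := f) U
  exact ω.existsUnique_isWeilMeasure p

/-- On a residue class the Weil measure of a gauge form on `U` is the Haar measure in any étale
coordinates of `X` at this class. -/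
theorem Form.IsWeilMeasure.apply_image_map_of_open [Smooth f] {U : X.Opens}
    {ω : Form (U.ι ≫ f) n} (hω : ω.IsGauge) {ν : Measure (Points (U.ι ≫ f) F)}
    (hν : ω.IsWeilMeasure p ν) {V : X.affineOpens} {t : Fin n → Sections f V.1}
    (ht : IsEtaleCoordinates t) {x : Points f (Residue p F)} (hx : x.1 ⁻¹ᵁ V.1 = ⊤)
    {E : Set (Points (U.ι ≫ f) (integers p F))} (hE : Points.ofOpen '' E ⊆ residueClass p x)
    (hEm : MeasurableSet E) :
    ν (Points.map F '' E) =
      haar p F n (coordMap t '' (Points.map F '' (Points.ofOpen '' E))) := by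
  rcases E.eq_empty_or_nonempty with rfl | ⟨y₀, hy₀⟩
  · simp
  let x₀ : Points (U.ι ≫ f) (Residue p F) := y₀.map (Residue p F)
  have hx₀ : x₀.ofOpen = x :=
    (Points.map_ofOpen (Residue p F) y₀).symm.trans (hE ⟨y₀, hy₀, rfl⟩)
  have hE₀ : E ⊆ residueClass p x₀ := fun y hy => Points.ofOpen_injective (by
    rw [hx₀, ← Points.map_ofOpen]
    exact hE ⟨y, hy, rfl⟩)
  -- restrict the coordinates to an affine neighbourhood of the class inside `U`
  have hxU : x.1 ⁻¹ᵁ U = ⊤ := hx₀ ▸ x₀.preimage_ofOpen_self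
  obtain ⟨V', hV', hxV'⟩ := x.exists_affine (Points.preimage_inf hx hxU)
  have hV'V : V'.1 ≤ V.1 := hV'.trans inf_le_left
  have hV'U : V'.1 ≤ U := hV'.trans inf_le_right
  let W := affinePreimage U V' hV'U
  have hle : W.1 ≤ U.ι ⁻¹ᵁ V.1 := U.ι.preimage_mono hV'V
  have hx₀W : x₀.1 ⁻¹ᵁ W.1 = ⊤ := by
    rw [← hx₀] at hxV'
    exact hxV'
  rw [hν.apply_image_map hω (ht.pull hle) hx₀W hE₀ hEm]
  congr 1
  rw [image_image, image_image, image_image]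
  refine image_congr fun y hy => ?_
  have hyW := residueClass_subset_pointsIn hx₀W (hE₀ hy)
  have hyV : (Points.ofOpen y).1 ⁻¹ᵁ V.1 = ⊤ :=
    residueClass_subset_pointsIn hx (hE ⟨y, hy, rfl⟩)
  rw [coordMap_map _ hyW, coordMap_map _ hyV]
  exact funext fun i => congrArg Subtype.val (Points.eval_pull y hle hyW hyV (t i))

/-- Two canonical measures agree: a residue class lies in an affine open set with étale
coordinates `t`, where both restrict to the Weil measure of `dt₁ ∧ … ∧ dtₙ`. -/
theorem IsCanonicalMeasure.eq [SmoothOfRelativeDimension n f] [QuasiCompact f]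
    {μ μ' : Measure (Points f (integers p F))} (hμ : IsCanonicalMeasure p f n μ)
    (hμ' : IsCanonicalMeasure p f n μ') : μ' = μ := by
  have : Smooth f := SmoothOfRelativeDimension.smooth n f
  have : CompactSpace X := QuasiCompact.compactSpace_of_compactSpace f
  have : Finite (Points f (Residue p F)) := finite_points
  ext E hE
  have hm : ∀ x, MeasurableSet (E ∩ residueClass p x) := fun x =>
    hE.inter (isOpen_residueClass x).measurableSet
  have hd : Pairwise (Function.onFun Disjoint fun x : Points f (Residue p F) =>
      E ∩ residueClass p x) := fun x x' h =>
    (residueClass_disjoint h).mono inter_subset_right inter_subset_right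
  conv_lhs => rw [← iUnion_inter_residueClass E]
  conv_rhs => rw [← iUnion_inter_residueClass E]
  rw [measure_iUnion hd hm, measure_iUnion hd hm]
  refine tsum_congr fun x => ?_
  obtain ⟨V, -, hxV, t, ht⟩ := exists_isEtaleCoordinates (f := f) (n := n) ⊤
    (x := x.1 (closedPoint (Residue p F))) trivial
  have hx : x.1 ⁻¹ᵁ V.1 = ⊤ := (closedPoint_mem_iff (x.1 ⁻¹ᵁ V.1)).1 hxV
  obtain ⟨ν, hν, -⟩ := existsUnique_isWeilMeasure_ι_comp p V.1 (coordinateForm t)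
  let E' : Set (Points (V.1.ι ≫ f) (integers p F)) := Points.ofOpen ⁻¹' (E ∩ residueClass p x)
  have hE' : Points.ofOpen '' E' = E ∩ residueClass p x := by
    refine image_preimage_eq_of_subset ?_
    rw [Points.range_ofOpen]
    exact inter_subset_right.trans (residueClass_subset_pointsIn hx)
  have hE'm : MeasurableSet E' := (isOpenEmbedding_ofOpen V.1).continuous.measurable (hm x)
  have hinj : InjOn (Points.map F) E' := by
    intro y hy y' hy' h
    refine Points.ofOpen_injective (injOn_map_residueClass x hy.2 hy'.2 ?_)
    rw [Points.map_ofOpen, Points.map_ofOpen, h]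
  rw [← hE', hμ V.1 _ (coordinateForm_isGauge ht) ν hν E' hE'm hinj,
    hμ' V.1 _ (coordinateForm_isGauge ht) ν hν E' hE'm hinj]

/-- The canonical measure is glued from the Haar measures in étale coordinates at the finitely many
residue classes, each of which has the measure of a translate of `𝔪 ^ n`. -/
theorem exists_isCanonicalMeasure [SmoothOfRelativeDimension n f] [QuasiCompact f] :
    ∃ μ : Measure (Points f (integers p F)), IsCanonicalMeasure p f n μ ∧
      μ univ = (Nat.card (Points f (Residue p F)) : ℝ≥0∞) /
        (Nat.card (Residue p F) : ℝ≥0∞) ^ n := by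
  have : Smooth f := SmoothOfRelativeDimension.smooth n f
  have : CompactSpace X := QuasiCompact.compactSpace_of_compactSpace f
  have : Finite (Points f (Residue p F)) := finite_points
  have hcoord : ∀ x : Points f (Residue p F), ∃ V : X.affineOpens, x.1 ⁻¹ᵁ V.1 = ⊤ ∧
      ∃ t : Fin n → Sections f V.1, IsEtaleCoordinates t := by
    intro x
    obtain ⟨V, -, hxV, ht⟩ := exists_isEtaleCoordinates (f := f) (n := n) ⊤
      (x := x.1 (closedPoint (Residue p F))) trivial
    exact ⟨V, (closedPoint_mem_iff (x.1 ⁻¹ᵁ V.1)).1 hxV, ht⟩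
  choose V hV t ht using hcoord
  let m (E : Set (Points f (integers p F))) : ℝ≥0∞ :=
    ∑' x, haar p F n (coordMap (t x) '' (Points.map F '' (E ∩ residueClass p x)))
  have hcm : ∀ x, MeasurableSet (residueClass p x : Set (Points f (integers p F))) := fun x =>
    (isOpen_residueClass x).measurableSet
  let μ : Measure (Points f (integers p F)) := Measure.ofMeasurable (fun E _ => m E)
    (by simp [m]) (by
      intro E hE hd
      simp only [m]
      rw [ENNReal.tsum_comm]
      refine tsum_congr fun x => ?_
      rw [iUnion_inter, image_iUnion, image_iUnion]
      refine measure_iUnion (fun i j hij => ?_) fun i =>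
        measurableSet_image_coordMap (ht x) (hV x) inter_subset_right ((hE i).inter (hcm x))
      refine Disjoint.image ?_ (injOn_coordMap_residueClass (ht x) (hV x))
        (image_mono inter_subset_right) (image_mono inter_subset_right)
      exact ((hd hij).mono inter_subset_left inter_subset_left).image (injOn_map_residueClass x)
        inter_subset_right inter_subset_right)
  have hμ : ∀ E, MeasurableSet E → μ E = m E := fun E hE => Measure.ofMeasurable_apply E hE
  refine ⟨μ, ?_, ?_⟩
  · intro U ω hω ν hν E hE hinj
    let C (x : Points f (Residue p F)) : Set (Points (U.ι ≫ f) (integers p F)) :=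
      E ∩ Points.ofOpen ⁻¹' residueClass p x
    have hC : ∀ x, Points.ofOpen '' C x = Points.ofOpen '' E ∩ residueClass p x := fun x =>
      image_inter_preimage _ _ _
    have hCs : ∀ x, Points.ofOpen '' C x ⊆ residueClass p x := fun x => by
      rw [hC]; exact inter_subset_right
    have hCm : ∀ x, MeasurableSet (C x) := fun x =>
      hE.inter ((isOpenEmbedding_ofOpen U).continuous.measurable (hcm x))
    have hCU : ⋃ x, C x = E := by
      rw [← inter_iUnion]
      exact inter_eq_left.2 fun y _ => mem_iUnion.2 ⟨_, rfl⟩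
    -- cut `E` along the residue classes of `X`, on which both sides are Haar measures
    rw [hμ _ (measurableSet_image_ofOpen U hE)]
    conv_rhs => rw [← hCU]
    rw [image_iUnion, measure_iUnion]
    · refine tsum_congr fun x => ?_
      rw [hν.apply_image_map_of_open p hω (ht x) (hV x) (hCs x) (hCm x), hC]
    · intro x x' h
      refine Disjoint.image ?_ hinj inter_subset_left inter_subset_left
      exact ((residueClass_disjoint h).preimage Points.ofOpen).mono inter_subset_right
        inter_subset_right
    · intro x
      rcases (C x).eq_empty_or_nonempty with h | ⟨y₀, hy₀⟩
      · rw [h]; simp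
      refine measurableSet_image_map (y₀.map (Residue p F)) (fun y hy => ?_) (hCm x)
      refine Points.ofOpen_injective ?_
      rw [← Points.map_ofOpen, ← Points.map_ofOpen]
      exact hy.2.trans hy₀.2.symm
  · rw [hμ _ MeasurableSet.univ]
    have hx : ∀ x : Points f (Residue p F),
        haar p F n (coordMap (t x) '' (Points.map F '' (univ ∩ residueClass p x))) =
          ((Nat.card (Residue p F) : ℝ≥0∞) ^ n)⁻¹ := by
      intro x
      obtain ⟨z, hz⟩ := exists_image_coordMap_residueClass (ht x) (hV x)
      rw [univ_inter, hz, haar_ball]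
    have : Fintype (Points f (Residue p F)) := Fintype.ofFinite _
    simp only [m, hx]
    rw [tsum_fintype, Finset.sum_const, Finset.card_univ, nsmul_eq_mul, ← Nat.card_eq_fintype_card,
      div_eq_mul_inv]

end Canonical
end PadicMeasure

theorem mainTheorem5 (p : ℕ) [Fact p.Prime] (F : Type u) [NontriviallyNormedField F]
    [NormedAlgebra ℚ_[p] F] [FiniteDimensional ℚ_[p] F] [MeasurableSpace F] [BorelSpace F]
    (n : ℕ) (X : Scheme.{u}) (f : X ⟶ Spec (.of (PadicMeasure.integers p F)))
    [SmoothOfRelativeDimension n f] [QuasiCompact f] :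
    (∀ (U : X.Opens) (ω : PadicMeasure.Form (U.ι ≫ f) n), ω.IsGauge →
      ∃! ν : Measure (PadicMeasure.Points (U.ι ≫ f) F), ω.IsWeilMeasure p ν) ∧
    ∃ μ : Measure (PadicMeasure.Points f (PadicMeasure.integers p F)),
      PadicMeasure.IsCanonicalMeasure p f n μ ∧
      (∀ μ' : Measure (PadicMeasure.Points f (PadicMeasure.integers p F)),
        PadicMeasure.IsCanonicalMeasure p f n μ' → μ' = μ) ∧
      Finite (PadicMeasure.Residue p F) ∧
      Finite (PadicMeasure.Points f (PadicMeasure.Residue p F)) ∧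
      μ Set.univ = (Nat.card (PadicMeasure.Points f (PadicMeasure.Residue p F)) : ℝ≥0∞) /
        (Nat.card (PadicMeasure.Residue p F) : ℝ≥0∞) ^ n := by
  have : Smooth f := SmoothOfRelativeDimension.smooth n f
  have : CompactSpace X := QuasiCompact.compactSpace_of_compactSpace f
  obtain ⟨μ, hμ, hμ1⟩ := PadicMeasure.exists_isCanonicalMeasure p (f := f) (n := n)
  exact ⟨fun U ω _ => PadicMeasure.existsUnique_isWeilMeasure_ι_comp p U ω, μ, hμ,
    fun μ' hμ' => hμ.eq p hμ', inferInstance, PadicMeasure.finite_points, hμ1⟩
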